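/- **Conventions.** All graphs are finite connected metric graphs (with the path metric, and with no valence-one points). A *natural vertex* is a point of valence $>2$; a *natural edge* is a directed edge joining natural vertices with no natural vertex in its interior. A *fold* $f:G\to H$ is the quotient map that identifies $e_1(t)$ with $e_2(t)$ for $t\in[0,L]$, where $e_1,e_2$ are unit-speed parameterizations of two directed natural edges with the same initial vertex, $0<L\le\min(\mathrm{length}\,e_1,\mathrm{length}\,e_2)$, $e_1((0,L])\cap e_2((0,L])=\emptyset$, and $f$ is injective and (for path metrics) isometric off the two segments. A *split sequence of rank $n$* is a sequence of folds $\zeta: G_0\xleftarrow{f_{-1}}G_{-1}\xleftarrow{f_{-2}}G_{-2}\leftarrow\cdots$ in which every $\pi_1(G_j)$ is free of rank $n$ and every composition $f^j_0:G_j\to G_0$ is locally injective on the complement of the natural vertices of $G_j$ (write $f^j_k:G_j\to G_k$ for the composition, $j\le k\le 0$). It is *proper* if $\{f^j_0(v): j<0,\ v \text{ a natural vertex of } G_j\}$ is finite. Its *solenoid* is $X(\zeta)=\varprojlim G_j$ with projections $\pi_j:X(\zeta)\to G_j$; a *proper solenoid of rank $n$* is a space homeomorphic to the solenoid of a proper split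 sequence of rank $n$. For $K\le 0$ the *tail* $\zeta_{<K}$ is $G_K\xleftarrow{f_{K-1}}G_{K-1}\leftarrow\cdots$. An *$m$-pronged star set* ($m\ge2$) is a subset homeomorphic to $\{1,\dots,m\}\times[0,1)$ with all points $(i,0)$ identified to one point (the center); a *turn* of it is the union of the center and two distinct open prongs $\{i\}\times(0,1)$. A point $p\in G_k$ is *special* if, for some $j$, the set $f^k_j(p)$ (if $j\ge k$) or $(f^j_k)^{-1}(p)$ (if $j<k$) contains a natural vertex of $G_j$. A *standard star neighborhood* in $G_k$ is an open star set without special points other than possibly its center; a *standard turn* is a turn of one. A *standard neighborhood* of $X(\zeta)$ is $\pi_k^{-1}(V)$ with $V$ a standard star neighborhood in $G_k$; a *standard plaque* is a path component of a standard neighborhood. A *singularity* is a point $x\in X(\zeta)$ whose path component in each standard neighborhood containing it is a star set with more than two prongs; a *pre-singularity* is a point $x$ such that $\pi_j(x)$ is a natural vertex of $G_j$ for all sufficiently negative $j$. A *singular plaque* is a standard plaque that is a star set centered at a singularity; a *singular segment* is a turn of a singular plaque; a *leaf segment* is a standard plaque that is not singular. A set $L\subset X(\zeta)$ *sustains* $I\subset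 G_k$ if there is a homeomorphism $l:I\to L$ with $\pi_k\circ l=\mathrm{id}_I$; if $L$ is a leaf segment, we say that $L$ *takes* $I$. A proper split sequence $\zeta$ is *stabilized* if it satisfies - (vertex stabilizing criteria) for each level $j$ and each $q\in G_j$: (1) if $q$ is a natural vertex, then $\pi_j^{-1}(q)$ contains at most one pre-singularity; (2) otherwise, $\pi_j^{-1}(q)$ contains no pre-singularity; - (turn stabilizing criteria) for each level $k$ and each standard turn $I\subset G_k$: (3) there is no $3$-pronged star set $U\subset X(\zeta)$ with $\pi_k(U)=I$; (4) for every singular segment $L$ that sustains $I$, exactly one of the following holds: (a) for every level $j$ some leaf segment takes $\pi_j(L)$; (b) no leaf segment takes $\pi_0(L)$. (For a tail $\zeta_{<K}$, all notions are taken relative to $\zeta_{<K}$, so that its top level graph $G_K$ plays the role of $G_0$.) **Proposition.** Let $\zeta$ be a proper split sequence of rank $n$. Then there is $K\le 0$ such that the tail $\zeta_{<K}$ is a stabilized proper split sequence, and the canonical map $X(\zeta)\to X(\zeta_{<K})$ that forgets the coordinates above level $K$ is a homeomorphism. Consequently, every proper solenoid of rank $n$ is homeomorphic to the solenoid of a stabilized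 proper split sequence of rank $n$. -/

import Mathlib

open Set Topology

universe u v

namespace SplitSeq

/-! ## Model stars, star sets, turns -/

/-- The relation on `{1,…,n} × [0,1)` that glues all the points `(i,0)` to one point. -/
def starSetoid (n : ℕ) : Setoid (Fin n × Ico (0 : ℝ) 1) where
  r x y := x = y ∨ ((x.2 : ℝ) = 0 ∧ (y.2 : ℝ) = 0)
  iseqv :=
    { refl := fun _ => Or.inl rfl
      symm := by
        rintro x y (h | ⟨h, h'⟩)
        · exact Or.inl h.symm
        · exact Or.inr ⟨h', h⟩
      trans := by
        rintro x y z (rfl | ⟨h, h'⟩) (rfl | ⟨k, k'⟩)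
        · exact Or.inl rfl
        · exact Or.inr ⟨k, k'⟩
        · exact Or.inr ⟨h, h'⟩
        · exact Or.inr ⟨h, k'⟩ }

/-- The model `n`-pronged star, with the quotient topology. -/
abbrev Star (n : ℕ) : Type := Quotient (starSetoid n)

/-- The set consisting of the center of the model star (a single point when `0 < n`). -/
def starCenter (n : ℕ) : Set (Star n) :=
  {q | ∃ (i : Fin n) (t : Ico (0 : ℝ) 1), (t : ℝ) = 0 ∧ q = Quotient.mk (starSetoid n) (i, t)}

/-- The `i`-th open prong of the model star. -/
def starProng (n : ℕ) (i : Fin n) : Set (Star n) :=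
  {q | ∃ t : Ico (0 : ℝ) 1, 0 < (t : ℝ) ∧ q = Quotient.mk (starSetoid n) (i, t)}

/-- `V` is an `n`-pronged star set of `Y`, `n > 1`. -/
def IsStarSet {Y : Type u} [TopologicalSpace Y] (n : ℕ) (V : Set Y) : Prop :=
  1 < n ∧ Nonempty (Star n ≃ₜ V)

/-- `V` is a star set that can be recognized as a star with center `p`. (For three or more prongs
the center is determined by `V`; every point of a two-pronged star set can serve as center.) -/
def IsStarSetCenteredAt {Y : Type u} [TopologicalSpace Y] (V : Set Y) (p : Y) : Prop :=
  ∃ n : ℕ, 1 < n ∧ ∃ h : Star n ≃ₜ V, ∃ c ∈ starCenter n, (h c : Y) = p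

/-- `I` is a turn of the star set `V`: the union of the center and of two distinct prongs. -/
def IsTurnOf {Y : Type u} [TopologicalSpace Y] (I V : Set Y) : Prop :=
  ∃ n : ℕ, 1 < n ∧ ∃ h : Star n ≃ₜ V, ∃ i j : Fin n, i ≠ j ∧
    I = (fun q : Star n => (h q : Y)) '' (starProng n i ∪ starCenter n ∪ starProng n j)

/-! ## Metric graphs -/

/-- The point `p` has valence `n`: some open ball around `p` is isometric to the star of the same
radius with `n` prongs, with its path metric and with `p` as center; `c i` is the unit-speed
parameterization of the `i`-th prong. -/
def HasValence {G : Type u} [MetricSpace G] (p : G) (n : ℕ) : Prop :=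
  ∃ r : ℝ, 0 < r ∧ ∃ c : Fin n → ℝ → G,
    (∀ i, c i 0 = p) ∧
    (∀ i, ∀ s ∈ Ico 0 r, ∀ t ∈ Ico 0 r, dist (c i s) (c i t) = |s - t|) ∧
    (∀ i j, i ≠ j → ∀ s ∈ Ico 0 r, ∀ t ∈ Ico 0 r, dist (c i s) (c j t) = s + t) ∧
    (∀ x, x ∈ Metric.ball p r ↔ x = p ∨ ∃ i, ∃ t ∈ Ico 0 r, x = c i t)

/-- A natural vertex is a point of valence greater than two. -/
def IsNaturalVertex {G : Type u} [MetricSpace G] (p : G) : Prop :=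
  ∃ n : ℕ, 2 < n ∧ HasValence p n

/-- A finite connected metric graph, with its path metric: a compact geodesic metric space in which
every point has a valence. -/
structure IsMetricGraph (G : Type u) [MetricSpace G] : Prop where
  nonempty : Nonempty G
  compact : CompactSpace G
  geodesic : ∀ x y : G, ∃ γ : ℝ → G, γ 0 = x ∧ γ (dist x y) = y ∧
    ∀ s ∈ Icc 0 (dist x y), ∀ t ∈ Icc 0 (dist x y), dist (γ s) (γ t) = |s - t|
  valence : ∀ p : G, ∃ n : ℕ, HasValence p n

/-- A core graph of rank `n`: no point of valence one, and free fundamental group of rank `n`. -/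
structure IsCoreGraph (n : ℕ) (G : Type u) [MetricSpace G] : Prop extends IsMetricGraph G where
  no_valence_one : ∀ p : G, ¬ HasValence p 1
  rank : ∀ p : G, Nonempty (FundamentalGroup G p ≃* FreeGroup (Fin n))

/-- `e` restricted to `[0,ℓ]` is the unit-speed parameterization of a directed natural edge of
length `ℓ`: it joins two natural vertices and has no natural vertex in between. The distance in the
graph is the path metric, so that unit speed is a local condition. -/
structure IsNaturalEdge {G : Type u} [MetricSpace G] (e : ℝ → G) (ℓ : ℝ) : Prop where
  pos : 0 < ℓ
  initial : IsNaturalVertex (e 0)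
  terminal : IsNaturalVertex (e ℓ)
  interior : ∀ t ∈ Ioo 0 ℓ, ¬ IsNaturalVertex (e t)
  unit_speed : ∀ t ∈ Icc 0 ℓ, ∃ ε > 0, ∀ s ∈ Icc 0 ℓ, ∀ s' ∈ Icc 0 ℓ,
    |s - t| < ε → |s' - t| < ε → dist (e s) (e s') = |s - s'|

/-- `f : G → H` is a fold: it is the quotient map that identifies the initial segments of length
`L` of two directed natural edges `e₁`, `e₂` with the same initial vertex, where the half-open
segments `e₁ (0,L]` and `e₂ (0,L]` are disjoint; off the two segments, `f` preserves the metric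
(locally, because distances are path distances). -/
def IsFold {G H : Type u} [MetricSpace G] [MetricSpace H] (f : G → H) : Prop :=
  ∃ (e₁ e₂ : ℝ → G) (ℓ₁ ℓ₂ L : ℝ),
    IsNaturalEdge e₁ ℓ₁ ∧ IsNaturalEdge e₂ ℓ₂ ∧ e₁ 0 = e₂ 0 ∧
    0 < L ∧ L ≤ min ℓ₁ ℓ₂ ∧
    Disjoint (e₁ '' Ioc 0 L) (e₂ '' Ioc 0 L) ∧
    IsQuotientMap f ∧
    (∀ x y, f x = f y ↔ x = y ∨
      ∃ t ∈ Icc 0 L, (x = e₁ t ∧ y = e₂ t) ∨ (x = e₂ t ∧ y = e₁ t)) ∧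
    (∀ x, x ∉ e₁ '' Icc 0 L ∪ e₂ '' Icc 0 L →
      ∃ ε > 0, ∀ y ∈ Metric.ball x ε, ∀ z ∈ Metric.ball x ε, dist (f y) (f z) = dist y z)

/-- `f` has no backtracking: it is locally injective on the complement of the natural vertices. -/
def NoBacktracking {G H : Type u} [MetricSpace G] (f : G → H) : Prop :=
  ∀ x : G, ¬ IsNaturalVertex x → ∃ U ∈ 𝓝 x, InjOn f (U ∩ {y | ¬ IsNaturalVertex y})

/-! ## Split sequences -/

/-- The composition `G k → ⋯ → G j` of the bonding maps `f i : G (i+1) → G i`, for `j ≤ k`. -/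
def transit {G : ℕ → Type u} (f : ∀ k, G (k + 1) → G k) {j k : ℕ} (h : j ≤ k) : G k → G j :=
  Nat.leRec (motive := fun m _ => G m → G j) id (fun m _ g => g ∘ f m) h

theorem transit_self {G : ℕ → Type u} (f : ∀ k, G (k + 1) → G k) (j : ℕ) :
    transit f (le_refl j) = id := by
  simp [transit]

theorem transit_succ {G : ℕ → Type u} (f : ∀ k, G (k + 1) → G k) {j k : ℕ} (h : j ≤ k) :
    transit f (Nat.le_succ_of_le h) = transit f h ∘ f k := by
  unfold transit
  rw [Nat.leRec_succ _ _ h]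

theorem transit_comp_tail {G : ℕ → Type u} (f : ∀ k, G (k + 1) → G k) (K k : ℕ) :
    transit f (Nat.zero_le (K + k)) =
      transit f (Nat.zero_le K) ∘
        transit (G := fun i => G (K + i)) (fun i => f (K + i)) (Nat.zero_le k) := by
  induction k with
  | zero => rw [transit_self]; rfl
  | succ k ih =>
    have h₁ := transit_succ f (Nat.zero_le (K + k))
    have h₂ := transit_succ (G := fun i => G (K + i)) (fun i => f (K + i)) (Nat.zero_le k)
    rw [h₂, ← Function.comp_assoc, ← ih]
    exact h₁

end SplitSeq

open SplitSeq in
/-- A split sequence of rank `n`. Here `G k` is the level graph that is usually written `G_{-k}`,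
and `f k : G (k+1) → G k` is the fold `f_{-(k+1)} : G_{-(k+1)} → G_{-k}`. -/
structure SplitSequence (n : ℕ) : Type (u + 1) where
  G : ℕ → Type u
  metric : ∀ k, MetricSpace (G k)
  f : ∀ k, G (k + 1) → G k
  core : ∀ k, IsCoreGraph n (G k)
  fold : ∀ k, IsFold (f k)
  no_backtracking : ∀ k, NoBacktracking (transit f (Nat.zero_le k))

attribute [instance] SplitSequence.metric

namespace SplitSequence

open SplitSeq

/-- The composition of folds from level `k` to level `j`, `j ≤ k`. -/
def map {n : ℕ} (ζ : SplitSequence.{u} n) {j k : ℕ} (h : j ≤ k) : ζ.G k → ζ.G j :=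
  transit ζ.f h

/-- A split sequence is proper if the natural vertices of all lower levels have only finitely many
images in the top level graph. -/
def IsProper {n : ℕ} (ζ : SplitSequence.{u} n) : Prop :=
  {p : ζ.G 0 | ∃ j, 1 ≤ j ∧ ∃ v : ζ.G j, IsNaturalVertex v ∧
    ζ.map (Nat.zero_le j) v = p}.Finite

/-- The `K`-tail of a split sequence. -/
def tail {n : ℕ} (ζ : SplitSequence.{u} n) (K : ℕ) : SplitSequence.{u} n where
  G k := ζ.G (K + k)
  metric k := ζ.metric (K + k)
  f k := ζ.f (K + k)
  core k := ζ.core (K + k)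
  fold k := ζ.fold (K + k)
  no_backtracking k := by
    intro x hx
    obtain ⟨U, hU, hinj⟩ := ζ.no_backtracking (K + k) x hx
    refine ⟨U, hU, fun y hy z hz hyz => hinj hy hz ?_⟩
    rw [transit_comp_tail ζ.f K k]
    exact congrArg (transit ζ.f (Nat.zero_le K)) hyz

/-- The solenoid induced by a split sequence: the inverse limit, topologized as a subspace of the
product of the level graphs. -/
abbrev Solenoid {n : ℕ} (ζ : SplitSequence.{u} n) : Type u :=
  {x : ∀ k, ζ.G k // ∀ k, ζ.f k (x (k + 1)) = x k}

/-- The projection of the solenoid to the level graph `G j`. -/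
def proj {n : ℕ} (ζ : SplitSequence.{u} n) (j : ℕ) (x : ζ.Solenoid) : ζ.G j := x.1 j

/-- The canonical map from the solenoid of `ζ` to the solenoid of its `K`-tail, which forgets the
first `K` coordinates. -/
def toTail {n : ℕ} (ζ : SplitSequence.{u} n) (K : ℕ) (x : ζ.Solenoid) : (ζ.tail K).Solenoid :=
  ⟨fun k => x.1 (K + k), fun k => x.2 (K + k)⟩

/-- The shadow in level `j` of a subset `U` of the level graph `G k`: the image of `U` if level `j`
lies above level `k` (that is, `j ≤ k` in our indexing), the preimage otherwise. -/
def shadow {n : ℕ} (ζ : SplitSequence.{u} n) {k : ℕ} (U : Set (ζ.G k)) (j : ℕ) : Set (ζ.G j) :=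
  if h : j ≤ k then ζ.map h '' U else ζ.map (le_of_not_ge h) ⁻¹' U

/-- A point of a level graph is special if one of its shadows contains a natural vertex. -/
def IsSpecial {n : ℕ} (ζ : SplitSequence.{u} n) {k : ℕ} (p : ζ.G k) : Prop :=
  ∃ j, ∃ v ∈ ζ.shadow {p} j, IsNaturalVertex v

/-- A standard star neighborhood of `G k`: an open star set without special points other than
possibly its center. -/
def IsStandardStarNbhd {n : ℕ} (ζ : SplitSequence.{u} n) {k : ℕ} (V : Set (ζ.G k)) : Prop :=
  IsOpen V ∧ ∃ p, IsStarSetCenteredAt V p ∧ ∀ q ∈ V \ {p}, ¬ ζ.IsSpecial q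

/-- A level `k` standard turn: a turn of a standard star neighborhood of `G k`. -/
def IsStandardTurn {n : ℕ} (ζ : SplitSequence.{u} n) {k : ℕ} (I : Set (ζ.G k)) : Prop :=
  ∃ V : Set (ζ.G k), ζ.IsStandardStarNbhd V ∧ IsTurnOf I V

/-- A standard neighborhood of the solenoid: the preimage of a standard star neighborhood. -/
def IsStandardNbhd {n : ℕ} (ζ : SplitSequence.{u} n) (O : Set ζ.Solenoid) : Prop :=
  ∃ (j : ℕ) (V : Set (ζ.G j)), ζ.IsStandardStarNbhd V ∧ O = ζ.proj j ⁻¹' V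

/-- The fiber at `q`. -/
def fiber {n : ℕ} (ζ : SplitSequence.{u} n) {j : ℕ} (q : ζ.G j) : Set ζ.Solenoid :=
  ζ.proj j ⁻¹' {q}

/-- A standard plaque: a path component of a standard neighborhood. -/
def IsStandardPlaque {n : ℕ} (ζ : SplitSequence.{u} n) (V : Set ζ.Solenoid) : Prop :=
  ∃ O, ζ.IsStandardNbhd O ∧ ∃ x ∈ O, V = pathComponentIn O x

/-- A singularity: every standard neighborhood of `x` has as its path component at `x` a star set
with more than two prongs. -/
def IsSingularity {n : ℕ} (ζ : SplitSequence.{u} n) (x : ζ.Solenoid) : Prop :=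
  ∀ O, ζ.IsStandardNbhd O → x ∈ O → ∃ m, 2 < m ∧ IsStarSet m (pathComponentIn O x)

/-- A pre-singularity: all coordinates of `x` from some level on downwards are natural vertices. -/
def IsPreSingularity {n : ℕ} (ζ : SplitSequence.{u} n) (x : ζ.Solenoid) : Prop :=
  ∃ K, ∀ j, K ≤ j → IsNaturalVertex (ζ.proj j x)

/-- A singular plaque: a standard plaque that is a star set whose center is a singularity. -/
def IsSingularPlaque {n : ℕ} (ζ : SplitSequence.{u} n) (V : Set ζ.Solenoid) : Prop :=
  ζ.IsStandardPlaque V ∧ ∃ x, ζ.IsSingularity x ∧ IsStarSetCenteredAt V x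

/-- A leaf segment: a standard plaque that is not singular. -/
def IsLeafSegment {n : ℕ} (ζ : SplitSequence.{u} n) (L : Set ζ.Solenoid) : Prop :=
  ζ.IsStandardPlaque L ∧ ¬ ζ.IsSingularPlaque L

/-- A singular segment: a turn of a singular plaque. -/
def IsSingularSegment {n : ℕ} (ζ : SplitSequence.{u} n) (L : Set ζ.Solenoid) : Prop :=
  ∃ V, ζ.IsSingularPlaque V ∧ IsTurnOf L V

/-- `L` sustains `I ⊆ G k`: the projection to level `k` has a section over `I` that is a
homeomorphism from `I` onto `L`. When `L` is a leaf segment, one says that `L` takes `I`. -/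
def Sustains {n : ℕ} (ζ : SplitSequence.{u} n) {k : ℕ} (L : Set ζ.Solenoid) (I : Set (ζ.G k)) :
    Prop :=
  ∃ l : I ≃ₜ L, ∀ p : I, ζ.proj k (l p : ζ.Solenoid) = (p : ζ.G k)

/-- Some leaf segment takes `I ⊆ G k`. -/
def IsTaken {n : ℕ} (ζ : SplitSequence.{u} n) {k : ℕ} (I : Set (ζ.G k)) : Prop :=
  ∃ L, ζ.IsLeafSegment L ∧ ζ.Sustains L I

/-- The two vertex stabilizing criteria. -/
def VertexStabilized {n : ℕ} (ζ : SplitSequence.{u} n) : Prop :=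
  ∀ (j : ℕ) (q : ζ.G j),
    (IsNaturalVertex q → {x ∈ ζ.fiber q | ζ.IsPreSingularity x}.Subsingleton) ∧
    (¬ IsNaturalVertex q → ∀ x ∈ ζ.fiber q, ¬ ζ.IsPreSingularity x)

/-- The two turn stabilizing criteria. -/
def TurnStabilized {n : ℕ} (ζ : SplitSequence.{u} n) : Prop :=
  ∀ (k : ℕ) (I : Set (ζ.G k)), ζ.IsStandardTurn I →
    (¬ ∃ U : Set ζ.Solenoid, IsStarSet 3 U ∧ ζ.proj k '' U = I) ∧
    (∀ L, ζ.IsSingularSegment L → ζ.Sustains L I →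
      Xor (∀ j, ζ.IsTaken (ζ.proj j '' L)) (¬ ζ.IsTaken (ζ.proj 0 '' L)))

/-- A stabilized proper split sequence. -/
structure IsStabilizedProper {n : ℕ} (ζ : SplitSequence.{u} n) : Prop where
  proper : ζ.IsProper
  vertex : ζ.VertexStabilized
  turn : ζ.TurnStabilized

end SplitSequence

/-- A proper solenoid of rank `n`: a topological space homeomorphic to the inverse limit of a
proper split sequence of rank `n`. -/
def IsProperSolenoid (n : ℕ) (X : Type v) [TopologicalSpace X] : Prop :=
  ∃ ζ : SplitSequence.{u} n, ζ.IsProper ∧ Nonempty (X ≃ₜ ζ.Solenoid)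

open Filter

namespace SplitSeq

/-! ## Paths in the real line -/

/-! The proof replaces valence by directions: a direction at `p` is the filter of germs of a path
issuing from `p`. In a metric graph two directions at a point are equal or disjoint, and their
number is the valence, so valence can be followed through continuous maps. A germ at a point of the
solenoid is a compatible choice of a direction at every level.

Finiteness. Comparing directions above and below a fold, the fold can merge away at most two of
them, while it also merges two points, whose expected valence is two each. Balancing the count, a
bound on the total excess of valence over two passes from the target of a fold to its source
(`IsFold.dirBound`), so one constant serves all levels. Distinct pre-singularities are eventually
distinct natural vertices, and distinct germs at a point are eventually distinct directions; hence
there are finitely many pre-singularities, each with finitely many germs. Whether a pair of germs is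
imitated at level `j` by a point with no further germs is monotone in `j`. So finitely many eventual
conditions must hold, and from some level `K` on they hold together: the tail is `IsGood`.

Geometry. Away from the center, a standard star neighborhood has no special points, so the maps from
lower levels are coverings over its open prongs. Unique lifting shows that a plaque consists of one
center and one prong for every germ there. In a good sequence different germs have different
directions at each level, so a plaque projects injectively to its level graph, and the points with
more than two germs are both pre-singularities and singularities.

The vertex criteria are then immediate. A three-pronged star cannot lie over a turn, because it
would inject into a line. A singular segment is a pair of germs at a pre-singularity. A leaf segment
taking its top-level image gives a matching pair of germs at level zero; goodness supplies a match
as deep as desired, and the plaque of the matching point takes the image at the given level. -/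

theorem map_nhdsGT_zero_eq {τ : ℝ → ℝ} {ε : ℝ} (hε : 0 < ε) (hc : ContinuousOn τ (Ioo 0 ε))
    (ht : Tendsto τ (𝓝[>] 0) (𝓝[>] 0)) : map τ (𝓝[>] 0) = 𝓝[>] 0 := by
  refine le_antisymm ht fun S hS => ?_
  have h₁ : ∀ᶠ u in 𝓝[>] (0 : ℝ), τ u ∈ S := hS
  have h₂ : ∀ᶠ u in 𝓝[>] (0 : ℝ), 0 < τ u := ht self_mem_nhdsWithin
  obtain ⟨δ, hδ, hδS⟩ := mem_nhdsGT_iff_exists_Ioo_subset.1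
    (h₁.and (h₂.and (Ioo_mem_nhdsGT hε)))
  have hδ : 0 < δ := hδ
  have hu : δ / 2 ∈ Ioo 0 δ := ⟨by linarith, by linarith⟩
  have hb : 0 < τ (δ / 2) := (hδS hu).2.1
  refine mem_of_superset (Ioo_mem_nhdsGT hb) fun c hc' => ?_
  have h₃ : ∀ᶠ u in 𝓝[>] (0 : ℝ), τ u < c := by
    have := ht (Ioo_mem_nhdsGT hc'.1)
    filter_upwards [this] with u hu using hu.2
  obtain ⟨u, hu₁, hu₂⟩ := (h₃.and (Ioo_mem_nhdsGT hu.1)).exists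
  have hsub : Icc u (δ / 2) ⊆ Ioo 0 δ := fun w hw => ⟨hu₂.1.trans_le hw.1, by
    have := hw.2; have := hu.2; linarith⟩
  -- Since `τ u < c < τ (δ / 2)`, the value `c` is attained between `u` and `δ / 2`; thus `τ` maps
  -- each initial interval onto one.
  obtain ⟨w, hw, rfl⟩ := intermediate_value_Icc hu₂.2.le
    (hc.mono fun w hw => (hδS (hsub hw)).2.2) ⟨hu₁.le, hc'.2.le⟩
  exact (hδS (hsub hw)).1

/-- Two of the three arcs end on the same side of `v`, and by the intermediate value theorem both
pass through whichever of their values at `ε / 2` is nearer to `v`. This obstruction is what detects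
stars with more than two prongs. -/
theorem not_three_arcs {γ : Fin 3 → ℝ → ℝ} {ε v : ℝ} (hε : 0 < ε)
    (hc : ∀ i, ContinuousOn (γ i) (Ico 0 ε)) (h0 : ∀ i, γ i 0 = v)
    (hne : ∀ i, ∀ t ∈ Ioo 0 ε, γ i t ≠ v)
    (hd : ∀ i j, i ≠ j → ∀ s ∈ Ioo 0 ε, ∀ t ∈ Ioo 0 ε, γ i s ≠ γ j t) : False := by
  have he : ε / 2 ∈ Ioo 0 ε := ⟨by linarith, by linarith⟩
  have hcI : ∀ i, ContinuousOn (γ i) (Icc 0 (ε / 2)) := fun i =>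
    (hc i).mono fun w hw => ⟨hw.1, hw.2.trans_lt he.2⟩
  have up : ∀ i c, v < c → c ≤ γ i (ε / 2) → ∃ t ∈ Ioo 0 ε, γ i t = c := by
    intro i c h₁ h₂
    obtain ⟨w, hw, hwc⟩ := intermediate_value_Icc he.1.le (hcI i) ⟨(h0 i).le.trans h₁.le, h₂⟩
    refine ⟨w, ⟨lt_of_le_of_ne hw.1 ?_, hw.2.trans_lt he.2⟩, hwc⟩
    rintro rfl
    rw [h0] at hwc; exact h₁.ne hwc
  have down : ∀ i c, c < v → γ i (ε / 2) ≤ c → ∃ t ∈ Ioo 0 ε, γ i t = c := by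
    intro i c h₁ h₂
    obtain ⟨w, hw, hwc⟩ := intermediate_value_Icc' he.1.le (hcI i) ⟨h₂, h₁.le.trans (h0 i).ge⟩
    refine ⟨w, ⟨lt_of_le_of_ne hw.1 ?_, hw.2.trans_lt he.2⟩, hwc⟩
    rintro rfl
    rw [h0] at hwc; exact h₁.ne' hwc
  have key : ∀ i j, i ≠ j → (v < γ i (ε / 2) ↔ ¬ v < γ j (ε / 2)) := by
    intro i j hij
    constructor
    · intro h₁ h₂
      obtain ⟨s, hs, hs'⟩ := up i _ (lt_min h₁ h₂) (min_le_left _ _)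
      obtain ⟨t, ht, ht'⟩ := up j _ (lt_min h₁ h₂) (min_le_right _ _)
      exact hd i j hij s hs t ht (hs'.trans ht'.symm)
    · intro h₂
      by_contra h₁
      have h₁' := lt_of_le_of_ne (not_lt.1 h₁) (hne i _ he)
      have h₂' := lt_of_le_of_ne (not_lt.1 h₂) (hne j _ he)
      obtain ⟨s, hs, hs'⟩ := down i _ (max_lt h₁' h₂') (le_max_left _ _)
      obtain ⟨t, ht, ht'⟩ := down j _ (max_lt h₁' h₂') (le_max_right _ _)
      exact hd i j hij s hs t ht (hs'.trans ht'.symm)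
  have k₁ := key 0 1 (by decide)
  have k₂ := key 1 2 (by decide)
  have k₃ := key 0 2 (by decide)
  tauto

/-- If two values agreed, there would be a local extremum strictly between, whereas a continuous
locally injective function is strictly monotone near every point. -/
theorem injOn_Ioo_of_locally_injOn {f : ℝ → ℝ} {a b : ℝ} (hf : ContinuousOn f (Ioo a b))
    (hl : ∀ x ∈ Ioo a b, ∃ U ∈ 𝓝 x, InjOn f U) : InjOn f (Ioo a b) := by
  have main : ∀ x ∈ Ioo a b, ∀ y ∈ Ioo a b, x < y → f x ≠ f y := by
    intro x hx y hy hxy hfxy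
    have hsub : Icc x y ⊆ Ioo a b := fun w hw => ⟨hx.1.trans_le hw.1, hw.2.trans_lt hy.2⟩
    obtain ⟨c, hc, hextr⟩ := exists_isLocalExtr_Ioo hxy (hf.mono hsub) hfxy
    have hcab := hsub (Ioo_subset_Icc_self hc)
    obtain ⟨U, hU, hinj⟩ := hl c hcab
    have close : ∀ P : ℝ → Prop, (∀ᶠ z in 𝓝 c, P z) →
        ∃ δ > 0, ∀ z ∈ Icc (c - δ) (c + δ), P z ∧ z ∈ U ∧ z ∈ Ioo a b := by
      intro P hP
      obtain ⟨δ, hδ, h⟩ := Metric.mem_nhds_iff.1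
        ((hP.and (Filter.Eventually.and hU (Ioo_mem_nhds hcab.1 hcab.2))))
      refine ⟨δ / 2, by linarith, fun z hz => h ?_⟩
      rw [Metric.mem_ball, Real.dist_eq, abs_lt]
      constructor <;> linarith [hz.1, hz.2]
    rcases hextr with hm | hm
    · obtain ⟨δ, hδ, h⟩ := close _ hm
      have m₁ : c - δ ∈ Icc (c - δ) (c + δ) := ⟨le_rfl, by linarith⟩
      have m₂ : c + δ ∈ Icc (c - δ) (c + δ) := ⟨by linarith, le_rfl⟩
      have m₃ : c ∈ Icc (c - δ) (c + δ) := ⟨by linarith, by linarith⟩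
      rcases ContinuousOn.strictMonoOn_of_injOn_Icc' (by linarith : c - δ ≤ c + δ)
        (hf.mono fun z hz => (h z hz).2.2) (hinj.mono fun z hz => (h z hz).2.1) with hs | hs
      · have := hs m₁ m₃ (by linarith); have := (h _ m₁).1; linarith
      · have := hs m₃ m₂ (by linarith); have := (h _ m₂).1; linarith
    · obtain ⟨δ, hδ, h⟩ := close _ hm
      have m₁ : c - δ ∈ Icc (c - δ) (c + δ) := ⟨le_rfl, by linarith⟩
      have m₂ : c + δ ∈ Icc (c - δ) (c + δ) := ⟨by linarith, le_rfl⟩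
      have m₃ : c ∈ Icc (c - δ) (c + δ) := ⟨by linarith, by linarith⟩
      rcases ContinuousOn.strictMonoOn_of_injOn_Icc' (by linarith : c - δ ≤ c + δ)
        (hf.mono fun z hz => (h z hz).2.2) (hinj.mono fun z hz => (h z hz).2.1) with hs | hs
      · have := hs m₃ m₂ (by linarith); have := (h _ m₂).1; linarith
      · have := hs m₁ m₃ (by linarith); have := (h _ m₁).1; linarith
  intro x hx y hy hxy
  by_contra hne
  rcases lt_or_gt_of_ne hne with h | h
  · exact main x hx y hy h hxy
  · exact main y hy x hx h hxy.symm

end SplitSeq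

namespace SplitSeq

/-! ## Directions -/

/-- The directions at `p`: the filters of germs at `0` of paths issuing from `p`. -/
def Dir {Y : Type u} [TopologicalSpace Y] (p : Y) : Set (Filter Y) :=
  {F | ∃ γ : ℝ → Y, ∃ ε > 0, ContinuousOn γ (Ioo 0 ε) ∧ Tendsto γ (𝓝[>] 0) (𝓝[≠] p) ∧
    map γ (𝓝[>] 0) = F}

theorem mem_dir {Y : Type u} [TopologicalSpace Y] {p : Y} {γ : ℝ → Y} {ε : ℝ} (hε : 0 < ε)
    (hc : ContinuousOn γ (Ioo 0 ε)) (ht : Tendsto γ (𝓝[>] 0) (𝓝 p))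
    (hne : ∀ᶠ t in 𝓝[>] (0 : ℝ), γ t ≠ p) : map γ (𝓝[>] 0) ∈ Dir p :=
  ⟨γ, ε, hε, hc, tendsto_nhdsWithin_iff.2 ⟨ht, hne⟩, rfl⟩

theorem Dir.neBot {Y : Type u} [TopologicalSpace Y] {p : Y} {F : Filter Y} (hF : F ∈ Dir p) :
    F.NeBot := by
  obtain ⟨γ, ε, hε, hc, ht, rfl⟩ := hF
  exact map_neBot

theorem Dir.le {Y : Type u} [TopologicalSpace Y] {p : Y} {F : Filter Y} (hF : F ∈ Dir p) :
    F ≤ 𝓝[≠] p := by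
  obtain ⟨γ, ε, hε, hc, ht, rfl⟩ := hF
  exact ht

theorem Dir.le_nhds {Y : Type u} [TopologicalSpace Y] {p : Y} {F : Filter Y} (hF : F ∈ Dir p) :
    F ≤ 𝓝 p := (Dir.le hF).trans nhdsWithin_le_nhds

theorem Dir.eq_of_mem {Y : Type u} [TopologicalSpace Y] [T2Space Y] {p q : Y} {F : Filter Y}
    (hp : F ∈ Dir p) (hq : F ∈ Dir q) : p = q := by
  have := Dir.neBot hp
  exact tendsto_nhds_unique (Dir.le_nhds hp : Tendsto id F (𝓝 p)) (Dir.le_nhds hq)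

/-- The hypothesis `hi` keeps the image path away from `f p`; for compositions of folds it follows
from finiteness of the fibers. -/
theorem Dir.map {Y : Type u} {Z : Type v} [TopologicalSpace Y] [TopologicalSpace Z] {f : Y → Z}
    {p : Y} (hf : Continuous f) (hi : ∀ᶠ x in 𝓝[≠] p, f x ≠ f p)
    {F : Filter Y} (hF : F ∈ Dir p) : map f F ∈ Dir (f p) := by
  obtain ⟨γ, ε, hε, hc, ht, rfl⟩ := hF
  rw [Filter.map_map]
  exact mem_dir hε (hf.comp_continuousOn hc)
    ((hf.tendsto p).comp (ht.mono_right nhdsWithin_le_nhds)) (ht hi)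

/-! ## Charts of metric graphs -/

/-- `c` is an isometric chart of radius `r` around the point `p` of valence `n`. -/
structure IsChart {G : Type u} [MetricSpace G] (p : G) (n : ℕ) (r : ℝ) (c : Fin n → ℝ → G) :
    Prop where
  pos : 0 < r
  zero : ∀ i, c i 0 = p
  same : ∀ i, ∀ s ∈ Ico 0 r, ∀ t ∈ Ico 0 r, dist (c i s) (c i t) = |s - t|
  diff : ∀ i j, i ≠ j → ∀ s ∈ Ico 0 r, ∀ t ∈ Ico 0 r, dist (c i s) (c j t) = s + t
  ball : ∀ x, x ∈ Metric.ball p r ↔ x = p ∨ ∃ i, ∃ t ∈ Ico 0 r, x = c i t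

theorem hasValence_iff {G : Type u} [MetricSpace G] {p : G} {n : ℕ} :
    HasValence p n ↔ ∃ r c, IsChart p n r c :=
  ⟨fun ⟨r, h, c, h₁, h₂, h₃, h₄⟩ => ⟨r, c, h, h₁, h₂, h₃, h₄⟩,
    fun ⟨r, c, h, h₁, h₂, h₃, h₄⟩ => ⟨r, h, c, h₁, h₂, h₃, h₄⟩⟩

namespace IsChart

variable {G : Type u} [MetricSpace G] {p : G} {n : ℕ} {r : ℝ} {c : Fin n → ℝ → G}

theorem dist_center (h : IsChart p n r c) (i : Fin n) {t : ℝ} (ht : t ∈ Ico 0 r) :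
    dist (c i t) p = t := by
  rw [← h.zero i, h.same i t ht 0 ⟨le_rfl, h.pos⟩, sub_zero, abs_of_nonneg ht.1]

theorem continuousOn (h : IsChart p n r c) (i : Fin n) : ContinuousOn (c i) (Ico 0 r) := by
  rw [Metric.continuousOn_iff]
  intro b hb ε hε
  refine ⟨ε, hε, fun a ha hab => ?_⟩
  rwa [h.same i a ha b hb, ← Real.dist_eq]

theorem exists_eq (h : IsChart p n r c) {x : G} (hx : dist x p < r) (hxp : x ≠ p) :
    ∃ i, x = c i (dist x p) ∧ 0 < dist x p := by
  rcases (h.ball x).1 hx with rfl | ⟨i, t, ht, rfl⟩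
  · exact absurd rfl hxp
  · exact ⟨i, by rw [h.dist_center i ht], dist_pos.2 hxp⟩

theorem ne_of_ne (h : IsChart p n r c) {i j : Fin n} (hij : i ≠ j) {s t : ℝ} (hs : s ∈ Ioo 0 r)
    (ht : t ∈ Ico 0 r) : c i s ≠ c j t := by
  intro he
  have := h.diff i j hij s ⟨hs.1.le, hs.2⟩ t ht
  rw [he, dist_self] at this
  linarith [hs.1, ht.1]

theorem isOpen_prong (h : IsChart p n r c) (i : Fin n) : IsOpen (c i '' Ioo 0 r) := by
  rw [Metric.isOpen_iff]
  rintro _ ⟨t, ht, rfl⟩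
  -- Points of other prongs, and the center, are at distance at least `t` from `c i t`; the bound `r
  -- - t` keeps the ball inside the chart.
  refine ⟨min t (r - t), lt_min ht.1 (by linarith [ht.2]), fun x hx => ?_⟩
  have hx' : dist x (c i t) < min t (r - t) := hx
  have h₁ := hx'.trans_le (min_le_left _ _)
  have h₂ := hx'.trans_le (min_le_right _ _)
  have htc := h.dist_center i ⟨ht.1.le, ht.2⟩
  have hxp : x ≠ p := by
    rintro rfl
    rw [dist_comm, htc] at h₁; exact lt_irrefl _ h₁
  have hxr : dist x p < r := by
    have := dist_triangle x (c i t) p; linarith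
  obtain ⟨j, hj, hpos⟩ := h.exists_eq hxr hxp
  by_cases hji : j = i
  · subst hji; exact ⟨_, ⟨hpos, hxr⟩, hj.symm⟩
  · have := h.diff j i hji _ ⟨hpos.le, hxr⟩ t ⟨ht.1.le, ht.2⟩
    rw [← hj] at this
    linarith

theorem mem_dir (h : IsChart p n r c) (i : Fin n) : map (c i) (𝓝[>] 0) ∈ Dir p := by
  refine SplitSeq.mem_dir h.pos ((h.continuousOn i).mono Ioo_subset_Ico_self) ?_ ?_
  · have h0 : Tendsto (c i) (𝓝[Ico 0 r] 0) (𝓝 (c i 0)) := h.continuousOn i 0 ⟨le_rfl, h.pos⟩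
    rw [h.zero] at h0
    refine h0.mono_left ?_
    rw [← nhdsWithin_Ioo_eq_nhdsGT h.pos]
    exact nhdsWithin_mono _ Ioo_subset_Ico_self
  · filter_upwards [Ioo_mem_nhdsGT h.pos] with t ht
    rw [← dist_pos, h.dist_center i ⟨ht.1.le, ht.2⟩]
    exact ht.1

theorem prong_mem (_h : IsChart p n r c) (i : Fin n) {s : ℝ} (hs : 0 < s) :
    c i '' Ioo 0 s ∈ map (c i) (𝓝[>] 0) :=
  image_mem_map (Ioo_mem_nhdsGT hs)

theorem disjoint (h : IsChart p n r c) {i j : Fin n} (hij : i ≠ j) :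
    Disjoint (map (c i) (𝓝[>] 0)) (map (c j) (𝓝[>] 0)) := by
  refine Filter.disjoint_iff.2 ⟨_, h.prong_mem i h.pos, _, h.prong_mem j h.pos, ?_⟩
  rw [Set.disjoint_left]
  rintro _ ⟨s, hs, rfl⟩ ⟨t, ht, he⟩
  exact h.ne_of_ne hij hs ⟨ht.1.le, ht.2⟩ he.symm

/-- A path that tends to `p` without meeting it stays, by connectedness, in one of the disjoint open
prongs. It may move back and forth there, but its distance to `p` sweeps out all small positive
numbers, so its germ is that of the whole prong. -/
theorem eventually_eq (h : IsChart p n r c) {γ : ℝ → G} {ε : ℝ} (hε : 0 < ε)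
    (hc : ContinuousOn γ (Ioo 0 ε)) (ht : Tendsto γ (𝓝[>] 0) (𝓝[≠] p)) :
    ∃ i, (∀ᶠ t in 𝓝[>] (0 : ℝ), γ t = c i (dist (γ t) p)) ∧
      map γ (𝓝[>] 0) = map (c i) (𝓝[>] 0) := by
  have hev : ∀ᶠ t in 𝓝[>] (0 : ℝ), γ t ∈ Metric.ball p r ∧ γ t ≠ p :=
    ((ht.mono_right nhdsWithin_le_nhds).eventually (Metric.ball_mem_nhds p h.pos)).and
      (ht.eventually self_mem_nhdsWithin)
  obtain ⟨δ, hδ, hδS⟩ := mem_nhdsGT_iff_exists_Ioo_subset.1 (hev.and (Ioo_mem_nhdsGT hε))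
  have hδ : 0 < δ := hδ
  have hcδ : ContinuousOn γ (Ioo 0 δ) := hc.mono fun t ht => (hδS ht).2
  have hcov : ∀ t ∈ Ioo 0 δ, ∃ i, γ t = c i (dist (γ t) p) ∧ 0 < dist (γ t) p ∧
      dist (γ t) p < r := by
    intro t ht
    obtain ⟨i, h₁, h₂⟩ := h.exists_eq (hδS ht).1.1 (hδS ht).1.2
    exact ⟨i, h₁, h₂, (hδS ht).1.1⟩
  have hm : δ / 2 ∈ Ioo 0 δ := ⟨by linarith, by linarith⟩
  obtain ⟨i, hi₁, hi₂, hi₃⟩ := hcov _ hm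
  have hpre : IsPreconnected (γ '' Ioo 0 δ) := isPreconnected_Ioo.image γ hcδ
  have hsub : γ '' Ioo 0 δ ⊆ c i '' Ioo 0 r := by
    refine hpre.subset_left_of_subset_union (h.isOpen_prong i)
      (v := ⋃ j ∈ {j | j ≠ i}, c j '' Ioo 0 r)
      (isOpen_biUnion fun j _ => h.isOpen_prong j) ?_ ?_ ?_
    · rw [Set.disjoint_left]
      rintro _ ⟨s, hs, rfl⟩ hx
      simp only [mem_iUnion] at hx
      obtain ⟨j, hj, t, ht, he⟩ := hx
      exact h.ne_of_ne hj ht ⟨hs.1.le, hs.2⟩ he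
    · rintro _ ⟨t, ht, rfl⟩
      obtain ⟨j, hj₁, hj₂, hj₃⟩ := hcov t ht
      by_cases hji : j = i
      · subst hji; exact Or.inl ⟨_, ⟨hj₂, hj₃⟩, hj₁.symm⟩
      · refine Or.inr ?_
        simp only [mem_iUnion]
        exact ⟨j, hji, _, ⟨hj₂, hj₃⟩, hj₁.symm⟩
    · exact ⟨γ (δ / 2), mem_image_of_mem _ hm, _, ⟨hi₂, hi₃⟩, hi₁.symm⟩
  have hev' : ∀ᶠ t in 𝓝[>] (0 : ℝ), γ t = c i (dist (γ t) p) := by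
    filter_upwards [Ioo_mem_nhdsGT hδ] with t ht
    obtain ⟨s, hs, he⟩ := hsub (mem_image_of_mem _ ht)
    rw [← he, h.dist_center i ⟨hs.1.le, hs.2⟩]
  refine ⟨i, hev', ?_⟩
  have hτ : map (fun t => dist (γ t) p) (𝓝[>] 0) = 𝓝[>] (0 : ℝ) := by
    refine map_nhdsGT_zero_eq hδ (continuous_dist.comp_continuousOn (hcδ.prodMk continuousOn_const)) ?_
    refine tendsto_nhdsWithin_iff.2 ⟨?_, ?_⟩
    · have := (ht.mono_right nhdsWithin_le_nhds).dist (tendsto_const_nhds (x := p))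
      rwa [dist_self] at this
    · filter_upwards [hev] with t ht
      exact dist_pos.2 ht.2
  calc map γ (𝓝[>] 0) = map (c i ∘ fun t => dist (γ t) p) (𝓝[>] 0) := map_congr hev'
    _ = map (c i) (𝓝[>] 0) := by rw [← Filter.map_map, hτ]

theorem dir_eq (h : IsChart p n r c) : Dir p = range fun i => map (c i) (𝓝[>] 0) := by
  refine Subset.antisymm ?_ ?_
  · rintro F ⟨γ, ε, hε, hc, ht, rfl⟩
    obtain ⟨i, -, hi⟩ := h.eventually_eq hε hc ht
    exact ⟨i, hi.symm⟩
  · rintro _ ⟨i, rfl⟩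
    exact h.mem_dir i

theorem injective (h : IsChart p n r c) :
    Function.Injective fun i => map (c i) (𝓝[>] (0 : ℝ)) := by
  intro i j hij
  by_contra hne
  have hd := h.disjoint hne
  have hij : map (c i) (𝓝[>] (0 : ℝ)) = map (c j) (𝓝[>] 0) := hij
  rw [hij, disjoint_self] at hd
  exact (Dir.neBot (h.mem_dir j)).ne hd

/-- Directions are defined topologically, so this shows that the valence is unique and does not
depend on the chart. -/
theorem ncard_dir (h : IsChart p n r c) : (Dir p).ncard = n := by
  rw [h.dir_eq, ← Set.image_univ, Set.ncard_image_of_injective _ h.injective, Set.ncard_univ,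
    Nat.card_fin]

/-- With finitely many prongs, a set that belongs to every prong germ contains initial segments of a
common length, hence a punctured ball. Neighborhoods can therefore be tested direction by direction.
-/
theorem nhdsNE_le (h : IsChart p n r c) : 𝓝[≠] p ≤ ⨆ i, map (c i) (𝓝[>] 0) := by
  intro S hS
  rw [mem_iSup] at hS
  have h₁ : ∀ᶠ t in 𝓝[>] (0 : ℝ), ∀ i, c i t ∈ S := eventually_all.2 fun i => hS i
  obtain ⟨δ, hδ, hδS⟩ := mem_nhdsGT_iff_exists_Ioo_subset.1 h₁
  have hδ : 0 < δ := hδ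
  have hball : Metric.ball p (min δ r) ∈ 𝓝 p := Metric.ball_mem_nhds p (lt_min hδ h.pos)
  filter_upwards [mem_nhdsWithin_of_mem_nhds hball, self_mem_nhdsWithin] with x hx hxp
  have hx' : dist x p < min δ r := hx
  obtain ⟨i, hi, hpos⟩ := h.exists_eq (hx'.trans_le (min_le_right _ _)) hxp
  rw [hi]
  exact hδS ⟨hpos, hx'.trans_le (min_le_left _ _)⟩ i

/-- The two prongs at `c i t` run forwards and backwards along `c i`. As a consequence natural
vertices are isolated, hence finite in number in a compact graph. -/
theorem hasValence_two (h : IsChart p n r c) (i : Fin n) {t : ℝ} (ht : t ∈ Ioo 0 r) :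
    HasValence (c i t) 2 := by
  set ρ := min t (r - t) with hρ
  have hρt : ρ ≤ t := min_le_left _ _
  have hρr : ρ ≤ r - t := min_le_right _ _
  have hρ0 : 0 < ρ := lt_min ht.1 (by linarith [ht.2])
  have pl : ∀ s ∈ Ico 0 ρ, t + s ∈ Ico 0 r := fun s hs =>
    ⟨by linarith [hs.1, ht.1], by linarith [hs.2]⟩
  have mi : ∀ s ∈ Ico 0 ρ, t - s ∈ Ico 0 r := fun s hs =>
    ⟨by linarith [hs.2], by linarith [hs.1, ht.2]⟩
  refine ⟨ρ, hρ0, fun k s => if k = 0 then c i (t + s) else c i (t - s), ?_, ?_, ?_, ?_⟩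
  · intro k; simp
  · intro k s hs u hu
    by_cases hk : k = 0
    · simp only [hk, if_true]
      rw [h.same i _ (pl s hs) _ (pl u hu)]; congr 1; ring
    · simp only [hk, if_false]
      rw [h.same i _ (mi s hs) _ (mi u hu), abs_sub_comm]; congr 1; ring
  · intro k l hkl s hs u hu
    have : (k = 0 ∧ l = 1) ∨ (k = 1 ∧ l = 0) := by omega
    rcases this with ⟨rfl, rfl⟩ | ⟨rfl, rfl⟩
    · simp only [if_true, one_ne_zero, if_false]
      rw [h.same i _ (pl s hs) _ (mi u hu), abs_of_nonneg (by linarith [hs.1, hu.1])]; ring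
    · simp only [if_true, one_ne_zero, if_false]
      rw [h.same i _ (mi s hs) _ (pl u hu), abs_of_nonpos (by linarith [hs.1, hu.1])]; ring
  · intro x
    constructor
    · intro hx
      have hx' : dist x (c i t) < ρ := hx
      have htc := h.dist_center i ⟨ht.1.le, ht.2⟩
      have hxp : x ≠ p := by
        rintro rfl
        rw [dist_comm, htc] at hx'; linarith
      have hxr : dist x p < r := by
        have := dist_triangle x (c i t) p; linarith
      obtain ⟨j, hj, hpos⟩ := h.exists_eq hxr hxp
      have hji : j = i := by
        by_contra hji
        have := h.diff j i hji _ ⟨hpos.le, hxr⟩ t ⟨ht.1.le, ht.2⟩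
        rw [← hj] at this
        linarith
      subst hji
      have hd := h.same j _ ⟨hpos.le, hxr⟩ t ⟨ht.1.le, ht.2⟩
      rw [← hj] at hd
      rw [hd, abs_lt] at hx'
      refine Or.inr ?_
      rcases le_total t (dist x p) with hle | hle
      · exact ⟨0, dist x p - t, ⟨by linarith, by linarith⟩, by simpa using hj⟩
      · exact ⟨1, t - dist x p, ⟨by linarith, by linarith⟩, by simpa using hj⟩
    · rintro (rfl | ⟨k, s, hs, rfl⟩)
      · exact Metric.mem_ball_self hρ0
      · rw [Metric.mem_ball]
        by_cases hk : k = 0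
        · simp only [hk, if_true]
          rw [h.same i _ (pl s hs) t ⟨ht.1.le, ht.2⟩, abs_of_nonneg (by linarith [hs.1])]
          linarith [hs.2]
        · simp only [hk, if_false]
          rw [h.same i _ (mi s hs) t ⟨ht.1.le, ht.2⟩, abs_of_nonpos (by linarith [hs.1])]
          linarith [hs.2]

end IsChart

namespace HasValence

variable {G : Type u} [MetricSpace G] {p : G} {n : ℕ}

theorem ncard_dir (h : HasValence p n) : (Dir p).ncard = n := by
  obtain ⟨r, c, h⟩ := hasValence_iff.1 h
  exact h.ncard_dir

theorem finite_dir (h : HasValence p n) : (Dir p).Finite := by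
  obtain ⟨r, c, h⟩ := hasValence_iff.1 h
  rw [h.dir_eq]
  exact finite_range _

theorem eq_or_disjoint (h : HasValence p n) {E F : Filter G} (hE : E ∈ Dir p) (hF : F ∈ Dir p) :
    E = F ∨ Disjoint E F := by
  obtain ⟨r, c, h⟩ := hasValence_iff.1 h
  rw [h.dir_eq] at hE hF
  obtain ⟨i, rfl⟩ := hE
  obtain ⟨j, rfl⟩ := hF
  by_cases hij : i = j
  · exact Or.inl (by rw [hij])
  · exact Or.inr (h.disjoint hij)

theorem nhdsNE_le (h : HasValence p n) : 𝓝[≠] p ≤ sSup (Dir p) := by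
  obtain ⟨r, c, h⟩ := hasValence_iff.1 h
  exact h.nhdsNE_le.trans (iSup_le fun i => le_sSup (h.mem_dir i))

theorem isNaturalVertex_iff (h : HasValence p n) : IsNaturalVertex p ↔ 2 < n :=
  ⟨fun ⟨m, hm, h'⟩ => by rwa [← h.ncard_dir, h'.ncard_dir], fun hn => ⟨n, hn, h⟩⟩

theorem eventually_not_isNaturalVertex (h : HasValence p n) :
    ∀ᶠ x in 𝓝[≠] p, ¬ IsNaturalVertex x := by
  obtain ⟨r, c, h⟩ := hasValence_iff.1 h
  have hball : Metric.ball p r ∈ 𝓝 p := Metric.ball_mem_nhds p h.pos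
  filter_upwards [mem_nhdsWithin_of_mem_nhds hball, self_mem_nhdsWithin] with x hx hxp
  obtain ⟨i, hi, hpos⟩ := h.exists_eq hx hxp
  rw [hi, (h.hasValence_two i ⟨hpos, hx⟩).isNaturalVertex_iff]
  exact lt_irrefl 2

/-- Two unit-speed paths with the same direction agree initially. -/
theorem eventually_eq_of_unit_speed (h : HasValence p n) {α β : ℝ → G} {ε : ℝ} (hε : 0 < ε)
    (hα0 : α 0 = p) (hβ0 : β 0 = p)
    (hα : ∀ s ∈ Ico 0 ε, ∀ t ∈ Ico 0 ε, dist (α s) (α t) = |s - t|)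
    (hβ : ∀ s ∈ Ico 0 ε, ∀ t ∈ Ico 0 ε, dist (β s) (β t) = |s - t|)
    (hαβ : map α (𝓝[>] 0) = map β (𝓝[>] 0)) : ∀ᶠ t in 𝓝[>] (0 : ℝ), α t = β t := by
  obtain ⟨r, c, h⟩ := hasValence_iff.1 h
  have aux : ∀ γ : ℝ → G, γ 0 = p →
      (∀ s ∈ Ico 0 ε, ∀ t ∈ Ico 0 ε, dist (γ s) (γ t) = |s - t|) →
      ∃ i, (∀ᶠ t in 𝓝[>] (0 : ℝ), γ t = c i t) ∧ map γ (𝓝[>] 0) = map (c i) (𝓝[>] 0) := by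
    intro γ h0 hγ
    have hd : ∀ t ∈ Ico 0 ε, dist (γ t) p = t := fun t ht => by
      rw [← h0, hγ t ht 0 ⟨le_rfl, hε⟩, sub_zero, abs_of_nonneg ht.1]
    have hco : ContinuousOn γ (Ioo 0 ε) := by
      rw [Metric.continuousOn_iff]
      intro b hb η hη
      refine ⟨η, hη, fun a ha hab => ?_⟩
      rwa [hγ a ⟨ha.1.le, ha.2⟩ b ⟨hb.1.le, hb.2⟩, ← Real.dist_eq]
    have ht : Tendsto γ (𝓝[>] 0) (𝓝[≠] p) := by
      refine tendsto_nhdsWithin_iff.2 ⟨?_, ?_⟩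
      · rw [tendsto_iff_dist_tendsto_zero]
        refine (tendsto_nhdsWithin_of_tendsto_nhds tendsto_id).congr' ?_
        filter_upwards [Ioo_mem_nhdsGT hε] with t ht
        exact (hd t ⟨ht.1.le, ht.2⟩).symm
      · filter_upwards [Ioo_mem_nhdsGT hε] with t ht
        exact dist_pos.1 (by rw [hd t ⟨ht.1.le, ht.2⟩]; exact ht.1)
    obtain ⟨i, h₁, h₂⟩ := h.eventually_eq hε hco ht
    refine ⟨i, ?_, h₂⟩
    filter_upwards [h₁, Ioo_mem_nhdsGT hε] with t ht ht'
    rwa [hd t ⟨ht'.1.le, ht'.2⟩] at ht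
  obtain ⟨i, hi, hi'⟩ := aux α hα0 hα
  obtain ⟨j, hj, hj'⟩ := aux β hβ0 hβ
  have hij : i = j := h.injective (hi'.symm.trans (hαβ.trans hj'))
  subst hij
  filter_upwards [hi, hj] with t h₁ h₂
  rw [h₁, h₂]

end HasValence

namespace IsMetricGraph

variable {G : Type u} [MetricSpace G]

theorem finite_dir (hG : IsMetricGraph G) (p : G) : (Dir p).Finite := by
  obtain ⟨n, hn⟩ := hG.valence p
  exact hn.finite_dir

theorem eq_or_disjoint (hG : IsMetricGraph G) {p : G} {E F : Filter G} (hE : E ∈ Dir p)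
    (hF : F ∈ Dir p) : E = F ∨ Disjoint E F := by
  obtain ⟨n, hn⟩ := hG.valence p
  exact hn.eq_or_disjoint hE hF

theorem nhdsNE_le (hG : IsMetricGraph G) (p : G) : 𝓝[≠] p ≤ sSup (Dir p) := by
  obtain ⟨n, hn⟩ := hG.valence p
  exact hn.nhdsNE_le

theorem isNaturalVertex_iff (hG : IsMetricGraph G) {p : G} :
    IsNaturalVertex p ↔ 2 < (Dir p).ncard := by
  obtain ⟨n, hn⟩ := hG.valence p
  rw [hn.isNaturalVertex_iff, hn.ncard_dir]

theorem eventually_not_isNaturalVertex (hG : IsMetricGraph G) (p : G) :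
    ∀ᶠ x in 𝓝[≠] p, ¬ IsNaturalVertex x := by
  obtain ⟨n, hn⟩ := hG.valence p
  exact hn.eventually_not_isNaturalVertex

theorem finite_isNaturalVertex (hG : IsMetricGraph G) : {v : G | IsNaturalVertex v}.Finite := by
  have := hG.compact
  by_contra hinf
  obtain ⟨x, hx⟩ := Set.Infinite.exists_accPt_principal hinf
  exact accPt_iff_frequently_nhdsNE.1 hx (hG.eventually_not_isNaturalVertex x)

end IsMetricGraph

theorem IsCoreGraph.two_le_ncard_dir {G : Type u} [MetricSpace G] {n : ℕ} (hG : IsCoreGraph n G)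
    [Nontrivial G] (p : G) : 2 ≤ (Dir p).ncard := by
  obtain ⟨m, hm⟩ := hG.valence p
  rw [hm.ncard_dir]
  by_contra hlt
  have h1 : m ≠ 1 := fun h => hG.no_valence_one p (h ▸ hm)
  have h0 : m = 0 := by omega
  subst h0
  obtain ⟨r, c, h⟩ := hasValence_iff.1 hm
  -- Valence zero remains: a geodesic from `p` to another point would enter the chart, which has no
  -- prongs.
  obtain ⟨q, hq⟩ := exists_ne p
  obtain ⟨γ, h₁, h₂, h₃⟩ := hG.geodesic p q
  have hd : 0 < dist p q := dist_pos.2 hq.symm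
  set t := min (dist p q) (r / 2) with ht
  have ht0 : 0 < t := lt_min hd (by linarith [h.pos])
  have htr : t < r := (min_le_right _ _).trans_lt (by linarith [h.pos])
  have hdt : dist (γ t) p = t := by
    rw [← h₁, h₃ t ⟨ht0.le, min_le_left _ _⟩ 0 ⟨le_rfl, hd.le⟩, sub_zero, abs_of_pos ht0]
  obtain ⟨i, -⟩ := h.exists_eq (hdt.trans_lt htr) (dist_pos.1 (by rw [hdt]; exact ht0))
  exact i.elim0

end SplitSeq

namespace SplitSeq

/-! ## Unit-speed paths and natural edges -/

/-- `e` is a path with unit speed on `[0,ℓ]`. -/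
def UnitSpeed {G : Type u} [MetricSpace G] (e : ℝ → G) (ℓ : ℝ) : Prop :=
  ∀ t ∈ Icc 0 ℓ, ∃ ε > 0, ∀ s ∈ Icc 0 ℓ, ∀ s' ∈ Icc 0 ℓ,
    |s - t| < ε → |s' - t| < ε → dist (e s) (e s') = |s - s'|

namespace UnitSpeed

variable {G : Type u} [MetricSpace G] {e : ℝ → G} {ℓ : ℝ}

theorem continuousOn (h : UnitSpeed e ℓ) : ContinuousOn e (Icc 0 ℓ) := by
  rw [Metric.continuousOn_iff]
  intro t ht η hη
  obtain ⟨ε, hε, hd⟩ := h t ht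
  refine ⟨min ε η, lt_min hε hη, fun s hs hst => ?_⟩
  rw [Real.dist_eq] at hst
  rw [hd s hs t ht (hst.trans_le (min_le_left _ _)) (by simpa using hε)]
  exact hst.trans_le (min_le_right _ _)

theorem comp (h : UnitSpeed e ℓ) {a σ d : ℝ} (hσ : |σ| = 1)
    (hm : ∀ w ∈ Icc 0 d, a + σ * w ∈ Icc 0 ℓ) : UnitSpeed (fun w => e (a + σ * w)) d := by
  have key : ∀ w w' : ℝ, |a + σ * w - (a + σ * w')| = |w - w'| := fun w w' => by
    rw [show a + σ * w - (a + σ * w') = σ * (w - w') by ring, abs_mul, hσ, one_mul]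
  intro t ht
  obtain ⟨ε, hε, hd⟩ := h _ (hm t ht)
  refine ⟨ε, hε, fun s hs s' hs' h₁ h₂ => ?_⟩
  rw [hd _ (hm s hs) _ (hm s' hs') (by rwa [key]) (by rwa [key]), key]

theorem exists_dist_eq (h : UnitSpeed e ℓ) (hℓ : 0 < ℓ) :
    ∃ ε > 0, ∀ s ∈ Ico 0 ε, ∀ t ∈ Ico 0 ε, dist (e s) (e t) = |s - t| := by
  obtain ⟨ε, hε, hd⟩ := h 0 ⟨le_rfl, hℓ.le⟩
  refine ⟨min ε ℓ, lt_min hε hℓ, fun s hs t ht => ?_⟩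
  have h₁ := hs.2.trans_le (min_le_left _ _)
  have h₂ := ht.2.trans_le (min_le_left _ _)
  refine hd s ⟨hs.1, (hs.2.trans_le (min_le_right _ _)).le⟩ t
    ⟨ht.1, (ht.2.trans_le (min_le_right _ _)).le⟩ ?_ ?_
  · rwa [sub_zero, abs_of_nonneg hs.1]
  · rwa [sub_zero, abs_of_nonneg ht.1]

theorem mem_dir (h : UnitSpeed e ℓ) (hℓ : 0 < ℓ) : map e (𝓝[>] 0) ∈ Dir (e 0) := by
  obtain ⟨ε, hε, hd⟩ := h.exists_dist_eq hℓ
  refine SplitSeq.mem_dir hℓ (h.continuousOn.mono Ioo_subset_Icc_self) ?_ ?_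
  · have h0 : Tendsto e (𝓝[Icc 0 ℓ] 0) (𝓝 (e 0)) := h.continuousOn 0 ⟨le_rfl, hℓ.le⟩
    refine h0.mono_left ?_
    rw [← nhdsWithin_Ioo_eq_nhdsGT hℓ]
    exact nhdsWithin_mono _ Ioo_subset_Icc_self
  · filter_upwards [Ioo_mem_nhdsGT hε] with t ht
    rw [← dist_pos, hd t ⟨ht.1.le, ht.2⟩ 0 ⟨le_rfl, hε⟩, sub_zero]
    exact abs_pos.2 ht.1.ne'

theorem mem_dir_at (h : UnitSpeed e ℓ) {a σ d : ℝ} (hσ : |σ| = 1) (hd : 0 < d)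
    (hm : ∀ w ∈ Icc 0 d, a + σ * w ∈ Icc 0 ℓ) :
    map (fun w => e (a + σ * w)) (𝓝[>] 0) ∈ Dir (e a) := by
  have := (h.comp hσ hm).mem_dir hd
  simpa using this

theorem forward_ne_backward (h : UnitSpeed e ℓ) {a : ℝ} (ha : a ∈ Ioo 0 ℓ) :
    map (fun w => e (a + 1 * w)) (𝓝[>] 0) ≠ map (fun w => e (a + -1 * w)) (𝓝[>] 0) := by
  intro heq
  obtain ⟨ε, hε, hd⟩ := h a (Ioo_subset_Icc_self ha)
  set δ := min ε (min a (ℓ - a)) with hδ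
  have hδ0 : 0 < δ := lt_min hε (lt_min ha.1 (by linarith [ha.2]))
  have h₁ : δ ≤ ε := min_le_left _ _
  have h₂ : δ ≤ a := (min_le_right _ _).trans (min_le_left _ _)
  have h₃ : δ ≤ ℓ - a := (min_le_right _ _).trans (min_le_right _ _)
  have m₁ : (fun w => e (a + 1 * w)) '' Ioo 0 δ ∈ map (fun w => e (a + 1 * w)) (𝓝[>] 0) :=
    image_mem_map (Ioo_mem_nhdsGT hδ0)
  have m₂ : (fun w => e (a + -1 * w)) '' Ioo 0 δ ∈ map (fun w => e (a + -1 * w)) (𝓝[>] 0) :=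
    image_mem_map (Ioo_mem_nhdsGT hδ0)
  rw [heq] at m₁
  obtain ⟨x, ⟨s, hs, rfl⟩, t, ht, hst⟩ :=
    (inferInstance : (map (fun w => e (a + -1 * w)) (𝓝[>] 0)).NeBot).nonempty_of_mem
      (inter_mem m₁ m₂)
  have := hd (a + 1 * s) ⟨by linarith [hs.1, ha.1], by linarith [hs.2]⟩ (a + -1 * t)
    ⟨by linarith [ht.2], by linarith [ht.1, ha.2]⟩
    (by rw [abs_of_nonneg] <;> linarith [hs.1, hs.2])
    (by rw [abs_of_nonpos] <;> linarith [ht.1, ht.2])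
  have hst : e (a + -1 * t) = e (a + 1 * s) := hst
  rw [hst, dist_self, abs_of_nonneg (by linarith [hs.1, ht.1])] at this
  linarith [hs.1, ht.1]

/-- Unit-speed paths cannot branch at points that are not natural vertices. -/
theorem eqOn (hG : IsMetricGraph G) {α β : ℝ → G} {d : ℝ} (hα : UnitSpeed α d)
    (hβ : UnitSpeed β d) (h0 : α 0 = β 0) (hdir : map α (𝓝[>] 0) = map β (𝓝[>] 0))
    (hn : ∀ t ∈ Ioo 0 d, ¬ IsNaturalVertex (α t)) : EqOn α β (Icc 0 d) := by
  -- Continuous induction: the set of times up to which the paths agree is closed in `[0,d]`, and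
  -- agreement can always be prolonged.
  set S : Set ℝ := {t | ∀ u ∈ Icc 0 t, α u = β u} with hS
  suffices hsub : Icc 0 d ⊆ S from fun t ht => hsub ht t ⟨ht.1, le_rfl⟩
  have hcl : IsClosed {t ∈ Icc 0 d | α t = β t} := by
    have := (hα.continuousOn.prodMk hβ.continuousOn).preimage_isClosed_of_isClosed isClosed_Icc
      (isClosed_diagonal (X := G))
    exact this
  refine IsClosed.Icc_subset_of_forall_exists_gt ?_ ?_ ?_
  · rw [← closure_subset_iff_isClosed]
    intro x hx
    have hxI : x ∈ Icc 0 d := closure_minimal inter_subset_right isClosed_Icc hx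
    refine ⟨fun u hu => ?_, hxI⟩
    rcases hu.2.lt_or_eq with hlt | rfl
    · obtain ⟨t, ht, ht'⟩ := mem_closure_iff.1 hx _ isOpen_Ioi hlt
      exact ht'.1 u ⟨hu.1, (show u < t from ht).le⟩
    · have : u ∈ {t ∈ Icc 0 d | α t = β t} :=
        closure_minimal (show S ∩ Icc 0 d ⊆ {t ∈ Icc 0 d | α t = β t} from
          fun t ht => ⟨ht.2, ht.1 t ⟨ht.2.1, le_rfl⟩⟩) hcl hx
      exact this.2
  · intro u hu
    have : u = 0 := le_antisymm hu.2 hu.1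
    rw [this, h0]
  · rintro x ⟨hxS, hx0, hxd⟩ y hy
    have hxe : α x = β x := hxS x ⟨hx0, le_rfl⟩
    have m₁ : ∀ w ∈ Icc 0 (d - x), x + 1 * w ∈ Icc 0 d := fun w hw =>
      ⟨by linarith [hw.1], by linarith [hw.2]⟩
    have m₂ : ∀ w ∈ Icc 0 x, x + -1 * w ∈ Icc 0 d := fun w hw =>
      ⟨by linarith [hw.2], by linarith [hw.1]⟩
    have hdx : 0 < d - x := by linarith
    have habs : |(1 : ℝ)| = 1 := abs_one
    have habs' : |(-1 : ℝ)| = 1 := by simp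
    have hF : map (fun w => α (x + 1 * w)) (𝓝[>] 0) = map (fun w => β (x + 1 * w)) (𝓝[>] 0) := by
      rcases hx0.eq_or_lt with rfl | hx0
      · simpa using hdir
      · have hback : map (fun w => α (x + -1 * w)) (𝓝[>] 0) =
            map (fun w => β (x + -1 * w)) (𝓝[>] 0) := by
          refine map_congr ?_
          filter_upwards [Ioo_mem_nhdsGT hx0] with w hw
          exact hxS _ ⟨by linarith [hw.2], by linarith [hw.1]⟩
        have a₁ := hα.mem_dir_at habs hdx m₁
        have a₂ := hα.mem_dir_at habs' hx0 m₂
        have b₁ := hβ.mem_dir_at habs hdx m₁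
        have n₁ := hα.forward_ne_backward ⟨hx0, hxd⟩
        have n₂ := hβ.forward_ne_backward ⟨hx0, hxd⟩
        rw [← hxe] at b₁
        rw [← hback] at n₂
        by_contra hne
        -- The common backward direction together with two different forward ones would be three
        -- directions at `α x`.
        refine hn x ⟨hx0, hxd⟩ (hG.isNaturalVertex_iff.2 ?_)
        rw [Set.two_lt_ncard_iff (hG.finite_dir _)]
        exact ⟨_, _, _, a₁, a₂, b₁, n₁, hne, n₂.symm⟩
    obtain ⟨m, hm⟩ := hG.valence (α x)
    obtain ⟨ε₁, hε₁, hd₁⟩ := (hα.comp habs m₁).exists_dist_eq hdx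
    obtain ⟨ε₂, hε₂, hd₂⟩ := (hβ.comp habs m₁).exists_dist_eq hdx
    have hev := hm.eventually_eq_of_unit_speed (α := fun w => α (x + 1 * w))
      (β := fun w => β (x + 1 * w)) (lt_min hε₁ hε₂) (by simp) (by simp [hxe])
      (fun s hs t ht => hd₁ s ⟨hs.1, hs.2.trans_le (min_le_left _ _)⟩ t
        ⟨ht.1, ht.2.trans_le (min_le_left _ _)⟩)
      (fun s hs t ht => hd₂ s ⟨hs.1, hs.2.trans_le (min_le_right _ _)⟩ t
        ⟨ht.1, ht.2.trans_le (min_le_right _ _)⟩) hF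
    obtain ⟨δ, hδ, hδS⟩ := mem_nhdsGT_iff_exists_Ioo_subset.1 hev
    have hδ : 0 < δ := hδ
    have hy : x < y := hy
    set w := min (δ / 2) (y - x) with hw
    have hw0 : 0 < w := lt_min (by linarith) (by linarith)
    have hwδ : w < δ := (min_le_left _ _).trans_lt (by linarith)
    have hwy : w ≤ y - x := min_le_right _ _
    refine ⟨x + w, fun u hu => ?_, by linarith, by linarith⟩
    rcases le_or_gt u x with hux | hux
    · exact hxS u ⟨hu.1, hux⟩
    · have : u - x ∈ Ioo 0 δ := ⟨by linarith, by linarith [hu.2]⟩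
      have := hδS this
      simpa using this

end UnitSpeed

namespace IsNaturalEdge

variable {G : Type u} [MetricSpace G] {e : ℝ → G} {ℓ : ℝ}

theorem unitSpeed (h : IsNaturalEdge e ℓ) : UnitSpeed e ℓ := h.unit_speed

/-- Suppose `e s = e t` with `s < t`; the point has at most two directions. If the backward
directions agree, tracing both branches back for time `s` gives `e 0 = e (t - s)`, a natural vertex
in the interior. Otherwise the forward direction at `s` is the backward one at `t`, and the branches
run into each other at the midpoint, contradicting unit speed there. -/
theorem injOn_Ioo (hG : IsMetricGraph G) (h : IsNaturalEdge e ℓ) : InjOn e (Ioo 0 ℓ) := by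
  have main : ∀ s ∈ Ioo 0 ℓ, ∀ t ∈ Ioo 0 ℓ, s < t → e s ≠ e t := by
    intro s hs t ht hst heq
    have habs : |(1 : ℝ)| = 1 := abs_one
    have habs' : |(-1 : ℝ)| = 1 := by simp
    have m₁ : ∀ w ∈ Icc 0 s, s + -1 * w ∈ Icc 0 ℓ := fun w hw =>
      ⟨by linarith [hw.2], by linarith [hw.1, hs.2]⟩
    have m₂ : ∀ w ∈ Icc 0 s, t + -1 * w ∈ Icc 0 ℓ := fun w hw =>
      ⟨by linarith [hw.2], by linarith [hw.1, ht.2]⟩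
    have m₃ : ∀ w ∈ Icc 0 (t - s), s + 1 * w ∈ Icc 0 ℓ := fun w hw =>
      ⟨by linarith [hw.1, hs.1], by linarith [hw.2, ht.2]⟩
    have m₄ : ∀ w ∈ Icc 0 (t - s), t + -1 * w ∈ Icc 0 ℓ := fun w hw =>
      ⟨by linarith [hw.2, hs.1], by linarith [hw.1, ht.2]⟩
    by_cases hcase : map (fun w => e (s + -1 * w)) (𝓝[>] 0) =
        map (fun w => e (t + -1 * w)) (𝓝[>] 0)
    · have := UnitSpeed.eqOn hG (h.unitSpeed.comp habs' m₁) (h.unitSpeed.comp habs' m₂)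
        (by simpa using heq) hcase
        (fun w hw => h.interior _ ⟨by linarith [hw.2], by linarith [hw.1, hs.2]⟩)
        ⟨hs.1.le, le_rfl⟩
      have hz : e 0 = e (t - s) := by
        have h' : e (s + -1 * s) = e (t + -1 * s) := this
        rwa [show s + -1 * s = 0 by ring, show t + -1 * s = t - s by ring] at h'
      exact h.interior (t - s) ⟨by linarith, by linarith [hs.1, ht.2]⟩ (hz ▸ h.initial)
    · have hts : 0 < t - s := by linarith
      have a₁ := h.unitSpeed.mem_dir_at habs' hs.1 m₁
      have a₂ := h.unitSpeed.mem_dir_at habs hts m₃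
      have a₃ := h.unitSpeed.mem_dir_at habs' hts m₄
      rw [← heq] at a₃
      have hfw : map (fun w => e (s + 1 * w)) (𝓝[>] 0) =
          map (fun w => e (t + -1 * w)) (𝓝[>] 0) := by
        by_contra hne
        refine h.interior s hs (hG.isNaturalVertex_iff.2 ?_)
        rw [Set.two_lt_ncard_iff (hG.finite_dir _)]
        exact ⟨_, _, _, a₁, a₂, a₃, (h.unitSpeed.forward_ne_backward hs).symm, hcase, hne⟩
      have := UnitSpeed.eqOn hG (h.unitSpeed.comp habs m₃) (h.unitSpeed.comp habs' m₄)
        (by simpa using heq) hfw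
        (fun w hw => h.interior _ ⟨by linarith [hw.1, hs.1], by linarith [hw.2, ht.2]⟩)
      have hmid : (s + t) / 2 ∈ Icc 0 ℓ := ⟨by linarith [hs.1, ht.1], by linarith [hs.2, ht.2]⟩
      obtain ⟨ε, hε, hd⟩ := h.unit_speed _ hmid
      set δ := min (ε / 2) ((t - s) / 2) with hδ
      have hδ0 : 0 < δ := lt_min (by linarith) (by linarith)
      have hδε : δ < ε := (min_le_left _ _).trans_lt (by linarith)
      have hδt : δ ≤ (t - s) / 2 := min_le_right _ _
      have h' : e (s + 1 * ((t - s) / 2 + δ)) = e (t + -1 * ((t - s) / 2 + δ)) :=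
        this ⟨by linarith, by linarith⟩
      have := hd ((s + t) / 2 + δ) ⟨by linarith [hs.1, ht.1], by linarith [hs.2, ht.2]⟩
        ((s + t) / 2 - δ) ⟨by linarith [hs.1, ht.1], by linarith [hs.2, ht.2]⟩
        (by rw [abs_of_nonneg] <;> linarith) (by rw [abs_of_nonpos] <;> linarith)
      rw [show (s + t) / 2 + δ = s + 1 * ((t - s) / 2 + δ) by ring,
        show (s + t) / 2 - δ = t + -1 * ((t - s) / 2 + δ) by ring, h', dist_self,
        abs_of_nonneg (by linarith)] at this
      linarith
  intro x hx y hy hxy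
  by_contra hne
  rcases lt_or_gt_of_ne hne with h | h
  · exact main x hx y hy h hxy
  · exact main y hy x hx h hxy.symm

theorem finite_eq (hG : IsMetricGraph G) (h : IsNaturalEdge e ℓ) (x : G) :
    {t ∈ Icc 0 ℓ | e t = x}.Finite := by
  have h₁ : {t ∈ Ioo 0 ℓ | e t = x}.Finite :=
    Set.Subsingleton.finite fun s hs t ht => h.injOn_Ioo hG hs.1 ht.1 (hs.2.trans ht.2.symm)
  refine (h₁.union (Set.toFinite {0, ℓ})).subset fun t ht => ?_
  by_cases h0 : t = 0
  · exact Or.inr (by simp [h0])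
  by_cases hl : t = ℓ
  · exact Or.inr (by simp [hl])
  exact Or.inl ⟨⟨lt_of_le_of_ne ht.1.1 (Ne.symm h0), lt_of_le_of_ne ht.1.2 hl⟩, ht.2⟩

theorem nontrivial (h : IsNaturalEdge e ℓ) : Nontrivial G := by
  obtain ⟨ε, hε, hd⟩ := h.unitSpeed.exists_dist_eq h.pos
  refine ⟨e (ε / 2), e 0, dist_pos.1 ?_⟩
  rw [hd (ε / 2) ⟨by linarith, by linarith⟩ 0 ⟨le_rfl, hε⟩]
  exact abs_pos.2 (by linarith)

/-- A direction whose sets all meet an initial segment of `e` is a direction of that segment. -/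
theorem dir_eq_of_meets (hG : IsMetricGraph G) (h : IsNaturalEdge e ℓ) {L : ℝ}
    (hL : L ≤ ℓ) {p : G} {F : Filter G} (hF : F ∈ Dir p)
    (hm : ∀ T ∈ F, ∃ t ∈ Icc 0 L, e t ∈ T) :
    ∃ t ∈ Icc 0 L, p = e t ∧
      ((t < L ∧ F = map (fun w => e (t + 1 * w)) (𝓝[>] 0)) ∨
        (0 < t ∧ F = map (fun w => e (t + -1 * w)) (𝓝[>] 0))) := by
  by_contra! hcon
  have hc := h.unitSpeed.continuousOn
  suffices hP : ∃ T ∈ F, ∀ t ∈ Icc 0 L, e t ∉ T by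
    obtain ⟨T, hT, hT'⟩ := hP
    obtain ⟨t, ht, ht'⟩ := hm T hT
    exact hT' t ht ht'
  -- Being avoided by some set of `F` passes to finite unions, so by compactness it need only be
  -- shown near each time `t`. There `F` is disjoint from the directions of `e` at `e t`, or is
  -- based at another point.
  refine isCompact_Icc.induction_on (p := fun s => ∃ T ∈ F, ∀ t ∈ s, e t ∉ T) ?_ ?_ ?_ ?_
  · exact ⟨univ, univ_mem, fun t ht => ht.elim⟩
  · rintro s t hst ⟨T, hT, h'⟩
    exact ⟨T, hT, fun u hu => h' u (hst hu)⟩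
  · rintro s t ⟨T, hT, h₁⟩ ⟨T', hT', h₂⟩
    refine ⟨T ∩ T', inter_mem hT hT', ?_⟩
    rintro u (hu | hu) hu'
    · exact h₁ u hu hu'.1
    · exact h₂ u hu hu'.2
  · intro t ht
    have htℓ : t ∈ Icc 0 ℓ := ⟨ht.1, ht.2.trans hL⟩
    have hct : Tendsto e (𝓝[Icc 0 L] t) (𝓝 (e t)) :=
      (hc t htℓ).mono_left (nhdsWithin_mono _ (Icc_subset_Icc_right hL))
    by_cases hp : p = e t
    · subst hp
      obtain ⟨hr, hl⟩ := hcon t ht rfl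
      have right : ∃ T ∈ F, ∃ δ > 0, ∀ w ∈ Ioo 0 δ, t + w ≤ L → e (t + w) ∉ T := by
        rcases ht.2.lt_or_eq with hlt | heq
        · have hd := h.unitSpeed.mem_dir_at (a := t) (σ := 1) (d := ℓ - t) abs_one
            (by linarith) (fun w hw => ⟨by linarith [ht.1, hw.1], by linarith [hw.2]⟩)
          have hdisj := (hG.eq_or_disjoint hF hd).resolve_left (hr hlt)
          obtain ⟨T, hT, T', hT', hTT⟩ := Filter.disjoint_iff.1 hdisj
          obtain ⟨δ, hδ, hδS⟩ := mem_nhdsGT_iff_exists_Ioo_subset.1 hT'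
          refine ⟨T, hT, δ, hδ, fun w hw _ hwT => ?_⟩
          have : e (t + 1 * w) ∈ T' := hδS hw
          rw [one_mul] at this
          exact Set.disjoint_left.1 hTT hwT this
        · exact ⟨univ, univ_mem, 1, one_pos, fun w hw hwL => by linarith [hw.1]⟩
      have left : ∃ T ∈ F, ∃ δ > 0, ∀ w ∈ Ioo 0 δ, 0 ≤ t - w → e (t - w) ∉ T := by
        rcases ht.1.lt_or_eq with hlt | heq
        · have hd := h.unitSpeed.mem_dir_at (a := t) (σ := -1) (d := t) (by simp)
            hlt (fun w hw => ⟨by linarith [hw.2], by linarith [htℓ.2, hw.1]⟩)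
          have hdisj := (hG.eq_or_disjoint hF hd).resolve_left (hl hlt)
          obtain ⟨T, hT, T', hT', hTT⟩ := Filter.disjoint_iff.1 hdisj
          obtain ⟨δ, hδ, hδS⟩ := mem_nhdsGT_iff_exists_Ioo_subset.1 hT'
          refine ⟨T, hT, δ, hδ, fun w hw _ hwT => ?_⟩
          have : e (t + -1 * w) ∈ T' := hδS hw
          rw [neg_one_mul, ← sub_eq_add_neg] at this
          exact Set.disjoint_left.1 hTT hwT this
        · exact ⟨univ, univ_mem, 1, one_pos, fun w hw hwL => by linarith [hw.1]⟩
      obtain ⟨T₁, hT₁, δ₁, hδ₁, h₁⟩ := right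
      obtain ⟨T₂, hT₂, δ₂, hδ₂, h₂⟩ := left
      have hT₃ : {x | x ≠ e t} ∈ F := Dir.le hF self_mem_nhdsWithin
      refine ⟨Icc 0 L ∩ Metric.ball t (min δ₁ δ₂), inter_mem_nhdsWithin _
        (Metric.ball_mem_nhds _ (lt_min hδ₁ hδ₂)), T₁ ∩ T₂ ∩ {x | x ≠ e t},
        inter_mem (inter_mem hT₁ hT₂) hT₃, ?_⟩
      rintro u ⟨huI, hu⟩ ⟨⟨hu₁, hu₂⟩, hu₃⟩
      rw [Metric.mem_ball, Real.dist_eq] at hu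
      have b₁ := abs_lt.1 (hu.trans_le (min_le_left _ _))
      have b₂ := abs_lt.1 (hu.trans_le (min_le_right _ _))
      rcases lt_trichotomy u t with hlt | heq | hgt
      · refine h₂ (t - u) ⟨by linarith, by linarith [b₂.1]⟩ (by linarith [huI.1]) ?_
        rwa [sub_sub_cancel]
      · exact hu₃ (by rw [heq])
      · refine h₁ (u - t) ⟨by linarith, by linarith [b₁.2]⟩ (by linarith [huI.2]) ?_
        rwa [add_sub_cancel]
    · obtain ⟨U, V, hU, hV, hpU, heV, hUV⟩ := t2_separation hp
      exact ⟨e ⁻¹' V, hct (hV.mem_nhds heV), U, Dir.le_nhds hF (hU.mem_nhds hpU),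
        fun u hu huU => Set.disjoint_left.1 hUV huU hu⟩

end IsNaturalEdge

end SplitSeq

namespace SplitSeq

/-! ## Folds do not lose valence -/

/-- The total excess of valence over two in the graph is at most `C`. -/
def DirBound (G : Type u) [TopologicalSpace G] (C : ℕ) : Prop :=
  ∀ B : Finset G, ∑ p ∈ B, (Dir p).ncard ≤ 2 * B.card + C

theorem IsMetricGraph.exists_dirBound {G : Type u} [MetricSpace G] (hG : IsMetricGraph G) :
    ∃ C, DirBound G C := by
  classical
  set N := hG.finite_isNaturalVertex.toFinset with hN
  -- The total valence of the natural vertices is a crude bound; every other point has at most two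
  -- directions.
  refine ⟨∑ p ∈ N, (Dir p).ncard, fun B => ?_⟩
  rw [← Finset.sum_filter_add_sum_filter_not B (fun p => p ∈ N), add_comm]
  refine add_le_add ?_ (Finset.sum_le_sum_of_subset fun p hp => (Finset.mem_filter.1 hp).2)
  calc ∑ p ∈ B with p ∉ N, (Dir p).ncard ≤ ∑ p ∈ B with p ∉ N, 2 := by
        refine Finset.sum_le_sum fun p hp => ?_
        have : p ∉ N := (Finset.mem_filter.1 hp).2
        rw [hN, Set.Finite.mem_toFinset, mem_ofPred_eq, hG.isNaturalVertex_iff] at this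
        omega
    _ ≤ 2 * B.card := by
        rw [Finset.sum_const, smul_eq_mul, mul_comm]
        exact Nat.mul_le_mul_left 2 (Finset.card_filter_le _ _)

namespace IsFold

variable {G H : Type u} [MetricSpace G] [MetricSpace H] {f : G → H}

theorem continuous (hf : IsFold f) : Continuous f := by
  obtain ⟨e₁, e₂, ℓ₁, ℓ₂, L, -, -, -, -, -, -, hq, -⟩ := hf
  exact hq.continuous

theorem surjective (hf : IsFold f) : Function.Surjective f := by
  obtain ⟨e₁, e₂, ℓ₁, ℓ₂, L, -, -, -, -, -, -, hq, -⟩ := hf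
  exact hq.surjective

theorem nontrivial (hf : IsFold f) : Nontrivial G := by
  obtain ⟨e₁, e₂, ℓ₁, ℓ₂, L, h₁, -⟩ := hf
  exact h₁.nontrivial

theorem finite_fiber (hG : IsMetricGraph G) (hf : IsFold f) (q : H) : (f ⁻¹' {q}).Finite := by
  obtain ⟨x, rfl⟩ := hf.surjective q
  obtain ⟨e₁, e₂, ℓ₁, ℓ₂, L, h₁, h₂, h0, hL, hL', hd, hq, hker, -⟩ := hf
  have hL₁ := hL'.trans (min_le_left _ _)
  have hL₂ := hL'.trans (min_le_right _ _)
  refine (((Set.finite_singleton x).union ((h₁.finite_eq hG x).image e₂)).union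
    ((h₂.finite_eq hG x).image e₁)).subset fun y hy => ?_
  have hy : f y = f x := hy
  rcases (hker y x).1 hy with rfl | ⟨t, ht, ⟨hy, hx⟩ | ⟨hy, hx⟩⟩
  · exact Or.inl (Or.inl rfl)
  · exact Or.inr ⟨t, ⟨⟨ht.1, ht.2.trans hL₂⟩, hx.symm⟩, hy.symm⟩
  · exact Or.inl (Or.inr ⟨t, ⟨⟨ht.1, ht.2.trans hL₁⟩, hx.symm⟩, hy.symm⟩)

theorem eventually_ne (hG : IsMetricGraph G) (hf : IsFold f) (p : G) :
    ∀ᶠ x in 𝓝[≠] p, f x ≠ f p := by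
  have hfin : (f ⁻¹' {f p} \ {p}).Finite := (hf.finite_fiber hG (f p)).subset sdiff_subset
  have := hfin.isClosed.isOpen_compl.mem_nhds (show p ∈ (f ⁻¹' {f p} \ {p})ᶜ from fun h => h.2 rfl)
  filter_upwards [mem_nhdsWithin_of_mem_nhds this, self_mem_nhdsWithin] with x hx hxp heq
  exact hx ⟨heq, hxp⟩

/-- Pulling back along a fold, the finite set `A` of points downstairs is taken to contain the
images of the natural vertices in `B` and of the end of the folded segment. -/
theorem exists_saturated (hG : IsMetricGraph G) (hf : IsFold f) (B : Finset G)
    (hB : ∀ p ∈ B, IsNaturalVertex p) :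
    ∃ (A : Finset H) (B' : Finset G) (R : Set (Filter G)), B ⊆ B' ∧ (∀ p, p ∈ B' ↔ f p ∈ A) ∧
      A.card + 1 ≤ B'.card ∧ R.Finite ∧ R.ncard ≤ 2 ∧
      ∀ p ∈ B', ∀ p' ∈ B', ∀ E ∈ Dir p, ∀ F ∈ Dir p', map f E = map f F →
        E = F ∨ E ∈ R ∨ F ∈ R := by
  classical
  have hfib := hf.finite_fiber hG
  have hsurj := hf.surjective
  obtain ⟨e₁, e₂, ℓ₁, ℓ₂, L, h₁, h₂, h0, hL, hL', hd, hq, hker, -⟩ := hf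
  have hL₁ := hL'.trans (min_le_left _ _)
  have hL₂ := hL'.trans (min_le_right _ _)
  have hdis : ∀ s ∈ Ioc 0 L, ∀ t ∈ Ioc 0 L, e₁ s ≠ e₂ t := fun s hs t ht he =>
    Set.disjoint_left.1 hd (mem_image_of_mem _ hs) (he ▸ mem_image_of_mem _ ht)
  have hfe : ∀ t ∈ Icc 0 L, f (e₁ t) = f (e₂ t) := fun t ht =>
    (hker _ _).2 (Or.inr ⟨t, ht, Or.inl ⟨rfl, rfl⟩⟩)
  -- Including the end `f (e₁ L)` of the folded segment puts the two different points `e₁ L` and `e₂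
  -- L` into the preimage of `A`.
  set A : Finset H := (insert (e₁ L) B).image f with hA
  have hfin : (f ⁻¹' (A : Set H)).Finite := by
    have : f ⁻¹' (A : Set H) = ⋃ q ∈ (A : Set H), f ⁻¹' {q} := by
      ext x; simp
    rw [this]
    exact A.finite_toSet.biUnion fun q _ => hfib q
  have hmem : ∀ p, p ∈ hfin.toFinset ↔ f p ∈ A := fun p => by simp
  have hLmem : L ∈ Ioc 0 L := ⟨hL, le_rfl⟩
  have hLmem' : L ∈ Icc 0 L := ⟨hL.le, le_rfl⟩
  -- The exceptional directions are those of the folded part of `e₁` at its two ends: outwards at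
  -- the initial vertex and backwards at `e₁ L`.
  refine ⟨A, hfin.toFinset, {map (fun w => e₁ (0 + 1 * w)) (𝓝[>] 0),
    map (fun w => e₁ (L + -1 * w)) (𝓝[>] 0)}, ?_, hmem, ?_, Set.toFinite _, ?_, ?_⟩
  · intro p hp
    rw [hmem]
    exact Finset.mem_image_of_mem f (Finset.mem_insert_of_mem hp)
  · have h₁A : f (e₁ L) ∈ A := Finset.mem_image_of_mem f (Finset.mem_insert_self _ _)
    have hmem₁ : e₁ L ∈ hfin.toFinset := (hmem _).2 h₁A
    have hmem₂ : e₂ L ∈ hfin.toFinset := (hmem _).2 (by rw [← hfe L hLmem']; exact h₁A)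
    -- Since `e₂ L` has the same image, `e₁ L` can be dropped and the remaining points still cover
    -- `A`; this is the gain of one point.
    have hsub : A ⊆ (hfin.toFinset.erase (e₁ L)).image f := by
      intro q hq'
      obtain ⟨p, rfl⟩ := hsurj q
      by_cases hp : p = e₁ L
      · rw [hp, hfe L hLmem']
        exact Finset.mem_image_of_mem f (Finset.mem_erase.2
          ⟨(hdis L hLmem L hLmem).symm, hmem₂⟩)
      · exact Finset.mem_image_of_mem f (Finset.mem_erase.2 ⟨hp, (hmem p).2 hq'⟩)
    have := (Finset.card_le_card hsub).trans Finset.card_image_le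
    rw [Finset.card_erase_of_mem hmem₁] at this
    have hpos := Finset.card_pos.2 ⟨_, hmem₁⟩
    omega
  · exact (Set.ncard_insert_le _ _).trans (by rw [Set.ncard_singleton])
  · have interior : ∀ t ∈ Ioo 0 L, f (e₁ t) ∉ A := by
      intro t ht hmemA
      have ht₁ : t ∈ Ioo 0 ℓ₁ := ⟨ht.1, ht.2.trans_le hL₁⟩
      have ht₂ : t ∈ Ioo 0 ℓ₂ := ⟨ht.1, ht.2.trans_le hL₂⟩
      have hn₁ := h₁.interior t ht₁
      obtain ⟨b, hb, hbt⟩ := Finset.mem_image.1 hmemA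
      have hb : IsNaturalVertex b ∨ b = e₁ L := by
        rcases Finset.mem_insert.1 hb with hb | hb
        · exact Or.inr hb
        · exact Or.inl (hB b hb)
      have hneL : e₁ t ≠ e₁ L := by
        intro heq
        rcases hL₁.lt_or_eq with hlt | heqL
        · exact ht.2.ne (h₁.injOn_Ioo hG ht₁ ⟨hL, hlt⟩ heq)
        · exact hn₁ (by rw [heq, heqL]; exact h₁.terminal)
      rcases (hker b (e₁ t)).1 hbt with rfl | ⟨u, hu, ⟨hbu, htu⟩ | ⟨hbu, htu⟩⟩
      · rcases hb with hb | hb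
        · exact hn₁ hb
        · exact hneL hb
      · rcases hu.1.eq_or_lt with rfl | hu0
        · exact hn₁ (by rw [htu]; exact h₂.initial)
        · exact hdis t ⟨ht.1, ht.2.le⟩ u ⟨hu0, hu.2⟩ htu
      · have hut : t = u := by
          rcases hu.1.eq_or_lt with rfl | hu0
          · exact absurd (by rw [htu]; exact h₁.initial) hn₁
          rcases (hu.2.trans hL₁).lt_or_eq with hlt | heqL
          · exact h₁.injOn_Ioo hG ht₁ ⟨hu0, hlt⟩ htu
          · exact absurd (by rw [htu, heqL]; exact h₁.terminal) hn₁
        subst hut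
        rcases hb with hb | hb
        · exact h₂.interior t ht₂ (by rw [← hbu]; exact hb)
        · exact hdis L hLmem t ⟨ht.1, ht.2.le⟩ (hb.symm.trans hbu)
    have side : ∀ p ∈ hfin.toFinset, ∀ E ∈ Dir p, (∀ T ∈ E, ∃ t ∈ Icc 0 L, e₁ t ∈ T) →
        E ∈ ({map (fun w => e₁ (0 + 1 * w)) (𝓝[>] 0),
          map (fun w => e₁ (L + -1 * w)) (𝓝[>] 0)} : Set (Filter G)) := by
      intro p hp E hE hmeet
      obtain ⟨t, ht, rfl, hcase⟩ := h₁.dir_eq_of_meets hG hL₁ hE hmeet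
      have hnt : t ∉ Ioo 0 L := fun htI => interior t htI ((hmem _).1 hp)
      rcases hcase with ⟨hlt, rfl⟩ | ⟨hlt, rfl⟩
      · have : t = 0 := by
          by_contra hne
          exact hnt ⟨lt_of_le_of_ne ht.1 (Ne.symm hne), hlt⟩
        subst this
        exact Or.inl rfl
      · have : t = L := by
          by_contra hne
          exact hnt ⟨hlt, lt_of_le_of_ne ht.2 hne⟩
        subst this
        exact Or.inr rfl
    intro p hp p' hp' E hE F hF hEF
    -- Off the folded part of `e₁` the map `f` is injective. Nonexceptional directions contain sets
    -- that avoid this part, so distinct ones cannot acquire the same image.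
    by_contra! hcon
    obtain ⟨hne, hER, hFR⟩ := hcon
    have hdisj : Disjoint E F := by
      by_cases hpp : p = p'
      · subst hpp
        exact (hG.eq_or_disjoint hE hF).resolve_left hne
      · exact (disjoint_nhds_nhds.2 hpp).mono (Dir.le_nhds hE) (Dir.le_nhds hF)
    obtain ⟨S, hS, S', hS', hSS⟩ := Filter.disjoint_iff.1 hdisj
    have hE' : ∃ T ∈ E, ∀ t ∈ Icc 0 L, e₁ t ∉ T := by
      by_contra! h; exact hER (side p hp E hE h)
    have hF' : ∃ T ∈ F, ∀ t ∈ Icc 0 L, e₁ t ∉ T := by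
      by_contra! h; exact hFR (side p' hp' F hF h)
    obtain ⟨T, hT, hTe⟩ := hE'
    obtain ⟨T', hT', hTe'⟩ := hF'
    have m₁ : f '' (T ∩ S) ∈ map f F := hEF ▸ image_mem_map (inter_mem hT hS)
    have m₂ : f '' (T' ∩ S') ∈ map f F := image_mem_map (inter_mem hT' hS')
    have := Dir.neBot hF
    obtain ⟨_, ⟨y, hy, rfl⟩, y', hy', hyy⟩ :=
      (inferInstance : (map f F).NeBot).nonempty_of_mem (inter_mem m₁ m₂)
    rcases (hker y' y).1 hyy with rfl | ⟨t, ht, ⟨ha, hb⟩ | ⟨ha, hb⟩⟩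
    · exact Set.disjoint_left.1 hSS hy.2 hy'.2
    · exact hTe' t ht (ha ▸ hy'.1)
    · exact hTe t ht (hb ▸ hy.1)

/-- Over a saturated set all but two directions inject into those at `A`, so there are at most `2 *
A.card + C + 2` of them. Because `A` has at least one point fewer than its preimage `B'`, this is at
most `2 * B'.card + C`. Valence at least two everywhere, and at most two at points that are not
natural vertices, transfers the bound from `B'` to `B`. -/
theorem dirBound {n : ℕ} (hG : IsCoreGraph n G) (hH : IsMetricGraph H) (hf : IsFold f) {C : ℕ}
    (hC : DirBound H C) : DirBound G C := by
  classical
  have hGm := hG.toIsMetricGraph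
  have := hf.nontrivial
  have h2 := hG.two_le_ncard_dir
  intro B
  set B₀ := B.filter fun p => IsNaturalVertex p with hB₀
  obtain ⟨A, B', R, hsub, hmem, hcard, hRfin, hR, hinj⟩ := hf.exists_saturated hGm B₀
    fun p hp => (Finset.mem_filter.1 hp).2
  have e₁ : ∑ p ∈ B, (Dir p).ncard ≤ ∑ p ∈ B₀, (Dir p).ncard + 2 * (B \ B₀).card := by
    rw [← Finset.sum_sdiff (show B₀ ⊆ B from Finset.filter_subset _ B), add_comm]
    refine Nat.add_le_add_left ?_ _
    rw [mul_comm, ← smul_eq_mul, ← Finset.sum_const]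
    refine Finset.sum_le_sum fun p hp => ?_
    have hp := Finset.mem_sdiff.1 hp
    have : ¬ IsNaturalVertex p := fun h => hp.2 (Finset.mem_filter.2 ⟨hp.1, h⟩)
    rw [hGm.isNaturalVertex_iff] at this
    omega
  have e₂ : ∑ p ∈ B₀, (Dir p).ncard + 2 * (B' \ B₀).card ≤ ∑ p ∈ B', (Dir p).ncard := by
    rw [← Finset.sum_sdiff hsub, add_comm]
    refine Nat.add_le_add_right ?_ _
    rw [mul_comm, ← smul_eq_mul, ← Finset.sum_const]
    exact Finset.sum_le_sum fun p _ => h2 p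
  have c₁ := Finset.card_sdiff_add_card_eq_card (show B₀ ⊆ B from Finset.filter_subset _ B)
  have c₂ := Finset.card_sdiff_add_card_eq_card hsub
  set D : G → Finset (Filter G) := fun p => (hGm.finite_dir p).toFinset with hD
  set D' : H → Finset (Filter H) := fun p => (hH.finite_dir p).toFinset with hD'
  have e₃ : ∑ p ∈ B', (Dir p).ncard = (B'.biUnion D).card := by
    rw [Finset.card_biUnion]
    · exact Finset.sum_congr rfl fun p _ => Set.ncard_eq_toFinset_card _ (hGm.finite_dir p)
    · intro p _ q _ hpq
      rw [Function.onFun, Finset.disjoint_left]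
      intro F hF hF'
      exact hpq (Dir.eq_of_mem ((Set.Finite.mem_toFinset _).1 hF)
        ((Set.Finite.mem_toFinset _).1 hF'))
  have e₄ : (A.biUnion D').card ≤ ∑ q ∈ A, (Dir q).ncard :=
    Finset.card_biUnion_le.trans (Finset.sum_le_sum fun p _ =>
      (Set.ncard_eq_toFinset_card _ (hH.finite_dir p)).ge)
  have e₅ : (B'.biUnion D \ hRfin.toFinset).card ≤ (A.biUnion D').card := by
    refine Finset.card_le_card_of_injOn (map f) ?_ ?_
    · intro F hF
      obtain ⟨hF, -⟩ := Finset.mem_sdiff.1 hF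
      obtain ⟨p, hp, hF⟩ := Finset.mem_biUnion.1 hF
      refine Finset.mem_biUnion.2 ⟨f p, (hmem p).1 hp, (Set.Finite.mem_toFinset _).2 ?_⟩
      exact Dir.map hf.continuous (hf.eventually_ne hGm p) ((Set.Finite.mem_toFinset _).1 hF)
    · intro E hE F hF hEF
      obtain ⟨hE, hER⟩ := Finset.mem_sdiff.1 hE
      obtain ⟨hF, hFR⟩ := Finset.mem_sdiff.1 hF
      obtain ⟨p, hp, hE⟩ := Finset.mem_biUnion.1 hE
      obtain ⟨q, hq, hF⟩ := Finset.mem_biUnion.1 hF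
      rw [Set.Finite.mem_toFinset] at hER hFR
      rcases hinj p hp q hq E ((Set.Finite.mem_toFinset _).1 hE) F
        ((Set.Finite.mem_toFinset _).1 hF) hEF with h | h | h
      · exact h
      · exact absurd h hER
      · exact absurd h hFR
  have e₆ := Finset.card_le_card_sdiff_add_card (s := B'.biUnion D) (t := hRfin.toFinset)
  have e₇ : hRfin.toFinset.card ≤ 2 := by rwa [← Set.ncard_eq_toFinset_card _ hRfin]
  have e₈ := hC A
  omega

end IsFold

end SplitSeq

namespace SplitSeq

/-! ## Lifting open arcs -/

theorem IsMetricGraph.exists_dir_meets {G : Type u} [MetricSpace G] (hG : IsMetricGraph G) {z : G}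
    {M : Filter G} (hM : (𝓝[≠] z ⊓ M).NeBot) : ∃ F ∈ Dir z, (F ⊓ M).NeBot := by
  by_contra! hcon
  have h₁ : Disjoint (sSup (Dir z)) M := by
    rw [← (hG.finite_dir z).coe_toFinset, ← Finset.sup_id_eq_sSup, Finset.disjoint_sup_left]
    intro F hF
    exact disjoint_iff.2 (hcon F ((Set.Finite.mem_toFinset _).1 hF))
  exact hM.ne (disjoint_iff.1 (h₁.mono_left (hG.nhdsNE_le z)))

/-- `a` parameterizes an open arc of `Z` over which `f : Y → Z` is a local homeomorphism. -/
structure IsArcCover {Y : Type u} {Z : Type v} [MetricSpace Y] [MetricSpace Z] (f : Y → Z)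
    (a : ℝ → Z) : Prop where
  graph : IsMetricGraph Y
  cont : Continuous f
  arc_cont : ContinuousOn a (Ioo 0 1)
  arc_inj : InjOn a (Ioo 0 1)
  arc_open : ∀ t ∈ Ioo 0 1, ∀ T ∈ 𝓝 t, a '' T ∈ 𝓝 (a t)
  loc_open : ∀ y, f y ∈ a '' Ioo 0 1 → 𝓝 (f y) ≤ map f (𝓝 y)
  loc_inj : ∀ y, f y ∈ a '' Ioo 0 1 → ∃ U ∈ 𝓝 y, InjOn f U

/-- `σ` lifts the open arc `a` through `f`. -/
structure IsLift {Y : Type u} {Z : Type v} [TopologicalSpace Y] (f : Y → Z) (a : ℝ → Z)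
    (σ : ℝ → Y) : Prop where
  cont : ContinuousOn σ (Ioo 0 1)
  lift : ∀ t ∈ Ioo 0 1, f (σ t) = a t

theorem IsLift.map_eq {Y : Type u} {Z : Type v} [TopologicalSpace Y] {f : Y → Z} {a : ℝ → Z}
    {σ : ℝ → Y} (hσ : IsLift f a σ) : map f (map σ (𝓝[>] 0)) = map a (𝓝[>] 0) := by
  rw [Filter.map_map]
  refine map_congr ?_
  filter_upwards [Ioo_mem_nhdsGT one_pos] with t ht using hσ.lift t ht

namespace IsArcCover

variable {Y : Type u} {Z : Type v} [MetricSpace Y] [MetricSpace Z] {f : Y → Z} {a : ℝ → Z}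
  {σ σ' : ℝ → Y}

theorem isOpen_arc (h : IsArcCover f a) : IsOpen (a '' Ioo 0 1) := by
  rw [isOpen_iff_mem_nhds]
  rintro _ ⟨t, ht, rfl⟩
  exact h.arc_open t ht _ (Ioo_mem_nhds ht.1 ht.2)

/-- Compactness of `Y` promotes the local homeomorphism over the arc to a covering, so that arcs
lift uniquely. -/
theorem isCoveringMapOn (h : IsArcCover f a) : IsCoveringMapOn f (a '' Ioo 0 1) := by
  have := h.graph.compact
  refine IsCoveringMapOn.of_isLocalHomeomorphOn h.cont ?_
  rw [isLocalHomeomorphOn_iff_isOpenEmbedding_restrict]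
  intro y hy
  obtain ⟨U, hU, hinj⟩ := h.loc_inj y hy
  have hW : IsOpen (interior U ∩ f ⁻¹' (a '' Ioo 0 1)) :=
    isOpen_interior.inter (h.isOpen_arc.preimage h.cont)
  refine ⟨_, hW.mem_nhds ⟨mem_interior_iff_mem_nhds.2 hU, hy⟩, ?_⟩
  refine IsOpenEmbedding.of_continuous_injective_isOpenMap (h.cont.comp continuous_subtype_val)
    ?_ ?_
  · intro x x' hxx
    exact Subtype.ext (hinj (interior_subset x.2.1) (interior_subset x'.2.1) hxx)
  · rw [isOpenMap_iff_nhds_le]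
    intro x
    calc 𝓝 (f x) ≤ map f (𝓝 (x : Y)) := h.loc_open _ x.2.2
      _ = map f (map Subtype.val (𝓝 x)) := by
        rw [map_nhds_subtype_coe_eq_nhds x.2 (hW.mem_nhds x.2)]
      _ = _ := Filter.map_map

theorem existsUnique_lift (h : IsArcCover f a) {y : Y} {t : ℝ} (ht : t ∈ Ioo (0 : ℝ) 1)
    (hy : f y = a t) : ∃! F : C(Ioo (0 : ℝ) 1, Y), F ⟨t, ht⟩ = y ∧
      f ∘ F = (⟨fun s => a s, continuousOn_iff_continuous_domRestrict.1 h.arc_cont⟩ :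
        C(Ioo (0 : ℝ) 1, Z)) := by
  have : ContractibleSpace (Ioo (0 : ℝ) 1) := (convex_Ioo 0 1).contractibleSpace ⟨t, ht⟩
  have : LocallyPathConnectedSpace (Ioo (0 : ℝ) 1) := isOpen_Ioo.locallyPathConnectedSpace
  exact h.isCoveringMapOn.existsUnique_continuousMap_lifts _ hy fun s => mem_image_of_mem a s.2

theorem exists_lift (h : IsArcCover f a) {y : Y} {t : ℝ} (ht : t ∈ Ioo (0 : ℝ) 1)
    (hy : f y = a t) : ∃ σ, IsLift f a σ ∧ σ t = y := by
  classical
  obtain ⟨F, ⟨hF₁, hF₂⟩, -⟩ := h.existsUnique_lift ht hy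
  refine ⟨fun s => if hs : s ∈ Ioo (0 : ℝ) 1 then F ⟨s, hs⟩ else y, ⟨?_, fun s hs => ?_⟩, ?_⟩
  · rw [continuousOn_iff_continuous_domRestrict]
    convert F.continuous using 1
    ext s
    exact dif_pos s.2
  · simp only [dif_pos hs]
    exact congrFun hF₂ ⟨s, hs⟩
  · simp only [dif_pos ht, hF₁]

theorem lift_unique (h : IsArcCover f a) (hσ : IsLift f a σ) (hσ' : IsLift f a σ') {t : ℝ}
    (ht : t ∈ Ioo (0 : ℝ) 1) (heq : σ t = σ' t) : EqOn σ σ' (Ioo 0 1) := by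
  have hu := h.existsUnique_lift ht (hσ.lift t ht)
  have e := hu.unique
    (y₁ := ⟨fun s => σ s, continuousOn_iff_continuous_domRestrict.1 hσ.cont⟩)
    (y₂ := ⟨fun s => σ' s, continuousOn_iff_continuous_domRestrict.1 hσ'.cont⟩)
    ⟨rfl, funext fun s => hσ.lift s s.2⟩ ⟨heq.symm, funext fun s => hσ'.lift s s.2⟩
  intro s hs
  exact congrArg (fun F : C(Ioo (0 : ℝ) 1, Y) => F ⟨s, hs⟩) e

/-- Lifts with a common point agree. -/
theorem lift_eq_of_meet (h : IsArcCover f a) (hσ : IsLift f a σ) (hσ' : IsLift f a σ') {s t : ℝ}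
    (hs : s ∈ Ioo (0 : ℝ) 1) (ht : t ∈ Ioo (0 : ℝ) 1) (heq : σ s = σ' t) :
    s = t ∧ EqOn σ σ' (Ioo 0 1) := by
  have : s = t := h.arc_inj hs ht (by rw [← hσ.lift s hs, ← hσ'.lift t ht, heq])
  subst this
  exact ⟨rfl, h.lift_unique hσ hσ' hs heq⟩

theorem isOpen_lift (h : IsArcCover f a) (hσ : IsLift f a σ) : IsOpen (σ '' Ioo 0 1) := by
  rw [isOpen_iff_mem_nhds]
  rintro _ ⟨t, ht, rfl⟩
  obtain ⟨U, hU, hinj⟩ := h.loc_inj (σ t) ⟨t, ht, (hσ.lift t ht).symm⟩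
  have hT : Ioo 0 1 ∩ σ ⁻¹' U ∈ 𝓝 t :=
    inter_mem (Ioo_mem_nhds ht.1 ht.2)
      ((hσ.cont.continuousAt (Ioo_mem_nhds ht.1 ht.2)).preimage_mem_nhds hU)
  have hA := h.arc_open t ht _ hT
  rw [← hσ.lift t ht] at hA
  filter_upwards [hU, h.cont.continuousAt.preimage_mem_nhds hA] with y hyU hy
  obtain ⟨t', ⟨ht', ht'U⟩, hy⟩ := hy
  exact ⟨t', ht', hinj ht'U hyU ((hσ.lift t' ht').trans hy)⟩

/-- Lifts that differ have disjoint open images, and together the lifts fill the preimage of the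
arc; a connected set over the arc thus stays in one of them. -/
theorem subset_lift (h : IsArcCover f a) (hσ : IsLift f a σ) {S : Set Y} (hS : IsPreconnected S)
    (hSA : ∀ y ∈ S, f y ∈ a '' Ioo 0 1) (hne : (S ∩ σ '' Ioo 0 1).Nonempty) :
    S ⊆ σ '' Ioo 0 1 := by
  refine hS.subset_left_of_subset_union (h.isOpen_lift hσ)
    (v := ⋃ σ' ∈ {σ' | IsLift f a σ' ∧ Disjoint (σ '' Ioo 0 1) (σ' '' Ioo 0 1)}, σ' '' Ioo 0 1)
    (isOpen_biUnion fun σ' hσ' => h.isOpen_lift hσ'.1) ?_ ?_ hne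
  · exact disjoint_iUnion₂_right.2 fun σ' hσ' => hσ'.2
  · intro y hy
    by_cases hyσ : y ∈ σ '' Ioo 0 1
    · exact Or.inl hyσ
    obtain ⟨t, ht, hty⟩ := hSA y hy
    obtain ⟨σ', hσ', hσ't⟩ := h.exists_lift ht hty.symm
    refine Or.inr (mem_biUnion ⟨hσ', ?_⟩ ⟨t, ht, hσ't⟩)
    rw [Set.disjoint_left]
    rintro _ ⟨s, hs, rfl⟩ ⟨s', hs', he⟩
    obtain ⟨rfl, heq⟩ := h.lift_eq_of_meet hσ' hσ hs' hs he
    exact hyσ ⟨t, ht, by rw [← heq ht, hσ't]⟩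

/-- A path representing `F` lies initially over the arc, hence in a single lift. Its parameter along
this lift is continuous and tends to `0` from the right, so path and lift have the same germ. -/
theorem exists_lift_of_dir (h : IsArcCover f a) {z : Y} {F : Filter Y} (hF : F ∈ Dir z)
    (hFa : map f F = map a (𝓝[>] 0)) : ∃ σ, IsLift f a σ ∧ map σ (𝓝[>] 0) = F := by
  obtain ⟨γ, ε₀, hε₀, hc, hγ, rfl⟩ := hF
  rw [Filter.map_map] at hFa
  have hsmall : ∀ s > 0, ∀ᶠ u in 𝓝[>] (0 : ℝ), f (γ u) ∈ a '' Ioo 0 s := fun s hs => by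
    have : a '' Ioo 0 s ∈ map a (𝓝[>] 0) := image_mem_map (Ioo_mem_nhdsGT hs)
    rwa [← hFa] at this
  obtain ⟨ε, hε, hεS⟩ := mem_nhdsGT_iff_exists_Ioo_subset.1
    ((hsmall 1 one_pos).and (Ioo_mem_nhdsGT hε₀))
  have hε : 0 < ε := hε
  have hcε : ContinuousOn γ (Ioo 0 ε) := hc.mono fun u hu => (hεS hu).2
  have hmid : ε / 2 ∈ Ioo 0 ε := ⟨by linarith, by linarith⟩
  obtain ⟨t₀, ht₀, he₀⟩ := (hεS hmid).1
  obtain ⟨σ, hσ, hσt⟩ := h.exists_lift ht₀ he₀.symm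
  have hsub : γ '' Ioo 0 ε ⊆ σ '' Ioo 0 1 := by
    refine h.subset_lift hσ (isPreconnected_Ioo.image γ hcε) ?_
      ⟨_, mem_image_of_mem γ hmid, t₀, ht₀, hσt⟩
    rintro _ ⟨u, hu, rfl⟩
    exact (hεS hu).1
  have hex : ∀ u, ∃ t, u ∈ Ioo 0 ε → t ∈ Ioo 0 1 ∧ σ t = γ u := fun u => by
    by_cases hu : u ∈ Ioo 0 ε
    · obtain ⟨t, ht, he⟩ := hsub (mem_image_of_mem γ hu)
      exact ⟨t, fun _ => ⟨ht, he⟩⟩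
    · exact ⟨0, fun h => absurd h hu⟩
  choose τ hτ using hex
  have hfτ : ∀ u ∈ Ioo 0 ε, f (γ u) = a (τ u) := fun u hu => by
    rw [← (hτ u hu).2, hσ.lift _ (hτ u hu).1]
  have hτc : ContinuousOn τ (Ioo 0 ε) := by
    intro u hu
    refine ContinuousAt.continuousWithinAt ?_
    intro T hT
    have hT' : T ∩ Ioo 0 1 ∈ 𝓝 (τ u) :=
      inter_mem hT (Ioo_mem_nhds (hτ u hu).1.1 (hτ u hu).1.2)
    have hA := h.arc_open _ (hτ u hu).1 _ hT'
    rw [← hfτ u hu] at hA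
    have hcu : ContinuousAt (fun u => f (γ u)) u :=
      h.cont.continuousAt.comp (hcε.continuousAt (Ioo_mem_nhds hu.1 hu.2))
    rw [mem_map]
    filter_upwards [hcu.preimage_mem_nhds hA, Ioo_mem_nhds hu.1 hu.2] with u' hu' hu'I
    obtain ⟨t, ⟨htT, htI⟩, het⟩ := hu'
    have het : a t = f (γ u') := het
    rw [hfτ u' hu'I] at het
    rw [mem_preimage, ← h.arc_inj htI (hτ u' hu'I).1 het]
    exact htT
  have hτ0 : Tendsto τ (𝓝[>] 0) (𝓝[>] 0) := by
    intro S hS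
    obtain ⟨s, hs, hsS⟩ := mem_nhdsGT_iff_exists_Ioo_subset.1 hS
    have hs : 0 < s := hs
    rw [mem_map]
    filter_upwards [hsmall _ (lt_min hs one_pos), Ioo_mem_nhdsGT hε] with u hu huI
    obtain ⟨t, ht, het⟩ := hu
    rw [hfτ u huI] at het
    have := h.arc_inj ⟨ht.1, ht.2.trans_le (min_le_right _ _)⟩ (hτ u huI).1 het
    rw [mem_preimage, ← this]
    exact hsS ⟨ht.1, ht.2.trans_le (min_le_left _ _)⟩
  refine ⟨σ, hσ, ?_⟩
  calc map σ (𝓝[>] 0) = map σ (map τ (𝓝[>] 0)) := by rw [map_nhdsGT_zero_eq hε hτc hτ0]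
    _ = map γ (𝓝[>] 0) := by
      rw [Filter.map_map]
      refine map_congr ?_
      filter_upwards [Ioo_mem_nhdsGT hε] with u hu
      exact (hτ u hu).2

theorem lift_eq_of_dir (h : IsArcCover f a) (hσ : IsLift f a σ) (hσ' : IsLift f a σ')
    (hd : (map σ (𝓝[>] 0) ⊓ map σ' (𝓝[>] 0)).NeBot) : EqOn σ σ' (Ioo 0 1) := by
  have m₁ : σ '' Ioo 0 1 ∈ map σ (𝓝[>] 0) := image_mem_map (Ioo_mem_nhdsGT one_pos)
  have m₂ : σ' '' Ioo 0 1 ∈ map σ' (𝓝[>] 0) := image_mem_map (Ioo_mem_nhdsGT one_pos)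
  obtain ⟨_, ⟨s, hs, rfl⟩, t, ht, he⟩ := hd.nonempty_of_mem (inter_mem_inf m₁ m₂)
  exact (h.lift_eq_of_meet hσ hσ' hs ht he.symm).2

/-- By compactness the lift has a cluster point `z`, necessarily over `p`, and some direction `F` at
`z` meets the germ of the lift. The image of `F` then meets, hence equals, the germ of `a`, so `F`
is itself the germ of a lift; lifts whose germs meet coincide. -/
theorem exists_center (h : IsArcCover f a) (hZ : IsMetricGraph Z)
    (hiso : ∀ z, ∀ᶠ y in 𝓝[≠] z, f y ≠ f z) {p : Z} (ha : map a (𝓝[>] 0) ∈ Dir p)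
    (hσ : IsLift f a σ) : ∃ z, f z = p ∧ map σ (𝓝[>] 0) ∈ Dir z := by
  have := h.graph.compact
  have hM := hσ.map_eq
  obtain ⟨z, hz⟩ := exists_clusterPt_of_compactSpace (map σ (𝓝[>] (0 : ℝ)))
  have hfz : f z = p := by
    have h₁ : ClusterPt (f z) (map f (map σ (𝓝[>] 0))) :=
      hz.map h.cont.continuousAt tendsto_map
    rw [hM] at h₁
    have h₂ : ClusterPt (f z) (𝓝 p) := h₁.mono (Dir.le_nhds ha)
    exact eq_of_nhds_neBot h₂
  have hne : {z}ᶜ ∈ map σ (𝓝[>] (0 : ℝ)) := by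
    have h₁ : {p}ᶜ ∈ map a (𝓝[>] (0 : ℝ)) := Dir.le ha self_mem_nhdsWithin
    rw [← hM] at h₁
    refine mem_of_superset (mem_map.1 h₁) ?_
    rintro y hy rfl
    exact hy hfz
  have hmeet : (𝓝[≠] z ⊓ map σ (𝓝[>] (0 : ℝ))).NeBot := by
    have : 𝓝[≠] z ⊓ map σ (𝓝[>] (0 : ℝ)) = 𝓝 z ⊓ map σ (𝓝[>] (0 : ℝ)) := by
      rw [nhdsWithin, inf_assoc, inf_eq_right.2 (le_principal_iff.2 hne)]
    rw [this]
    exact hz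
  obtain ⟨F, hF, hFσ⟩ := h.graph.exists_dir_meets hmeet
  have hfF : map f F = map a (𝓝[>] 0) := by
    have h₁ : map f F ∈ Dir p := hfz ▸ Dir.map h.cont (hiso z) hF
    refine (hZ.eq_or_disjoint h₁ ha).resolve_right fun hdis => ?_
    have : (map f (F ⊓ map σ (𝓝[>] (0 : ℝ)))).NeBot := hFσ.map f
    refine this.ne (le_bot_iff.1 (hdis ?_ ?_))
    · exact map_mono inf_le_left
    · exact (map_mono inf_le_right).trans hM.le
  obtain ⟨σ', hσ', rfl⟩ := h.exists_lift_of_dir hF hfF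
  have heq := h.lift_eq_of_dir hσ' hσ hFσ
  refine ⟨z, hfz, ?_⟩
  have : map σ (𝓝[>] 0) = map σ' (𝓝[>] (0 : ℝ)) := map_congr <| by
    filter_upwards [Ioo_mem_nhdsGT one_pos] with t ht using (heq ht).symm
  rwa [this]

end IsArcCover

end SplitSeq

namespace SplitSeq

/-! ## Model stars -/

/-- The parameterization of the `i`-th closed prong of the model star. -/
noncomputable def starPath {n : ℕ} (i : Fin n) (t : ℝ) : Star n :=
  open Classical in
  Quotient.mk (starSetoid n) (i, if h : t ∈ Ico (0 : ℝ) 1 then ⟨t, h⟩ else ⟨0, le_rfl, one_pos⟩)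

section Star

variable {n m : ℕ}

theorem starPath_of_mem {t : ℝ} (ht : t ∈ Ico (0 : ℝ) 1) (i : Fin n) :
    starPath i t = Quotient.mk (starSetoid n) (i, ⟨t, ht⟩) := by
  rw [starPath, dif_pos ht]

theorem continuousOn_starPath (i : Fin n) : ContinuousOn (starPath i) (Ico 0 1) := by
  rw [continuousOn_iff_continuous_domRestrict]
  have : (Ico (0 : ℝ) 1).domRestrict (starPath i) =
      fun t => Quotient.mk (starSetoid n) (i, t) := by
    ext t
    exact starPath_of_mem t.2 i
  rw [this]
  exact continuous_quotient_mk'.comp (continuous_const.prodMk continuous_id)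

theorem exists_starPath (q : Star n) : ∃ i, ∃ t ∈ Ico (0 : ℝ) 1, q = starPath i t := by
  induction q using Quotient.inductionOn with
  | h x => exact ⟨x.1, x.2, x.2.2, by rw [starPath_of_mem x.2.2]⟩

theorem starPath_eq_iff {i j : Fin n} {s t : ℝ} (hs : s ∈ Ico (0 : ℝ) 1)
    (ht : t ∈ Ico (0 : ℝ) 1) : starPath i s = starPath j t ↔ s = t ∧ (i = j ∨ s = 0) := by
  rw [starPath_of_mem hs, starPath_of_mem ht, Quotient.eq]
  constructor
  · rintro (h | ⟨h, h'⟩)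
    · have h₁ := congrArg Prod.fst h
      have h₂ := congrArg (fun x => (x.2 : ℝ)) h
      exact ⟨h₂, Or.inl h₁⟩
    · have h : s = 0 := h
      have h' : t = 0 := h'
      exact ⟨h.trans h'.symm, Or.inr h⟩
  · rintro ⟨rfl, rfl | rfl⟩
    · exact Or.inl rfl
    · exact Or.inr ⟨rfl, rfl⟩

theorem zero_mem_Ico : (0 : ℝ) ∈ Ico (0 : ℝ) 1 := ⟨le_rfl, one_pos⟩

theorem starPath_zero (i j : Fin n) : starPath i 0 = starPath j 0 :=
  (starPath_eq_iff zero_mem_Ico zero_mem_Ico).2 ⟨rfl, Or.inr rfl⟩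

theorem starProng_eq (i : Fin n) : starProng n i = starPath i '' Ioo 0 1 := by
  ext q
  constructor
  · rintro ⟨t, ht, rfl⟩
    exact ⟨t, ⟨ht, t.2.2⟩, starPath_of_mem t.2 i⟩
  · rintro ⟨t, ht, rfl⟩
    exact ⟨⟨t, ht.1.le, ht.2⟩, ht.1, starPath_of_mem _ i⟩

theorem mem_starCenter_iff {q : Star n} (i : Fin n) : q ∈ starCenter n ↔ q = starPath i 0 := by
  constructor
  · rintro ⟨j, t, ht, rfl⟩
    rw [starPath_zero i j, starPath_of_mem zero_mem_Ico]
    congr 2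
    exact Subtype.ext ht
  · rintro rfl
    exact ⟨i, ⟨0, zero_mem_Ico⟩, rfl, starPath_of_mem _ i⟩

/-- Continuous maps out of a star, prong by prong. -/
theorem exists_starLift {Y : Type u} [TopologicalSpace Y] {g : Fin n → ℝ → Y}
    (hc : ∀ i, ContinuousOn (g i) (Ico 0 1)) (h0 : ∀ i j, g i 0 = g j 0) :
    ∃ Φ : Star n → Y, Continuous Φ ∧ ∀ i, ∀ t ∈ Ico (0 : ℝ) 1, Φ (starPath i t) = g i t := by
  have hr : ∀ x y : Fin n × Ico (0 : ℝ) 1, starSetoid n x y → g x.1 x.2 = g y.1 y.2 := by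
    rintro ⟨i, s⟩ ⟨j, t⟩ (h | ⟨h, h'⟩)
    · rw [h]
    · have h : (s : ℝ) = 0 := h
      have h' : (t : ℝ) = 0 := h'
      change g i s = g j t
      rw [h, h', h0 i j]
  refine ⟨Quotient.lift (fun x : Fin n × Ico (0 : ℝ) 1 => g x.1 x.2) hr, ?_, ?_⟩
  · refine Continuous.quotient_lift ?_ hr
    rw [continuous_prod_of_discrete_left]
    exact fun i => continuousOn_iff_continuous_domRestrict.1 (hc i)
  · intro i t ht
    rw [starPath_of_mem ht]
    rfl

theorem isOpen_starPath_image (i : Fin n) {T : Set ℝ} (hT : IsOpen T) (hT' : T ⊆ Ioo 0 1) :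
    IsOpen (starPath i '' T) := by
  have hq : IsQuotientMap (Quotient.mk (starSetoid n)) := isQuotientMap_quotient_mk'
  rw [← hq.isOpen_preimage]
  have : Quotient.mk (starSetoid n) ⁻¹' (starPath i '' T) =
      ({i} : Set (Fin n)) ×ˢ ((fun t : Ico (0 : ℝ) 1 => (t : ℝ)) ⁻¹' T) := by
    ext ⟨j, t⟩
    constructor
    · rintro ⟨s, hs, he⟩
      rw [← starPath_of_mem t.2,
        starPath_eq_iff (Ioo_subset_Ico_self (hT' hs)) t.2] at he
      obtain ⟨rfl, rfl | h⟩ := he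
      · exact ⟨rfl, hs⟩
      · exact absurd h (hT' hs).1.ne'
    · rintro ⟨rfl, ht⟩
      exact ⟨t, ht, starPath_of_mem t.2 _⟩
  rw [this]
  exact (isOpen_discrete _).prod (hT.preimage continuous_subtype_val)

theorem starPath_image_mem_nhds (i : Fin n) {t : ℝ} (ht : t ∈ Ioo (0 : ℝ) 1) {T : Set ℝ}
    (hT : T ∈ 𝓝 t) : starPath i '' T ∈ 𝓝 (starPath i t) := by
  obtain ⟨T', hT', ho, hm⟩ := mem_nhds_iff.1 (inter_mem hT (Ioo_mem_nhds ht.1 ht.2))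
  exact mem_of_superset ((isOpen_starPath_image i ho fun s hs => (hT' hs).2).mem_nhds
    (mem_image_of_mem _ hm)) (image_mono fun s hs => (hT' hs).1)

theorem subset_prong {S : Set (Star n)} (hS : IsPreconnected S) (i : Fin n)
    (hne : (S ∩ starPath i '' Ioo 0 1).Nonempty) (hc : starPath i 0 ∉ S) :
    S ⊆ starPath i '' Ioo 0 1 := by
  refine hS.subset_left_of_subset_union (isOpen_starPath_image i isOpen_Ioo Subset.rfl)
    (v := ⋃ j ∈ {j | j ≠ i}, starPath j '' Ioo 0 1)
    (isOpen_biUnion fun j _ => isOpen_starPath_image j isOpen_Ioo Subset.rfl) ?_ ?_ hne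
  · refine disjoint_iUnion₂_right.2 fun j hj => ?_
    rw [Set.disjoint_left]
    rintro _ ⟨s, hs, rfl⟩ ⟨t, ht, he⟩
    rw [starPath_eq_iff (Ioo_subset_Ico_self ht) (Ioo_subset_Ico_self hs)] at he
    rcases he.2 with h | h
    · exact hj h
    · exact ht.1.ne' h
  · intro q hq
    obtain ⟨j, t, ht, rfl⟩ := exists_starPath q
    have ht0 : t ≠ 0 := by
      rintro rfl
      exact hc (starPath_zero i j ▸ hq)
    have ht' : t ∈ Ioo (0 : ℝ) 1 := ⟨lt_of_le_of_ne ht.1 (Ne.symm ht0), ht.2⟩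
    by_cases hji : j = i
    · subst hji
      exact Or.inl ⟨t, ht', rfl⟩
    · exact Or.inr (mem_biUnion (show j ∈ {j | j ≠ i} from hji) ⟨t, ht', rfl⟩)

/-- No neighborhood of the center of a star with more than two prongs embeds in a line. -/
theorem not_injective_near_center (hm : 2 < m) {g : Star m → ℝ} {ε : ℝ} (hε : 0 < ε)
    (hε1 : ε ≤ 1) (hc : ∀ i, ContinuousOn (fun t => g (starPath i t)) (Ico 0 ε))
    (hinj : InjOn g {q | ∃ i, ∃ t ∈ Ico (0 : ℝ) ε, q = starPath i t}) : False := by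
  let ι : Fin 3 → Fin m := Fin.castLE hm
  have hι : Function.Injective ι := Fin.castLE_injective hm
  have hI : ∀ t ∈ Ico (0 : ℝ) ε, t ∈ Ico (0 : ℝ) 1 := fun t ht => ⟨ht.1, ht.2.trans_le hε1⟩
  have h0 : (0 : ℝ) ∈ Ico (0 : ℝ) ε := ⟨le_rfl, hε⟩
  refine not_three_arcs (γ := fun i t => g (starPath (ι i) t)) (v := g (starPath (ι 0) 0)) hε
    (fun i => hc _) (fun i => by rw [starPath_zero (ι i) (ι 0)]) ?_ ?_
  · intro i t ht he
    have := hinj ⟨ι i, t, Ioo_subset_Ico_self ht, rfl⟩ ⟨ι 0, 0, h0, rfl⟩ he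
    rw [starPath_eq_iff (hI t (Ioo_subset_Ico_self ht)) zero_mem_Ico] at this
    exact ht.1.ne' this.1
  · intro i j hij s hs t ht he
    have := hinj ⟨ι i, s, Ioo_subset_Ico_self hs, rfl⟩ ⟨ι j, t, Ioo_subset_Ico_self ht, rfl⟩ he
    rw [starPath_eq_iff (hI s (Ioo_subset_Ico_self hs)) (hI t (Ioo_subset_Ico_self ht))] at this
    rcases this.2 with h | h
    · exact hij (hι h)
    · exact hs.1.ne' h

theorem not_injOn_of_isStarSet {Y : Type u} [TopologicalSpace Y] {U : Set Y} (hm : 2 < m)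
    (hU : IsStarSet m U) {g : Y → ℝ} (hg : ContinuousOn g U) : ¬ InjOn g U := by
  obtain ⟨-, ⟨h⟩⟩ := hU
  intro hinj
  have hg' := continuousOn_iff_continuous_domRestrict.1 hg
  refine not_injective_near_center hm (g := fun q => g (h q)) one_pos le_rfl
    (fun i => (hg'.comp h.continuous).comp_continuousOn (continuousOn_starPath i)) ?_
  intro x _ y _ hxy
  exact h.injective (Subtype.ext (hinj (h x).2 (h y).2 hxy))

/-- The radial coordinate, with a sign that singles out the `i`-th prong. -/
theorem exists_signedRadius (i : Fin n) : ∃ ρ : Star n → ℝ, Continuous ρ ∧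
    (∀ t ∈ Ico (0 : ℝ) 1, ρ (starPath i t) = t) ∧
    ∀ j, j ≠ i → ∀ t ∈ Ico (0 : ℝ) 1, ρ (starPath j t) = -t := by
  classical
  obtain ⟨ρ, hρ, hρ'⟩ := exists_starLift (g := fun (j : Fin n) t => if j = i then t else -t)
    (fun j => by split_ifs <;> fun_prop) (fun j k => by simp)
  exact ⟨ρ, hρ, fun t ht => by simpa using hρ' i t ht,
    fun j hj t ht => by simpa [hj] using hρ' j t ht⟩

/-- A homeomorphism of stars with more than two prongs preserves the center and the prongs. -/
theorem homeomorph_starPath (hm : 2 < m) (φ : Star n ≃ₜ Star m) :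
    (∀ i i', φ (starPath i 0) = starPath i' 0) ∧
    ∀ i, ∃ i', φ '' (starPath i '' Ioo 0 1) = starPath i' '' Ioo 0 1 := by
  have key : ∀ i i', φ (starPath i 0) = starPath i' 0 := by
    intro i i'
    obtain ⟨b, t, ht, hbt⟩ := exists_starPath (φ.symm (starPath i' 0))
    by_cases ht0 : t = 0
    · subst ht0
      rw [starPath_zero i b, ← hbt, φ.apply_symm_apply]
    exfalso
    -- If the center of the star with `m` prongs came from inside a prong, a neighborhood of it
    -- would embed in that prong, hence in the line.
    have htI : t ∈ Ioo (0 : ℝ) 1 := ⟨lt_of_le_of_ne ht.1 (Ne.symm ht0), ht.2⟩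
    have hcont : ∀ j, ContinuousOn (fun s => φ.symm (starPath j s)) (Ico 0 1) := fun j =>
      φ.symm.continuous.comp_continuousOn (continuousOn_starPath j)
    have hnear : ∀ j, ∀ᶠ s in 𝓝[Ico 0 1] (0 : ℝ),
        φ.symm (starPath j s) ∈ starPath b '' Ioo 0 1 := by
      intro j
      refine hcont j 0 zero_mem_Ico ?_
      beta_reduce
      rw [starPath_zero j i', hbt]
      exact (isOpen_starPath_image b isOpen_Ioo Subset.rfl).mem_nhds ⟨t, htI, rfl⟩
    have hall : ∀ᶠ s in 𝓝[Ico 0 1] (0 : ℝ), ∀ j,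
        φ.symm (starPath j s) ∈ starPath b '' Ioo 0 1 := eventually_all.2 hnear
    obtain ⟨δ, hδ, hδS⟩ := Metric.mem_nhdsWithin_iff.1 hall
    have hS : ∀ s ∈ Ico (0 : ℝ) (min δ 1), ∀ j,
        φ.symm (starPath j s) ∈ starPath b '' Ioo 0 1 := fun s hs =>
      hδS ⟨by rw [Metric.mem_ball, dist_zero_right, Real.norm_of_nonneg hs.1]
              exact hs.2.trans_le (min_le_left _ _), hs.1, hs.2.trans_le (min_le_right _ _)⟩
    obtain ⟨ρ, hρ, hρ₁, -⟩ := exists_signedRadius b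
    refine not_injective_near_center hm (g := fun q => ρ (φ.symm q)) (lt_min hδ one_pos)
      (min_le_right _ _) (fun j => hρ.comp_continuousOn
        ((hcont j).mono (Ico_subset_Ico_right (min_le_right _ _)))) ?_
    rintro _ ⟨j, s, hs, rfl⟩ _ ⟨k, u, hu, rfl⟩ he
    obtain ⟨s', hs', hse⟩ := hS s hs j
    obtain ⟨u', hu', hue⟩ := hS u hu k
    have he : ρ (φ.symm (starPath j s)) = ρ (φ.symm (starPath k u)) := he
    rw [← hse, ← hue, hρ₁ _ (Ioo_subset_Ico_self hs'), hρ₁ _ (Ioo_subset_Ico_self hu')] at he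
    rw [he, hue] at hse
    exact (φ.symm.injective hse).symm
  refine ⟨key, fun i => ?_⟩
  have hpre : ∀ {k : ℕ} (j : Fin k), IsPreconnected (starPath j '' Ioo 0 1) := fun j =>
    isPreconnected_Ioo.image _ ((continuousOn_starPath j).mono Ioo_subset_Ico_self)
  have hh : (1 / 2 : ℝ) ∈ Ioo (0 : ℝ) 1 := by norm_num
  obtain ⟨i', t, ht, hit⟩ := exists_starPath (φ (starPath i (1 / 2)))
  have ht0 : t ≠ 0 := by
    rintro rfl
    rw [← key i i'] at hit
    have := φ.injective hit
    rw [starPath_eq_iff (Ioo_subset_Ico_self hh) zero_mem_Ico] at this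
    norm_num at this
  have htI : t ∈ Ioo (0 : ℝ) 1 := ⟨lt_of_le_of_ne ht.1 (Ne.symm ht0), ht.2⟩
  have hncenter : ∀ {k : ℕ} (j j' : Fin k), starPath j' 0 ∉ starPath j '' Ioo 0 1 := by
    rintro k j j' ⟨s, hs, he⟩
    rw [starPath_eq_iff (Ioo_subset_Ico_self hs) zero_mem_Ico] at he
    exact hs.1.ne' he.1
  refine ⟨i', Subset.antisymm ?_ ?_⟩
  · refine subset_prong ((hpre i).image _ φ.continuous.continuousOn) i'
      ⟨_, ⟨_, ⟨_, hh, rfl⟩, rfl⟩, t, htI, hit.symm⟩ ?_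
    rintro ⟨q, hq, he⟩
    rw [← key i i'] at he
    exact hncenter i i (φ.injective he ▸ hq)
  · have : φ.symm '' (starPath i' '' Ioo 0 1) ⊆ starPath i '' Ioo 0 1 := by
      refine subset_prong ((hpre i').image _ φ.symm.continuous.continuousOn) i
        ⟨starPath i (1 / 2), ⟨_, ⟨t, htI, rfl⟩, ?_⟩, _, hh, rfl⟩ ?_
      · rw [← hit, φ.symm_apply_apply]
      · rintro ⟨q, hq, he⟩
        rw [φ.symm_apply_eq, key i i'] at he
        exact hncenter i' i' (he ▸ hq)
    intro q hq
    exact ⟨φ.symm q, this (mem_image_of_mem _ hq), φ.apply_symm_apply q⟩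

end Star

/-! ## Arcs of star sets -/

section StarArc

variable {Y : Type u} [TopologicalSpace Y] {V : Set Y} {m : ℕ} (h : Star m ≃ₜ V)

/-- The `i`-th closed prong of a star set. -/
noncomputable def starArc (i : Fin m) (t : ℝ) : Y := h (starPath i t)

theorem starArc_mem (i : Fin m) (t : ℝ) : starArc h i t ∈ V := (h _).2

theorem continuousOn_starArc (i : Fin m) : ContinuousOn (starArc h i) (Ico 0 1) :=
  (continuous_subtype_val.comp h.continuous).comp_continuousOn (continuousOn_starPath i)

theorem starArc_eq_iff {i j : Fin m} {s t : ℝ} (hs : s ∈ Ico (0 : ℝ) 1)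
    (ht : t ∈ Ico (0 : ℝ) 1) : starArc h i s = starArc h j t ↔ s = t ∧ (i = j ∨ s = 0) := by
  rw [starArc, starArc, Subtype.val_inj, h.injective.eq_iff, starPath_eq_iff hs ht]

theorem starArc_zero (i j : Fin m) : starArc h i 0 = starArc h j 0 :=
  (starArc_eq_iff h zero_mem_Ico zero_mem_Ico).2 ⟨rfl, Or.inr rfl⟩

theorem exists_starArc {x : Y} (hx : x ∈ V) : ∃ i, ∃ t ∈ Ico (0 : ℝ) 1, x = starArc h i t := by
  obtain ⟨i, t, ht, he⟩ := exists_starPath (h.symm ⟨x, hx⟩)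
  refine ⟨i, t, ht, ?_⟩
  rw [starArc, ← he, h.apply_symm_apply]

theorem starArc_injOn (i : Fin m) : InjOn (starArc h i) (Ioo 0 1) := fun _ hs _ ht he =>
  ((starArc_eq_iff h (Ioo_subset_Ico_self hs) (Ioo_subset_Ico_self ht)).1 he).1

theorem starArc_image_mem_nhds (hV : IsOpen V) (i : Fin m) {t : ℝ} (ht : t ∈ Ioo (0 : ℝ) 1)
    {T : Set ℝ} (hT : T ∈ 𝓝 t) : starArc h i '' T ∈ 𝓝 (starArc h i t) := by
  have h₁ := starPath_image_mem_nhds i ht hT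
  have h₂ : h '' (starPath i '' T) ∈ 𝓝 (h (starPath i t)) := h.isOpenMap.image_mem_nhds h₁
  have h₃ := hV.isOpenMap_subtype_val.image_mem_nhds h₂
  rwa [image_image, image_image] at h₃

theorem tendsto_starArc (i : Fin m) : Tendsto (starArc h i) (𝓝[>] 0) (𝓝 (starArc h i 0)) := by
  have h0 : Tendsto (starArc h i) (𝓝[Ico 0 1] 0) (𝓝 (starArc h i 0)) :=
    continuousOn_starArc h i 0 zero_mem_Ico
  refine h0.mono_left ?_
  rw [← nhdsWithin_Ioo_eq_nhdsGT one_pos]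
  exact nhdsWithin_mono _ Ioo_subset_Ico_self

theorem starArc_mem_dir (i : Fin m) : map (starArc h i) (𝓝[>] 0) ∈ Dir (starArc h i 0) := by
  refine mem_dir one_pos ((continuousOn_starArc h i).mono Ioo_subset_Ico_self)
    (tendsto_starArc h i) ?_
  filter_upwards [Ioo_mem_nhdsGT one_pos] with t ht he
  rw [starArc_eq_iff h (Ioo_subset_Ico_self ht) zero_mem_Ico] at he
  exact ht.1.ne' he.1

theorem starArc_map_inj {i j : Fin m}
    (he : map (starArc h i) (𝓝[>] 0) = map (starArc h j) (𝓝[>] 0)) : i = j := by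
  have m₁ : starArc h i '' Ioo 0 1 ∈ map (starArc h i) (𝓝[>] 0) :=
    image_mem_map (Ioo_mem_nhdsGT one_pos)
  have m₂ : starArc h j '' Ioo 0 1 ∈ map (starArc h i) (𝓝[>] 0) :=
    he ▸ image_mem_map (Ioo_mem_nhdsGT one_pos)
  obtain ⟨_, ⟨s, hs, rfl⟩, t, ht, hst⟩ :=
    (inferInstance : (map (starArc h i) (𝓝[>] 0)).NeBot).nonempty_of_mem (inter_mem m₁ m₂)
  rw [starArc_eq_iff h (Ioo_subset_Ico_self ht) (Ioo_subset_Ico_self hs)] at hst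
  exact (hst.2.resolve_right ht.1.ne').symm

/-- Every direction at the center of an open star set of a metric graph is that of a prong. -/
theorem exists_starArc_dir {G : Type u} [MetricSpace G] (hG : IsMetricGraph G) {V : Set G} {m : ℕ}
    (h : Star m ≃ₜ V) (hV : IsOpen V) (i₀ : Fin m) {F : Filter G}
    (hF : F ∈ Dir (starArc h i₀ 0)) : ∃ i, F = map (starArc h i) (𝓝[>] 0) := by
  by_contra! hcon
  have hdis : ∀ i, Disjoint F (map (starArc h i) (𝓝[>] 0)) := fun i =>
    (hG.eq_or_disjoint hF (starArc_zero h i i₀ ▸ starArc_mem_dir h i)).resolve_left (hcon i)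
  have hex : ∀ i, ∃ T ∈ F, ∀ᶠ t in 𝓝[>] (0 : ℝ), starArc h i t ∉ T := fun i => by
    obtain ⟨T, hT, T', hT', hTT⟩ := Filter.disjoint_iff.1 (hdis i)
    refine ⟨T, hT, ?_⟩
    filter_upwards [mem_map.1 hT'] with t ht ht'
    exact Set.disjoint_left.1 hTT ht' ht
  choose T hT hT' using hex
  obtain ⟨δ, hδ, hδS⟩ := mem_nhdsGT_iff_exists_Ioo_subset.1 (eventually_all.2 hT')
  have hδ : 0 < δ := hδ
  obtain ⟨ρ, hρ, hρ'⟩ := exists_starLift (n := m) (g := fun _ t => t)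
    (fun _ => continuousOn_id) (fun _ _ => rfl)
  -- The points of radial coordinate less than `δ` form a neighborhood of the center, so `F`
  -- contains a noncentral one that also lies in all the sets `T i`, which the prongs avoid up to
  -- `δ`.
  have hW : IsOpen (Subtype.val '' ((fun x : V => ρ (h.symm x)) ⁻¹' Iio δ)) :=
    hV.isOpenMap_subtype_val _ (isOpen_Iio.preimage (hρ.comp h.symm.continuous))
  have hmemW : starArc h i₀ 0 ∈ Subtype.val '' ((fun x : V => ρ (h.symm x)) ⁻¹' Iio δ) := by
    refine ⟨h (starPath i₀ 0), ?_, rfl⟩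
    rw [mem_preimage, h.symm_apply_apply, hρ' _ _ zero_mem_Ico]
    exact hδ
  have hWF := Dir.le_nhds hF (hW.mem_nhds hmemW)
  have hneF : {starArc h i₀ 0}ᶜ ∈ F := Dir.le hF self_mem_nhdsWithin
  have := Dir.neBot hF
  obtain ⟨x, ⟨⟨y, hy, rfl⟩, hyT⟩, hyne⟩ := this.nonempty_of_mem
    (inter_mem (inter_mem hWF (iInter_mem.2 hT)) hneF)
  obtain ⟨i, t, ht, hyt⟩ := exists_starPath (h.symm y)
  have hyt' : (y : G) = starArc h i t := by rw [starArc, ← hyt, h.apply_symm_apply]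
  rw [mem_preimage, hyt, hρ' _ _ ht] at hy
  have ht0 : t ≠ 0 := by
    rintro rfl
    exact hyne (hyt'.trans (starArc_zero h i i₀))
  exact hδS ⟨lt_of_le_of_ne ht.1 (Ne.symm ht0), hy⟩ i (hyt' ▸ mem_iInter.1 hyT i)

end StarArc

end SplitSeq

namespace SplitSeq

theorem mem_nhds_of_forall_dir {G : Type u} [MetricSpace G] (hG : IsMetricGraph G) {w : G}
    {U : Set G} (hw : w ∈ U) (hU : ∀ F ∈ Dir w, U ∈ F) : U ∈ 𝓝 w := by
  have h₁ : U ∈ 𝓝[≠] w := hG.nhdsNE_le w (mem_sSup.2 hU)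
  rw [mem_nhdsWithin_iff_eventually] at h₁
  filter_upwards [h₁] with y hy
  by_cases hyw : y = w
  · exact hyw ▸ hw
  · exact hy hyw

theorem continuousOn_Ico_of_tendsto {Y : Type u} [TopologicalSpace Y] {σ : ℝ → Y}
    (hc : ContinuousOn σ (Ioo 0 1)) (h0 : Tendsto σ (𝓝[>] 0) (𝓝 (σ 0))) :
    ContinuousOn σ (Ico 0 1) := by
  intro t ht
  rcases ht.1.eq_or_lt with rfl | ht0
  · rw [← Ioo_insert_left one_pos]
    refine continuousWithinAt_insert_self.2 ?_
    rw [ContinuousWithinAt, nhdsWithin_Ioo_eq_nhdsGT one_pos]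
    exact h0
  · exact (hc.continuousAt (Ioo_mem_nhds ht0 ht.2)).continuousWithinAt

/-! ## Preimages of open star sets -/

/-- `f` is a local homeomorphism over the open prongs of the open star set `V`. -/
structure IsStarCover {Y : Type u} {Z : Type v} [MetricSpace Y] [MetricSpace Z] (f : Y → Z)
    {V : Set Z} {m : ℕ} (h : Star m ≃ₜ V) : Prop where
  target : IsMetricGraph Z
  isOpen : IsOpen V
  arc : ∀ i, IsArcCover f (starArc h i)
  isolated : ∀ y, ∀ᶠ y' in 𝓝[≠] y, f y' ≠ f y

namespace IsStarCover

variable {Y : Type u} {Z : Type v} [MetricSpace Y] [MetricSpace Z] {f : Y → Z}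
  {V : Set Z} {m : ℕ} {h : Star m ≃ₜ V}

/-- The part of the preimage of a star set that retracts to the point `w` over the center. -/
def piece (f : Y → Z) (h : Star m ≃ₜ V) (w : Y) : Set Y :=
  {y | y = w ∨ ∃ i σ, IsLift f (starArc h i) σ ∧ map σ (𝓝[>] 0) ∈ Dir w ∧
    ∃ t ∈ Ioo (0 : ℝ) 1, y = σ t}

/-- At `w`, each direction maps to the direction of some prong of `V` and is therefore the germ of a
lift contained in the piece; elsewhere, the images of lifts are open. -/
theorem isOpen_piece (hf : IsStarCover f h) {i₀ : Fin m} {w : Y} (hw : f w = starArc h i₀ 0) :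
    IsOpen (piece f h w) := by
  have hY := (hf.arc i₀).graph
  rw [isOpen_iff_mem_nhds]
  rintro y (rfl | ⟨i, σ, hσ, hdir, t, ht, rfl⟩)
  · refine mem_nhds_of_forall_dir hY (Or.inl rfl) fun F hF => ?_
    have h₁ : map f F ∈ Dir (starArc h i₀ 0) := hw ▸ Dir.map (hf.arc i₀).cont (hf.isolated y) hF
    obtain ⟨i, hi⟩ := exists_starArc_dir hf.target h hf.isOpen i₀ h₁
    obtain ⟨σ, hσ, rfl⟩ := (hf.arc i).exists_lift_of_dir hF hi
    refine mem_of_superset (image_mem_map (Ioo_mem_nhdsGT one_pos)) ?_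
    rintro _ ⟨t, ht, rfl⟩
    exact Or.inr ⟨i, σ, hσ, hF, t, ht, rfl⟩
  · refine mem_of_superset (((hf.arc i).isOpen_lift hσ).mem_nhds ⟨t, ht, rfl⟩) ?_
    rintro _ ⟨s, hs, rfl⟩
    exact Or.inr ⟨i, σ, hσ, hdir, s, hs, rfl⟩

theorem lift_ne_center {i i₀ : Fin m} {σ : ℝ → Y} (hσ : IsLift f (starArc h i) σ) {t : ℝ}
    (ht : t ∈ Ioo (0 : ℝ) 1) : f (σ t) ≠ starArc h i₀ 0 := by
  rw [hσ.lift t ht]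
  intro he
  rw [starArc_eq_iff h (Ioo_subset_Ico_self ht) zero_mem_Ico] at he
  exact ht.1.ne' he.1

theorem disjoint_piece (hf : IsStarCover f h) {i₀ : Fin m} {w w' : Y}
    (hw : f w = starArc h i₀ 0) (hw' : f w' = starArc h i₀ 0) (hne : w ≠ w') :
    Disjoint (piece f h w) (piece f h w') := by
  rw [Set.disjoint_left]
  rintro y (rfl | ⟨i, σ, hσ, hdir, t, ht, rfl⟩) (h₁ | ⟨i', σ', hσ', hdir', t', ht', h'⟩)
  · exact hne h₁
  · exact lift_ne_center hσ' ht' (h' ▸ hw)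
  · exact lift_ne_center hσ ht (h₁ ▸ hw')
  · have he : starArc h i t = starArc h i' t' := by
      rw [← hσ.lift t ht, ← hσ'.lift t' ht', h']
    rw [starArc_eq_iff h (Ioo_subset_Ico_self ht) (Ioo_subset_Ico_self ht')] at he
    obtain ⟨rfl, rfl | h0⟩ := he
    · have := (hf.arc i).lift_unique hσ hσ' ht h'
      have hmap : map σ (𝓝[>] 0) = map σ' (𝓝[>] 0) := map_congr <| by
        filter_upwards [Ioo_mem_nhdsGT one_pos] with s hs using this hs
      exact hne (Dir.eq_of_mem hdir (hmap ▸ hdir'))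
    · exact ht.1.ne' h0

theorem exists_mem_piece (hf : IsStarCover f h) {i₀ : Fin m} {y : Y} (hy : f y ∈ V) :
    ∃ w, f w = starArc h i₀ 0 ∧ y ∈ piece f h w := by
  obtain ⟨i, t, ht, hyt⟩ := exists_starArc h hy
  rcases ht.1.eq_or_lt with rfl | ht0
  · exact ⟨y, hyt.trans (starArc_zero h i i₀), Or.inl rfl⟩
  · obtain ⟨σ, hσ, hσt⟩ := (hf.arc i).exists_lift ⟨ht0, ht.2⟩ hyt
    obtain ⟨w, hw, hdir⟩ := (hf.arc i).exists_center hf.target hf.isolated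
      (starArc_zero h i i₀ ▸ starArc_mem_dir h i) hσ
    exact ⟨w, hw, Or.inr ⟨i, σ, hσ, hdir, t, ⟨ht0, ht.2⟩, hσt.symm⟩⟩

/-- The pieces around the points over the center partition the preimage of `V` into open sets. This
is the reason that a plaque has only one center. -/
theorem eq_of_isPreconnected (hf : IsStarCover f h) {i₀ : Fin m} {w w' : Y}
    (hw : f w = starArc h i₀ 0) (hw' : f w' = starArc h i₀ 0) {S : Set Y}
    (hS : IsPreconnected S) (hSV : ∀ y ∈ S, f y ∈ V) (hwS : w ∈ S) (hwS' : w' ∈ S) : w = w' := by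
  have hsub : S ⊆ piece f h w := by
    refine hS.subset_left_of_subset_union (hf.isOpen_piece hw)
      (v := ⋃ z ∈ {z | f z = starArc h i₀ 0 ∧ w ≠ z}, piece f h z)
      (isOpen_biUnion fun z hz => hf.isOpen_piece hz.1) ?_ ?_ ⟨w, hwS, Or.inl rfl⟩
    · exact disjoint_iUnion₂_right.2 fun z hz => hf.disjoint_piece hw hz.1 hz.2
    · intro y hy
      obtain ⟨z, hz, hyz⟩ := hf.exists_mem_piece (i₀ := i₀) (hSV y hy)
      by_cases hwz : w = z
      · exact Or.inl (hwz ▸ hyz)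
      · exact Or.inr (mem_biUnion (show z ∈ {z | f z = starArc h i₀ 0 ∧ w ≠ z} from
          ⟨hz, hwz⟩) hyz)
  by_contra hne
  exact Set.disjoint_left.1 (hf.disjoint_piece hw hw' hne) (hsub hwS') (Or.inl rfl)

end IsStarCover

end SplitSeq

namespace SplitSequence

open SplitSeq

variable {n : ℕ} (ζ : SplitSequence.{u} n)

/-! ## Maps between the levels -/

theorem graph (k : ℕ) : IsMetricGraph (ζ.G k) := (ζ.core k).toIsMetricGraph

theorem map_self (k : ℕ) (x : ζ.G k) : ζ.map le_rfl x = x := by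
  rw [map, transit_self]; rfl

theorem map_succ {j k : ℕ} (h : j ≤ k) (x : ζ.G (k + 1)) :
    ζ.map (Nat.le_succ_of_le h) x = ζ.map h (ζ.f k x) := by
  rw [map, transit_succ]; rfl

theorem map_map {j k l : ℕ} (h : j ≤ k) (h' : k ≤ l) (x : ζ.G l) :
    ζ.map h (ζ.map h' x) = ζ.map (h.trans h') x := by
  induction l, h' using Nat.le_induction with
  | base => rw [map_self]
  | succ l h' ih => rw [ζ.map_succ h', ih, ← ζ.map_succ (h.trans h')]

theorem map_proj {j k : ℕ} (h : j ≤ k) (x : ζ.Solenoid) : ζ.map h (x.1 k) = x.1 j := by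
  induction k, h using Nat.le_induction with
  | base => rw [map_self]
  | succ k h ih => rw [ζ.map_succ h, x.2, ih]

theorem map_one (k : ℕ) (x : ζ.G (k + 1)) : ζ.map (Nat.le_succ k) x = ζ.f k x := by
  rw [ζ.map_succ le_rfl, map_self]

theorem continuous_map {j k : ℕ} (h : j ≤ k) : Continuous (ζ.map h) := by
  induction k, h using Nat.le_induction with
  | base => exact continuous_id.congr fun x => (ζ.map_self j x).symm
  | succ k h ih => exact (ih.comp (ζ.fold k).continuous).congr fun x => (ζ.map_succ h x).symm

theorem finite_fiber {j k : ℕ} (h : j ≤ k) (q : ζ.G j) : (ζ.map h ⁻¹' {q}).Finite := by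
  induction k, h using Nat.le_induction with
  | base =>
    refine (Set.finite_singleton q).subset fun x hx => ?_
    rw [← ζ.map_self j x]; exact hx
  | succ k h ih =>
    refine (ih.biUnion fun y _ => (ζ.fold k).finite_fiber (ζ.graph (k + 1)) y).subset ?_
    intro x hx
    have hx : ζ.map (Nat.le_succ_of_le h) x = q := hx
    rw [ζ.map_succ h] at hx
    exact mem_biUnion (x := ζ.f k x) hx rfl

theorem isolated_map {j k : ℕ} (h : j ≤ k) (p : ζ.G k) :
    ∀ᶠ x in 𝓝[≠] p, ζ.map h x ≠ ζ.map h p := by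
  have hfin : (ζ.map h ⁻¹' {ζ.map h p} \ {p}).Finite :=
    (ζ.finite_fiber h (ζ.map h p)).subset sdiff_subset
  have := hfin.isClosed.isOpen_compl.mem_nhds
    (show p ∈ (ζ.map h ⁻¹' {ζ.map h p} \ {p})ᶜ from fun h => h.2 rfl)
  filter_upwards [mem_nhdsWithin_of_mem_nhds this, self_mem_nhdsWithin] with x hx hxp heq
  exact hx ⟨heq, hxp⟩

theorem dir_map {j k : ℕ} (h : j ≤ k) {p : ζ.G k} {F : Filter (ζ.G k)} (hF : F ∈ Dir p) :
    Filter.map (ζ.map h) F ∈ Dir (ζ.map h p) :=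
  Dir.map (ζ.continuous_map h) (ζ.isolated_map h p) hF

theorem exists_injOn_map {j k : ℕ} (h : j ≤ k) {x : ζ.G k} (hx : ¬ IsNaturalVertex x) :
    ∃ U ∈ 𝓝 x, InjOn (ζ.map h) U := by
  obtain ⟨U, hU, hinj⟩ := ζ.no_backtracking k x hx
  have hnn : ∀ᶠ y in 𝓝 x, ¬ IsNaturalVertex y := by
    have := (ζ.graph k).eventually_not_isNaturalVertex x
    rw [eventually_nhdsWithin_iff] at this
    filter_upwards [this] with y hy
    by_cases hyx : y = x
    · exact hyx ▸ hx
    · exact hy hyx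
  refine ⟨_, inter_mem hU hnn, fun y hy z hz hyz => hinj hy hz ?_⟩
  have key : ∀ y : ζ.G k, transit ζ.f (Nat.zero_le k) y = ζ.map (Nat.zero_le j) (ζ.map h y) :=
    fun y => (ζ.map_map (Nat.zero_le j) h y).symm
  rw [key, key, hyz]

/-- Absence of backtracking makes the map injective near `x`, so it carries disjoint sets in two
directions to disjoint sets. -/
theorem dir_map_injOn {j k : ℕ} (h : j ≤ k) {x : ζ.G k} (hx : ¬ IsNaturalVertex x) :
    InjOn (Filter.map (ζ.map h)) (Dir x) := by
  obtain ⟨U, hU, hinj⟩ := ζ.exists_injOn_map h hx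
  intro E hE F hF hEF
  refine ((ζ.graph k).eq_or_disjoint hE hF).resolve_right fun hdis => ?_
  obtain ⟨S, hS, T, hT, hST⟩ := Filter.disjoint_iff.1 hdis
  have m₁ : ζ.map h '' (S ∩ U) ∈ Filter.map (ζ.map h) E :=
    image_mem_map (inter_mem hS (Dir.le_nhds hE hU))
  have m₂ : ζ.map h '' (T ∩ U) ∈ Filter.map (ζ.map h) E :=
    hEF ▸ image_mem_map (inter_mem hT (Dir.le_nhds hF hU))
  have := Dir.neBot hE
  obtain ⟨_, ⟨y, hy, rfl⟩, z, hz, hyz⟩ :=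
    (inferInstance : (Filter.map (ζ.map h) E).NeBot).nonempty_of_mem (inter_mem m₁ m₂)
  have := hinj hz.2 hy.2 hyz
  exact Set.disjoint_left.1 hST hy.1 (this ▸ hz.1)

theorem two_le_ncard_dir (k : ℕ) (x : ζ.G (k + 1)) : 2 ≤ (Dir x).ncard := by
  have := (ζ.fold k).nontrivial
  exact (ζ.core (k + 1)).two_le_ncard_dir x

/-- At least two directions at `x` inject into at most two at the image, so every direction there is
hit, and openness follows direction by direction. -/
theorem nhds_le_map {j k : ℕ} (h : j ≤ k) {x : ζ.G k} (hx : ¬ IsNaturalVertex x)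
    (hx' : ¬ IsNaturalVertex (ζ.map h x)) : 𝓝 (ζ.map h x) ≤ Filter.map (ζ.map h) (𝓝 x) := by
  rcases h.eq_or_lt with rfl | hlt
  · have : ζ.map h = id := funext (ζ.map_self j)
    rw [this, Filter.map_id]; rfl
  -- A successor level is the source of a fold, hence not a single point; this is what guarantees
  -- valence at least two.
  obtain ⟨k, rfl⟩ : ∃ l, k = l + 1 := ⟨k - 1, by omega⟩
  intro S hS
  have hxS : x ∈ ζ.map h ⁻¹' S := mem_of_mem_nhds (mem_map.1 hS)
  refine mem_nhds_of_forall_dir (ζ.graph j) hxS fun F hF => ?_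
  have himg : Filter.map (ζ.map h) '' Dir x = Dir (ζ.map h x) := by
    refine Set.eq_of_subset_of_ncard_le ?_ ?_ ((ζ.graph j).finite_dir _)
    · rintro _ ⟨E, hE, rfl⟩
      exact ζ.dir_map h hE
    · rw [(ζ.dir_map_injOn h hx).ncard_image]
      rw [(ζ.graph j).isNaturalVertex_iff] at hx'
      have := ζ.two_le_ncard_dir k x
      omega
  rw [← himg] at hF
  obtain ⟨E, hE, rfl⟩ := hF
  exact mem_map.2 (Dir.le_nhds hE (mem_map.1 hS))

/-! ## Special points and standard neighborhoods -/

theorem isSpecial_of_isNaturalVertex {k j : ℕ} (h : k ≤ j) {y : ζ.G j} (hy : IsNaturalVertex y) :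
    ζ.IsSpecial (ζ.map h y) := by
  refine ⟨j, y, ?_, hy⟩
  unfold shadow
  split_ifs with h'
  · obtain rfl := le_antisymm h h'
    exact ⟨_, rfl, by rw [map_self, map_self]⟩
  · rfl

theorem isSpecial_of_isNaturalVertex_map {k j : ℕ} (h : j ≤ k) {y : ζ.G k}
    (hy : IsNaturalVertex (ζ.map h y)) : ζ.IsSpecial y := by
  refine ⟨j, _, ?_, hy⟩
  unfold shadow
  rw [dif_pos h]
  exact ⟨y, rfl, rfl⟩

/-- A parameterized standard star neighborhood of `G k` with center `p`. -/
structure IsStandardChart {k : ℕ} {V : Set (ζ.G k)} {m : ℕ} (h : Star m ≃ₜ V) (p : ζ.G k) :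
    Prop where
  one_lt : 1 < m
  isOpen : IsOpen V
  center : ∀ i, starArc h i 0 = p
  not_special : ∀ q ∈ V, q ≠ p → ¬ ζ.IsSpecial q

variable {ζ}

theorem exists_isStandardChart {k : ℕ} {V : Set (ζ.G k)} (hV : ζ.IsStandardStarNbhd V) :
    ∃ (m : ℕ) (h : Star m ≃ₜ V) (p : ζ.G k), ζ.IsStandardChart h p := by
  obtain ⟨hO, p, ⟨m, hm, h, c, hc, hcp⟩, hns⟩ := hV
  refine ⟨m, h, p, hm, hO, fun i => ?_, fun q hq hqp => hns q ⟨hq, hqp⟩⟩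
  rw [← hcp, starArc, (mem_starCenter_iff i).1 hc]

namespace IsStandardChart

variable {k : ℕ} {V : Set (ζ.G k)} {m : ℕ} {h : Star m ≃ₜ V} {p : ζ.G k}

theorem arc_ne (H : ζ.IsStandardChart h p) (i : Fin m) {t : ℝ} (ht : t ∈ Ioo (0 : ℝ) 1) :
    starArc h i t ≠ p := by
  rw [← H.center i]
  intro he
  rw [starArc_eq_iff h (Ioo_subset_Ico_self ht) zero_mem_Ico] at he
  exact ht.1.ne' he.1

theorem not_special_arc (H : ζ.IsStandardChart h p) (i : Fin m) {t : ℝ}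
    (ht : t ∈ Ioo (0 : ℝ) 1) : ¬ ζ.IsSpecial (starArc h i t) :=
  H.not_special _ (starArc_mem h i t) (H.arc_ne i ht)

theorem center_mem (H : ζ.IsStandardChart h p) : p ∈ V := by
  rw [← H.center ⟨0, one_pos.trans H.one_lt⟩]
  exact starArc_mem h _ _

/-- A natural vertex in or over an open prong would make a point of that prong special. So the map
satisfies the local injectivity and openness conditions there. -/
theorem isStarCover (H : ζ.IsStandardChart h p) {j : ℕ} (hkj : k ≤ j) :
    IsStarCover (ζ.map hkj) h where
  target := ζ.graph k
  isOpen := H.isOpen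
  isolated := ζ.isolated_map hkj
  arc i :=
    { graph := ζ.graph j
      cont := ζ.continuous_map hkj
      arc_cont := (continuousOn_starArc h i).mono Ioo_subset_Ico_self
      arc_inj := starArc_injOn h i
      arc_open := fun t ht T hT => starArc_image_mem_nhds h H.isOpen i ht hT
      loc_open := by
        rintro y ⟨t, ht, hty⟩
        have hns := H.not_special_arc i ht
        rw [hty] at hns
        refine ζ.nhds_le_map hkj (fun hn => hns (ζ.isSpecial_of_isNaturalVertex hkj hn))
          fun hn => hns (ζ.isSpecial_of_isNaturalVertex_map le_rfl (by rwa [map_self]))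
      loc_inj := by
        rintro y ⟨t, ht, hty⟩
        have hns := H.not_special_arc i ht
        rw [hty] at hns
        exact ζ.exists_injOn_map hkj fun hn => hns (ζ.isSpecial_of_isNaturalVertex hkj hn) }

end IsStandardChart

end SplitSequence

namespace SplitSequence

open SplitSeq

variable {n : ℕ} {ζ : SplitSequence.{u} n}

/-! ## Points and germs of the solenoid -/

theorem tendsto_solenoid_iff {α : Type*} {l : Filter α} {g : α → ζ.Solenoid} {x : ζ.Solenoid} :
    Tendsto g l (𝓝 x) ↔ ∀ j, Tendsto (fun a => (g a).1 j) l (𝓝 (x.1 j)) := by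
  rw [tendsto_subtype_rng, tendsto_pi_nhds]

theorem continuous_coord (j : ℕ) : Continuous fun x : ζ.Solenoid => x.1 j :=
  (continuous_apply j).comp continuous_subtype_val

theorem solenoid_ext {k : ℕ} {x y : ζ.Solenoid} (h : ∀ j, k ≤ j → x.1 j = y.1 j) : x = y := by
  refine Subtype.ext (funext fun j => ?_)
  rw [← ζ.map_proj (Nat.le_add_left j k) x, ← ζ.map_proj (Nat.le_add_left j k) y,
    h _ (Nat.le_add_right k j)]

theorem exists_solenoid_point {k : ℕ} (y : ∀ j, k ≤ j → ζ.G j)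
    (hy : ∀ j l (hj : k ≤ j) (hjl : j ≤ l), ζ.map hjl (y l (hj.trans hjl)) = y j hj) :
    ∃ x : ζ.Solenoid, ∀ j hj, x.1 j = y j hj := by
  -- The index `k + j` is at least both `k` and `j`, so one formula defines all coordinates,
  -- including those before `k`.
  refine ⟨⟨fun j => ζ.map (Nat.le_add_left j k) (y (k + j) (Nat.le_add_right k j)), fun j => ?_⟩,
    fun j hj => hy j _ hj _⟩
  beta_reduce
  rw [← ζ.map_one, ζ.map_map,
    ← hy (k + j) (k + (j + 1)) (Nat.le_add_right k j) (by omega), ζ.map_map]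

/-- The germs of prongs at a point of the solenoid, given by the directions at all levels. -/
def Germ (x : ζ.Solenoid) : Set (∀ j, Filter (ζ.G j)) :=
  {D | (∀ j, D j ∈ Dir (x.1 j)) ∧ ∀ j, Filter.map (ζ.f j) (D (j + 1)) = D j}

theorem Germ.map {x : ζ.Solenoid} {D : ∀ j, Filter (ζ.G j)} (hD : D ∈ Germ x) {j k : ℕ}
    (h : j ≤ k) : Filter.map (ζ.map h) (D k) = D j := by
  induction k, h using Nat.le_induction with
  | base =>
    have : ζ.map (le_refl j) = id := funext (ζ.map_self j)
    rw [this, Filter.map_id]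
  | succ k h ih =>
    rw [← ih, ← hD.2 k, Filter.map_map]
    exact congrFun (congrArg _ (funext (ζ.map_succ h))) _

theorem Germ.eq_of_le {x y : ζ.Solenoid} {D E : ∀ j, Filter (ζ.G j)} (hD : D ∈ Germ x)
    (hE : E ∈ Germ y) {j k : ℕ} (h : j ≤ k) (hk : D k = E k) : D j = E j := by
  rw [← Germ.map hD h, ← Germ.map hE h, hk]

theorem Germ.ext {x y : ζ.Solenoid} {D E : ∀ j, Filter (ζ.G j)} (hD : D ∈ Germ x)
    (hE : E ∈ Germ y) {k : ℕ} (h : ∀ j, k ≤ j → D j = E j) : D = E :=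
  funext fun j => Germ.eq_of_le hD hE (Nat.le_add_left j k) (h _ (Nat.le_add_right k j))

theorem exists_germ {k : ℕ} {x : ζ.Solenoid} (E : ∀ j, k ≤ j → Filter (ζ.G j))
    (hE : ∀ j hj, E j hj ∈ Dir (x.1 j))
    (hc : ∀ j l (hj : k ≤ j) (hjl : j ≤ l),
      Filter.map (ζ.map hjl) (E l (hj.trans hjl)) = E j hj) :
    ∃ D ∈ Germ x, ∀ j hj, D j = E j hj := by
  refine ⟨fun j => Filter.map (ζ.map (Nat.le_add_left j k)) (E (k + j) (Nat.le_add_right k j)),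
    ⟨fun j => ?_, fun j => ?_⟩, fun j hj => hc j _ hj _⟩
  · rw [← ζ.map_proj (Nat.le_add_left j k) x]
    exact ζ.dir_map _ (hE _ _)
  · beta_reduce
    rw [← hc (k + j) (k + (j + 1)) (Nat.le_add_right k j) (by omega), Filter.map_map,
      Filter.map_map]
    congr 1
    funext w
    simp only [Function.comp_apply]
    rw [← ζ.map_one, ζ.map_map, ζ.map_map]

theorem Germ.tendsto {x : ζ.Solenoid} {D : ∀ j, Filter (ζ.G j)} (hD : D ∈ Germ x)
    {σ : ℝ → ζ.Solenoid} (hσ : ∀ j, Filter.map (fun t => (σ t).1 j) (𝓝[>] 0) = D j) :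
    Tendsto σ (𝓝[>] 0) (𝓝 x) := by
  rw [tendsto_solenoid_iff]
  intro j
  have := Dir.le_nhds (hD.1 j)
  rw [← hσ j] at this
  exact this

/-- The germ of a path in the solenoid. -/
theorem germ_of_path {x : ζ.Solenoid} {σ : ℝ → ζ.Solenoid} {ε : ℝ} (hε : 0 < ε)
    (hc : ContinuousOn σ (Ioo 0 ε)) (ht : Tendsto σ (𝓝[>] 0) (𝓝 x)) {k : ℕ}
    (hne : ∀ᶠ t in 𝓝[>] (0 : ℝ), (σ t).1 k ≠ x.1 k) :
    (fun j => Filter.map (fun t => (σ t).1 j) (𝓝[>] 0)) ∈ Germ x := by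
  have key : ∀ j, k ≤ j → Filter.map (fun t => (σ t).1 j) (𝓝[>] 0) ∈ Dir (x.1 j) := by
    intro j hj
    refine mem_dir hε ((continuous_coord j).comp_continuousOn hc)
      (tendsto_solenoid_iff.1 ht j) ?_
    filter_upwards [hne] with t ht he
    exact ht (by rw [← ζ.map_proj hj, he, ζ.map_proj hj])
  have hcomp : ∀ j l (h : j ≤ l), Filter.map (ζ.map h)
      (Filter.map (fun t => (σ t).1 l) (𝓝[>] 0)) = Filter.map (fun t => (σ t).1 j) (𝓝[>] 0) := by
    intro j l h
    rw [Filter.map_map]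
    congr 1
    funext t
    exact ζ.map_proj h _
  refine ⟨fun j => ?_, fun j => ?_⟩
  · beta_reduce
    rw [← hcomp j (k + j) (Nat.le_add_left j k), ← ζ.map_proj (Nat.le_add_left j k) x]
    exact ζ.dir_map _ (key _ (Nat.le_add_right k j))
  · rw [Filter.map_map]
    congr 1
    funext t
    exact (σ t).2 j

/-! ## Prongs -/

/-- `σ` parameterizes a prong at `x`, with germ `D`, over the `i`-th prong of a standard star
neighborhood centered at the projection of `x`. -/
structure IsProng {k : ℕ} {V : Set (ζ.G k)} {m : ℕ} (h : Star m ≃ₜ V) (x : ζ.Solenoid)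
    (D : ∀ j, Filter (ζ.G j)) (i : Fin m) (σ : ℝ → ζ.Solenoid) : Prop where
  cont : ContinuousOn σ (Ico 0 1)
  zero : σ 0 = x
  proj : ∀ t ∈ Ico (0 : ℝ) 1, (σ t).1 k = starArc h i t
  germ : ∀ j, Filter.map (fun t => (σ t).1 j) (𝓝[>] 0) = D j

theorem IsProng.isLift {k : ℕ} {V : Set (ζ.G k)} {m : ℕ} {h : Star m ≃ₜ V} {x : ζ.Solenoid}
    {D : ∀ j, Filter (ζ.G j)} {i : Fin m} {σ : ℝ → ζ.Solenoid} (hσ : IsProng h x D i σ) {j : ℕ}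
    (hkj : k ≤ j) : IsLift (ζ.map hkj) (starArc h i) fun t => (σ t).1 j where
  cont := (continuous_coord j).comp_continuousOn (hσ.cont.mono Ioo_subset_Ico_self)
  lift t ht := by rw [ζ.map_proj]; exact hσ.proj t (Ioo_subset_Ico_self ht)

namespace IsStandardChart

variable {k : ℕ} {V : Set (ζ.G k)} {m : ℕ} {h : Star m ≃ₜ V} {p : ζ.G k}

/-- Two prongs with the same direction at level `j` agree down to level `j`. -/
theorem prong_coord_eq (H : ζ.IsStandardChart h p) {x y : ζ.Solenoid}
    {D E : ∀ j, Filter (ζ.G j)} {i i' : Fin m} {σ τ : ℝ → ζ.Solenoid} (hσ : IsProng h x D i σ)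
    (hτ : IsProng h y E i' τ) (hD : D ∈ Germ x) (hE : E ∈ Germ y) {j : ℕ} (hkj : k ≤ j)
    (hDE : D j = E j) : ∀ l ≤ j, ∀ t ∈ Ico (0 : ℝ) 1, (σ t).1 l = (τ t).1 l := by
  have hii : i = i' := by
    have h₁ := (hσ.isLift hkj).map_eq
    have h₂ := (hτ.isLift hkj).map_eq
    rw [hσ.germ j] at h₁
    rw [hτ.germ j, ← hDE, h₁] at h₂
    exact starArc_map_inj h h₂
  subst hii
  have hxy : x.1 j = y.1 j := Dir.eq_of_mem (hD.1 j) (hDE ▸ hE.1 j)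
  have heq := ((H.isStarCover hkj).arc i).lift_eq_of_dir (hσ.isLift hkj) (hτ.isLift hkj) (by
    rw [hσ.germ j, hτ.germ j, ← hDE, inf_idem]
    exact Dir.neBot (hD.1 j))
  intro l hl t ht
  rw [← ζ.map_proj hl (σ t), ← ζ.map_proj hl (τ t)]
  congr 1
  rcases ht.1.eq_or_lt with rfl | ht0
  · rw [hσ.zero, hτ.zero, hxy]
  · exact heq ⟨ht0, ht.2⟩

theorem prong_unique (H : ζ.IsStandardChart h p) {x : ζ.Solenoid}
    {D : ∀ j, Filter (ζ.G j)} {i i' : Fin m} {σ τ : ℝ → ζ.Solenoid} (hσ : IsProng h x D i σ)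
    (hτ : IsProng h x D i' τ) (hD : D ∈ Germ x) : EqOn σ τ (Ico 0 1) := fun t ht =>
  solenoid_ext fun j hj => H.prong_coord_eq hσ hτ hD hD hj rfl j le_rfl t ht

/-- The direction `D k` belongs to one prong of `V`, which lifts to each level `j ≥ k` with germ `D
j`. Uniqueness of lifts makes these compatible, so they assemble to a path in the solenoid. -/
theorem exists_prong (H : ζ.IsStandardChart h p) {x : ζ.Solenoid} (hx : x.1 k = p)
    {D : ∀ j, Filter (ζ.G j)} (hD : D ∈ Germ x) : ∃ i σ, IsProng h x D i σ := by
  have i₀ : Fin m := ⟨0, one_pos.trans H.one_lt⟩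
  have hDk : D k ∈ Dir (starArc h i₀ 0) := by rw [H.center, ← hx]; exact hD.1 k
  obtain ⟨i, hi⟩ := exists_starArc_dir (ζ.graph k) h H.isOpen i₀ hDk
  have hex : ∀ j (hj : k ≤ j), ∃ σ, IsLift (ζ.map hj) (starArc h i) σ ∧
      Filter.map σ (𝓝[>] 0) = D j := fun j hj =>
    ((H.isStarCover hj).arc i).exists_lift_of_dir (hD.1 j) ((Germ.map hD hj).trans hi)
  choose τ hτ hτD using hex
  have hcompat : ∀ j l (hj : k ≤ j) (hjl : j ≤ l), ∀ t ∈ Ioo (0 : ℝ) 1,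
      ζ.map hjl (τ l (hj.trans hjl) t) = τ j hj t := by
    intro j l hj hjl
    refine ((H.isStarCover hj).arc i).lift_eq_of_dir
      (σ := fun t => ζ.map hjl (τ l (hj.trans hjl) t)) ⟨?_, ?_⟩ (hτ j hj) ?_
    · exact (ζ.continuous_map hjl).comp_continuousOn (hτ l _).cont
    · intro t ht
      rw [ζ.map_map]
      exact (hτ l _).lift t ht
    · have : Filter.map (fun t => ζ.map hjl (τ l (hj.trans hjl) t)) (𝓝[>] 0) = D j := by
        rw [← Germ.map hD hjl, ← hτD l (hj.trans hjl), Filter.map_map]; rfl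
      rw [this, hτD, inf_idem]
      exact Dir.neBot (hD.1 j)
  have hpt : ∀ t : ℝ, ∃ y : ζ.Solenoid, (t ∈ Ioo (0 : ℝ) 1 → ∀ j hj, y.1 j = τ j hj t) ∧
      (t = 0 → y = x) := by
    intro t
    by_cases ht : t ∈ Ioo (0 : ℝ) 1
    · obtain ⟨y, hy⟩ := exists_solenoid_point (fun j hj => τ j hj t)
        fun j l hj hjl => hcompat j l hj hjl t ht
      exact ⟨y, fun _ => hy, fun h0 => absurd h0 ht.1.ne'⟩
    · exact ⟨x, fun h => absurd h ht, fun _ => rfl⟩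
  choose σ hσ hσ0 using hpt
  have hgerm : ∀ j, Filter.map (fun t => (σ t).1 j) (𝓝[>] 0) = D j := by
    have key : ∀ j, k ≤ j → Filter.map (fun t => (σ t).1 j) (𝓝[>] 0) = D j := by
      intro j hj
      rw [← hτD j hj]
      refine map_congr ?_
      filter_upwards [Ioo_mem_nhdsGT one_pos] with t ht using hσ t ht j hj
    intro j
    rw [← Germ.map hD (Nat.le_add_left j k), ← key _ (Nat.le_add_right k j), Filter.map_map]
    congr 1
    funext t
    exact (ζ.map_proj _ _).symm
  have hzero : σ 0 = x := hσ0 0 rfl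
  refine ⟨i, σ, continuousOn_Ico_of_tendsto ?_ ?_, hzero, ?_, hgerm⟩
  · intro t ht
    refine tendsto_solenoid_iff.2 fun j => ?_
    have h₁ : ContinuousOn (fun t => (σ t).1 j) (Ioo 0 1) := by
      refine ((ζ.continuous_map (Nat.le_add_left j k)).comp_continuousOn
        (hτ (k + j) (Nat.le_add_right k j)).cont).congr fun t ht => ?_
      simp only [Function.comp_apply]
      rw [← hσ t ht, ζ.map_proj]
    exact h₁ t ht
  · rw [hzero]
    exact Germ.tendsto hD hgerm
  · intro t ht
    rcases ht.1.eq_or_lt with rfl | ht0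
    · rw [hzero, hx, H.center]
    · rw [hσ t ⟨ht0, ht.2⟩ k le_rfl, ← (hτ k le_rfl).lift t ⟨ht0, ht.2⟩, map_self]

theorem joined_prong {x : ζ.Solenoid} {D : ∀ j, Filter (ζ.G j)} {i : Fin m}
    {σ : ℝ → ζ.Solenoid} (hσ : IsProng h x D i σ) {t : ℝ} (ht : t ∈ Ico (0 : ℝ) 1) :
    JoinedIn (ζ.proj k ⁻¹' V) x (σ t) := by
  have hpc : IsPathConnected (σ '' Ico 0 1) :=
    ((convex_Ico (0 : ℝ) 1).isPathConnected ⟨0, zero_mem_Ico⟩).image' hσ.cont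
  have hsub : σ '' Ico 0 1 ⊆ ζ.proj k ⁻¹' V := by
    rintro _ ⟨s, hs, rfl⟩
    have : (σ s).1 k ∈ V := hσ.proj s hs ▸ starArc_mem h i s
    exact this
  exact ((hpc.joinedIn _ ⟨0, zero_mem_Ico, hσ.zero⟩ _ ⟨t, ht, rfl⟩)).mono hsub

/-- Every point of a standard neighborhood is the center of its plaque or lies on a prong. -/
theorem exists_center (H : ζ.IsStandardChart h p) {y : ζ.Solenoid} (hy : y.1 k ∈ V) :
    ∃ z : ζ.Solenoid, z.1 k = p ∧ (y = z ∨ ∃ D ∈ Germ z, ∃ t ∈ Ioo (0 : ℝ) 1,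
      ∀ i σ, IsProng h z D i σ → σ t = y) := by
  obtain ⟨i, t, ht, hyt⟩ := exists_starArc h hy
  rcases ht.1.eq_or_lt with rfl | ht0
  · exact ⟨y, by rw [hyt, H.center], Or.inl rfl⟩
  have htI : t ∈ Ioo (0 : ℝ) 1 := ⟨ht0, ht.2⟩
  -- At each level the prong is lifted through the coordinate of `y` and followed back to its
  -- center; unique lifting makes both centers and germs compatible.
  have hex : ∀ j (hj : k ≤ j), ∃ σ z, IsLift (ζ.map hj) (starArc h i) σ ∧ σ t = y.1 j ∧
      ζ.map hj z = p ∧ Filter.map σ (𝓝[>] 0) ∈ Dir z := by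
    intro j hj
    have hA := (H.isStarCover hj).arc i
    obtain ⟨σ, hσ, hσt⟩ := hA.exists_lift htI ((ζ.map_proj hj y).trans hyt)
    obtain ⟨z, hz, hdir⟩ := hA.exists_center (ζ.graph k) (ζ.isolated_map hj)
      (starArc_mem_dir h i) hσ
    exact ⟨σ, z, hσ, hσt, by rw [hz, H.center], hdir⟩
  choose τ z hτ hτy hz hdir using hex
  have hcompat : ∀ j l (hj : k ≤ j) (hjl : j ≤ l), Filter.map (ζ.map hjl)
      (Filter.map (τ l (hj.trans hjl)) (𝓝[>] 0)) = Filter.map (τ j hj) (𝓝[>] 0) := by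
    intro j l hj hjl
    have heq := ((H.isStarCover hj).arc i).lift_unique
      (σ := fun t => ζ.map hjl (τ l (hj.trans hjl) t)) (σ' := τ j hj) ⟨?_, ?_⟩ (hτ j hj) htI
      (by simp only [hτy]; exact ζ.map_proj hjl y)
    · rw [Filter.map_map]
      refine map_congr ?_
      filter_upwards [Ioo_mem_nhdsGT one_pos] with s hs using heq hs
    · exact (ζ.continuous_map hjl).comp_continuousOn (hτ l _).cont
    · intro s hs
      rw [ζ.map_map]
      exact (hτ l _).lift s hs
  obtain ⟨w, hw⟩ := exists_solenoid_point z fun j l hj hjl =>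
    Dir.eq_of_mem (ζ.dir_map hjl (hdir l (hj.trans hjl))) (by rw [hcompat]; exact hdir j hj)
  obtain ⟨D, hD, hDj⟩ := exists_germ (x := w) (fun j hj => Filter.map (τ j hj) (𝓝[>] 0))
    (fun j hj => by rw [hw j hj]; exact hdir j hj) hcompat
  refine ⟨w, ?_, Or.inr ⟨D, hD, t, htI, fun i' σ hσ => ?_⟩⟩
  · rw [hw k le_rfl, ← hz k le_rfl, map_self]
  · refine solenoid_ext (k := k) fun j hj => ?_
    have h₁ := (hσ.isLift hj).map_eq
    rw [hσ.germ j, hDj j hj, (hτ j hj).map_eq] at h₁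
    have hii : i = i' := starArc_map_inj h h₁
    subst hii
    have := ((H.isStarCover hj).arc i).lift_eq_of_dir (hσ.isLift hj) (hτ j hj) (by
      rw [hσ.germ j, hDj j hj, inf_idem]
      exact map_neBot)
    rw [← hτy j hj]
    exact this htI

theorem eq_of_joinedIn (H : ζ.IsStandardChart h p) {x y : ζ.Solenoid} (hx : x.1 k = p)
    (hy : y.1 k = p) (hxy : JoinedIn (ζ.proj k ⁻¹' V) x y) : x = y := by
  refine solenoid_ext (k := k) fun j hj => ?_
  obtain ⟨γ, hγ⟩ := hxy
  have i₀ : Fin m := ⟨0, one_pos.trans H.one_lt⟩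
  refine (H.isStarCover hj).eq_of_isPreconnected (i₀ := i₀)
    (by rw [ζ.map_proj, hx, H.center]) (by rw [ζ.map_proj, hy, H.center])
    (S := range fun t => (γ t).1 j)
    (isPreconnected_range ((continuous_coord j).comp γ.continuous)) ?_
    ⟨0, by simp⟩ ⟨1, by simp⟩
  rintro _ ⟨t, rfl⟩
  rw [ζ.map_proj]
  exact hγ t

/-- The structure of standard plaques. -/
theorem exists_plaque (H : ζ.IsStandardChart h p) {x : ζ.Solenoid} (hx : x.1 k ∈ V) :
    ∃ z : ζ.Solenoid, z.1 k = p ∧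
      pathComponentIn (ζ.proj k ⁻¹' V) x = pathComponentIn (ζ.proj k ⁻¹' V) z := by
  obtain ⟨z, hz, hcase⟩ := H.exists_center hx
  refine ⟨z, hz, ?_⟩
  rcases hcase with rfl | ⟨D, hD, t, ht, hσ⟩
  · rfl
  obtain ⟨i, σ, hprong⟩ := H.exists_prong hz hD
  have := joined_prong hprong (Ioo_subset_Ico_self ht)
  rw [hσ i σ hprong] at this
  exact pathComponentIn_congr this

/-- Every point of the neighborhood is joined to some center, and a path component contains only one
center. Since a germ has a unique prong, it does not matter that the prong is universally
quantified. -/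
theorem mem_pathComponentIn_iff (H : ζ.IsStandardChart h p) {z : ζ.Solenoid} (hz : z.1 k = p)
    {y : ζ.Solenoid} : y ∈ pathComponentIn (ζ.proj k ⁻¹' V) z ↔
      y = z ∨ ∃ D ∈ Germ z, ∃ t ∈ Ioo (0 : ℝ) 1, ∀ i σ, IsProng h z D i σ → σ t = y := by
  constructor
  · intro hy
    have hy : JoinedIn (ζ.proj k ⁻¹' V) z y := hy
    obtain ⟨w, hw, hcase⟩ := H.exists_center (show y.1 k ∈ V from hy.mem.2)
    have hwy : JoinedIn (ζ.proj k ⁻¹' V) w y := by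
      rcases hcase with rfl | ⟨D, hD, t, ht, hσ⟩
      · exact JoinedIn.refl hy.mem.2
      · obtain ⟨i, σ, hprong⟩ := H.exists_prong hw hD
        have := joined_prong hprong (Ioo_subset_Ico_self ht)
        rwa [hσ i σ hprong] at this
    obtain rfl := H.eq_of_joinedIn hz hw (hy.trans hwy.symm)
    exact hcase
  · rintro (rfl | ⟨D, hD, t, ht, hσ⟩)
    · exact mem_pathComponentIn_self (show y.1 k ∈ V from hz ▸ H.center_mem)
    · obtain ⟨i, σ, hprong⟩ := H.exists_prong hz hD
      have := joined_prong hprong (Ioo_subset_Ico_self ht)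
      rwa [hσ i σ hprong] at this

end IsStandardChart

end SplitSequence

namespace SplitSeq

theorem isPathConnected_of_star {Y : Type u} [TopologicalSpace Y] {U : Set Y} {m : ℕ}
    (h : Star m ≃ₜ U) (i₀ : Fin m) : IsPathConnected U := by
  have h₀ : ∀ i, ∀ t ∈ Ico (0 : ℝ) 1, JoinedIn U (starArc h i₀ 0) (starArc h i t) := by
    intro i t ht
    have hpc : IsPathConnected (starArc h i '' Ico 0 1) :=
      ((convex_Ico (0 : ℝ) 1).isPathConnected ⟨0, zero_mem_Ico⟩).image' (continuousOn_starArc h i)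
    rw [starArc_zero h i₀ i]
    refine (hpc.joinedIn _ ⟨0, zero_mem_Ico, rfl⟩ _ ⟨t, ht, rfl⟩).mono ?_
    rintro _ ⟨s, -, rfl⟩
    exact starArc_mem h i s
  refine ⟨starArc h i₀ 0, starArc_mem h _ _, fun {y} hy => ?_⟩
  obtain ⟨i, t, ht, rfl⟩ := exists_starArc h hy
  exact h₀ i t ht

theorem exists_starSet_extend {Y : Type u} [TopologicalSpace Y] {V : Set Y} {m : ℕ}
    (h : Star m ≃ₜ V) {Z : Type v} [TopologicalSpace Z] [Nonempty Z] {ρ : Star m → Z}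
    (hρ : Continuous ρ) : ∃ g : Y → Z, ContinuousOn g V ∧
      ∀ i t, g (starArc h i t) = ρ (starPath i t) := by
  classical
  refine ⟨fun y => if hy : y ∈ V then ρ (h.symm ⟨y, hy⟩) else Classical.arbitrary Z, ?_, ?_⟩
  · rw [continuousOn_iff_continuous_domRestrict]
    convert hρ.comp h.symm.continuous using 1
    ext y
    exact dif_pos y.2
  · intro i t
    simp only [dif_pos (starArc_mem h i t)]
    congr 1
    rw [Homeomorph.symm_apply_eq]
    rfl

end SplitSeq

/-! ### Good sequences: germs, pre-singularities and the structure of plaques -/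

namespace SplitSequence

open SplitSeq

variable {n : ℕ} {ζ : SplitSequence.{u} n}

/-- Some point, all of whose germs are among the two germs `A`, `B`, has the same directions at
level `j` as the turn given by the germs `D`, `E`. -/
def IsTakenGerm (D E : ∀ j, Filter (ζ.G j)) (j : ℕ) : Prop :=
  ∃ y : ζ.Solenoid, ∃ A ∈ Germ y, ∃ B ∈ Germ y, Germ y ⊆ {A, B} ∧ A j = D j ∧ B j = E j

variable (ζ) in
/-- All pre-singularities and all turns at pre-singularities have stabilized at the top level. -/
structure IsGood : Prop where
  natural : ∀ x, ζ.IsPreSingularity x → ∀ j, IsNaturalVertex (x.1 j)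
  separated : ∀ x y, ζ.IsPreSingularity x → ζ.IsPreSingularity y → x.1 0 = y.1 0 → x = y
  germ : ∀ x, ζ.IsPreSingularity x → ∀ D ∈ Germ x, ∀ E ∈ Germ x, D 0 = E 0 → D = E
  taken : ∀ x, ζ.IsPreSingularity x → ∀ D ∈ Germ x, ∀ E ∈ Germ x,
    IsTakenGerm D E 0 → ∀ j, IsTakenGerm D E j

theorem exists_not_isNaturalVertex {x : ζ.Solenoid} (hx : ¬ ζ.IsPreSingularity x) (k : ℕ) :
    ∃ j, k ≤ j ∧ ¬ IsNaturalVertex (x.1 j) := by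
  by_contra! h
  exact hx ⟨k, h⟩

namespace IsGood

theorem vertexStabilized (hg : ζ.IsGood) : ζ.VertexStabilized := by
  intro j q
  refine ⟨fun _ x hx y hy => ?_, fun hq x hx hpre => hq ?_⟩
  · refine hg.separated x y hx.2 hy.2 ?_
    have h₁ : x.1 j = q := hx.1
    have h₂ : y.1 j = q := hy.1
    rw [← ζ.map_proj (Nat.zero_le j) x, ← ζ.map_proj (Nat.zero_le j) y, h₁, h₂]
  · have h₁ : x.1 j = q := hx
    rw [← h₁]
    exact hg.natural x hpre j

/-- At a pre-singularity this is part of goodness. Any other point has arbitrarily deep coordinates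
that are not natural vertices, and there the map on directions is injective. -/
theorem germ_inj (hg : ζ.IsGood) {x : ζ.Solenoid} {D E : ∀ j, Filter (ζ.G j)} (hD : D ∈ Germ x)
    (hE : E ∈ Germ x) {j : ℕ} (h : D j = E j) : D = E := by
  by_cases hx : ζ.IsPreSingularity x
  · exact hg.germ x hx D hD E hE (Germ.eq_of_le hD hE (Nat.zero_le j) h)
  · refine Germ.ext hD hE (k := j) fun l hl => ?_
    obtain ⟨l', hl', hn⟩ := exists_not_isNaturalVertex hx l
    refine Germ.eq_of_le hD hE hl' ?_
    refine ζ.dir_map_injOn (hl.trans hl') hn (hD.1 l') (hE.1 l') ?_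
    rw [Germ.map hD, Germ.map hE, h]

theorem finite_germ (hg : ζ.IsGood) (x : ζ.Solenoid) : (Germ x).Finite := by
  refine Set.Finite.of_finite_image (f := fun D => D 0) (((ζ.graph 0).finite_dir (x.1 0)).subset ?_)
    fun D hD E hE h => hg.germ_inj hD hE h
  rintro _ ⟨D, hD, rfl⟩
  exact hD.1 0

/-- The germs inject into the directions at every level, so a single coordinate that is not a
natural vertex allows at most two. -/
theorem isPreSingularity_of_two_lt (hg : ζ.IsGood) {x : ζ.Solenoid} (hx : 2 < (Germ x).ncard) :
    ζ.IsPreSingularity x := by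
  by_contra hpre
  obtain ⟨j, -, hn⟩ := exists_not_isNaturalVertex hpre 0
  rw [(ζ.graph j).isNaturalVertex_iff] at hn
  refine hn (hx.trans_le ?_)
  refine Set.ncard_le_ncard_of_injOn (fun D => D j) (fun D hD => hD.1 j)
    (fun D hD E hE h => hg.germ_inj hD hE h) ((ζ.graph j).finite_dir _)

end IsGood

/-! ## Plaques of a stabilized sequence -/

section Plaque

variable {k : ℕ} {V : Set (ζ.G k)} {m : ℕ} {h : Star m ≃ₜ V} {p : ζ.G k}

theorem prong_index_inj (hg : ζ.IsGood) {x : ζ.Solenoid} {D E : ∀ j, Filter (ζ.G j)} {i : Fin m}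
    {σ τ : ℝ → ζ.Solenoid} (hσ : IsProng h x D i σ) (hτ : IsProng h x E i τ) (hD : D ∈ Germ x)
    (hE : E ∈ Germ x) : D = E := by
  refine hg.germ_inj hD hE (j := k) ?_
  have h₁ := (hσ.isLift le_rfl).map_eq
  have h₂ := (hτ.isLift le_rfl).map_eq
  rw [hσ.germ k, Germ.map hD] at h₁
  rw [hτ.germ k, Germ.map hE] at h₂
  rw [h₁, h₂]

/-- Different germs at the center lie over different prongs of `V`, and each prong of the plaque
projects injectively. -/
theorem proj_injOn_plaque (hg : ζ.IsGood) (H : ζ.IsStandardChart h p) {x : ζ.Solenoid}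
    (hx : x.1 k ∈ V) : InjOn (ζ.proj k) (pathComponentIn (ζ.proj k ⁻¹' V) x) := by
  obtain ⟨z, hz, heq⟩ := H.exists_plaque hx
  rw [heq]
  have hrep : ∀ y ∈ pathComponentIn (ζ.proj k ⁻¹' V) z, y = z ∨ ∃ D ∈ Germ z, ∃ i σ,
      IsProng h z D i σ ∧ ∃ t ∈ Ioo (0 : ℝ) 1, y = σ t := by
    intro y hy
    rcases (H.mem_pathComponentIn_iff hz).1 hy with hy | ⟨D, hD, t, ht, hσ⟩
    · exact Or.inl hy
    · obtain ⟨i, σ, hprong⟩ := H.exists_prong hz hD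
      exact Or.inr ⟨D, hD, i, σ, hprong, t, ht, (hσ i σ hprong).symm⟩
  intro y hy y' hy' hyy
  have hyy : y.1 k = y'.1 k := hyy
  rcases hrep y hy with rfl | ⟨D, hD, i, σ, hσ, t, ht, rfl⟩ <;>
    rcases hrep y' hy' with rfl | ⟨E, hE, i', τ, hτ, s, hs, rfl⟩
  · rfl
  · rw [hτ.proj s (Ioo_subset_Ico_self hs), hz] at hyy
    exact absurd hyy.symm (H.arc_ne i' hs)
  · rw [hσ.proj t (Ioo_subset_Ico_self ht), hz] at hyy
    exact absurd hyy (H.arc_ne i ht)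
  · rw [hσ.proj t (Ioo_subset_Ico_self ht), hτ.proj s (Ioo_subset_Ico_self hs),
      starArc_eq_iff h (Ioo_subset_Ico_self ht) (Ioo_subset_Ico_self hs)] at hyy
    obtain ⟨rfl, rfl | h0⟩ := hyy
    · obtain rfl := prong_index_inj hg hσ hτ hD hE
      exact H.prong_unique hσ hτ hD (Ioo_subset_Ico_self ht)
    · exact absurd h0 ht.1.ne'

/-- A signed coordinate on a standard neighborhood that singles out one prong. -/
theorem exists_coordinate (h : Star m ≃ₜ V) (i : Fin m) : ∃ g : ζ.Solenoid → ℝ,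
    ContinuousOn g (ζ.proj k ⁻¹' V) ∧
    (∀ x : ζ.Solenoid, ∀ t ∈ Ico (0 : ℝ) 1, x.1 k = starArc h i t → g x = t) ∧
    ∀ b, b ≠ i → ∀ x : ζ.Solenoid, ∀ t ∈ Ico (0 : ℝ) 1, x.1 k = starArc h b t → g x = -t := by
  obtain ⟨ρ, hρ, hρ₁, hρ₂⟩ := exists_signedRadius i
  obtain ⟨g, hgc, hg'⟩ := exists_starSet_extend h hρ
  refine ⟨fun x => g (x.1 k), ?_, ?_, ?_⟩
  · exact hgc.comp (continuous_coord k).continuousOn fun x hx => hx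
  · intro x t ht hx
    simp only [hx, hg', hρ₁ t ht]
  · intro b hb x t ht hx
    simp only [hx, hg', hρ₂ b hb t ht]

/-- A plaque with at most two germs embeds into the line by a signed coordinate. -/
theorem injOn_coordinate (hg : ζ.IsGood) (H : ζ.IsStandardChart h p) {z : ζ.Solenoid}
    (hz : z.1 k = p) (hle : ¬ 2 < (Germ z).ncard) {A : ∀ j, Filter (ζ.G j)} (hA : A ∈ Germ z)
    {i : Fin m} {σ : ℝ → ζ.Solenoid} (hσ : IsProng h z A i σ) {g : ζ.Solenoid → ℝ}
    (hg₁ : ∀ x : ζ.Solenoid, ∀ t ∈ Ico (0 : ℝ) 1, x.1 k = starArc h i t → g x = t)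
    (hg₂ : ∀ b, b ≠ i → ∀ x : ζ.Solenoid, ∀ t ∈ Ico (0 : ℝ) 1, x.1 k = starArc h b t →
      g x = -t) : InjOn g (pathComponentIn (ζ.proj k ⁻¹' V) z) := by
  have hg0 : g z = 0 := hg₁ z 0 zero_mem_Ico (by rw [hz, H.center])
  have hrep : ∀ y ∈ pathComponentIn (ζ.proj k ⁻¹' V) z, g y = 0 ∧ y = z ∨
      (∃ t ∈ Ioo (0 : ℝ) 1, g y = t ∧ y = σ t) ∨
      ∃ D ∈ Germ z, D ≠ A ∧ ∃ b τ, IsProng h z D b τ ∧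
        ∃ t ∈ Ioo (0 : ℝ) 1, g y = -t ∧ y = τ t := by
    intro y hy
    rcases (H.mem_pathComponentIn_iff hz).1 hy with rfl | ⟨D, hD, t, ht, hy⟩
    · exact Or.inl ⟨hg0, rfl⟩
    · by_cases hDA : D = A
      · subst hDA
        have := hy i σ hσ
        subst this
        exact Or.inr (Or.inl ⟨t, ht, hg₁ _ t (Ioo_subset_Ico_self ht)
          (hσ.proj t (Ioo_subset_Ico_self ht)), rfl⟩)
      · obtain ⟨b, τ, hτ⟩ := H.exists_prong hz hD
        have := hy b τ hτ
        subst this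
        have hb : b ≠ i := by
          rintro rfl
          exact hDA (prong_index_inj hg hτ hσ hD hA)
        exact Or.inr (Or.inr ⟨D, hD, hDA, b, τ, hτ, t, ht,
          hg₂ b hb _ t (Ioo_subset_Ico_self ht) (hτ.proj t (Ioo_subset_Ico_self ht)), rfl⟩)
  intro y hy y' hy' hyy
  rcases hrep y hy with ⟨h₁, h₂⟩ | ⟨t, ht, h₁, h₂⟩ | ⟨D, hD, hDA, b, τ, hτ, t, ht, h₁, h₂⟩ <;>
  rcases hrep y' hy' with ⟨h₃, h₄⟩ | ⟨s, hs, h₃, h₄⟩ | ⟨E, hE, hEA, c, υ, hυ, s, hs, h₃, h₄⟩ <;>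
  rw [h₁, h₃] at hyy
  · rw [h₂, h₄]
  · linarith [hs.1]
  · linarith [hs.1]
  · linarith [ht.1]
  · rw [h₂, h₄, hyy]
  · linarith [ht.1, hs.1]
  · linarith [ht.1]
  · linarith [ht.1, hs.1]
  · have hDE : D = E := by
      by_contra hne
      refine hle ((Set.two_lt_ncard_iff (hg.finite_germ z)).2
        ⟨A, D, E, hA, hD, hE, Ne.symm hDA, Ne.symm hEA, hne⟩)
    subst hDE
    obtain rfl : t = s := by linarith
    rw [h₂, h₄]
    exact H.prong_unique hτ hυ hD (Ioo_subset_Ico_self ht)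

/-- With at most two germs the plaque is a point or injects continuously into the line, which a star
with more than two prongs does not. -/
theorem two_lt_ncard_germ (hg : ζ.IsGood) (H : ζ.IsStandardChart h p) {z : ζ.Solenoid}
    (hz : z.1 k = p) {N : ℕ} (hN : 2 < N)
    (hs : IsStarSet N (pathComponentIn (ζ.proj k ⁻¹' V) z)) : 2 < (Germ z).ncard := by
  by_contra hle
  rcases (Germ z).eq_empty_or_nonempty with hempty | ⟨A, hA⟩
  · refine not_injOn_of_isStarSet hN hs (g := fun _ => (0 : ℝ)) continuousOn_const ?_
    have hone : ∀ y ∈ pathComponentIn (ζ.proj k ⁻¹' V) z, y = z := by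
      intro y hy
      rcases (H.mem_pathComponentIn_iff hz).1 hy with hy | ⟨D, hD, -⟩
      · exact hy
      · rw [hempty] at hD
        exact hD.elim
    intro y hy y' hy' _
    rw [hone y hy, hone y' hy']
  · obtain ⟨i, σ, hσ⟩ := H.exists_prong hz hA
    obtain ⟨g, hgc, hg₁, hg₂⟩ := exists_coordinate (ζ := ζ) h i
    exact not_injOn_of_isStarSet hN hs (hgc.mono pathComponentIn_subset)
      (injOn_coordinate hg H hz hle hA hσ hg₁ hg₂)

/-- A standard plaque is a star whose prongs correspond to the germs at its center. -/
theorem exists_plaque_homeomorph (hg : ζ.IsGood) (H : ζ.IsStandardChart h p) {z : ζ.Solenoid}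
    (hz : z.1 k = p) {N : ℕ} (hN : 0 < N) (e : Fin N ≃ Germ z) :
    ∃ (φ : Star N ≃ₜ pathComponentIn (ζ.proj k ⁻¹' V) z) (ι : Fin N → Fin m)
      (σ : Fin N → ℝ → ζ.Solenoid), (∀ d, IsProng h z (e d) (ι d) (σ d)) ∧
      ∀ d, ∀ t ∈ Ico (0 : ℝ) 1, (φ (starPath d t) : ζ.Solenoid) = σ d t := by
  classical
  have hex := fun d => H.exists_prong hz (e d).2
  choose ι σ hσ using hex
  have hι : Function.Injective ι := fun d d' hdd => e.injective <| Subtype.ext <|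
    prong_index_inj hg (hdd ▸ hσ d) (hσ d') (e d).2 (e d').2
  obtain ⟨Φ, hΦ, hΦ'⟩ := exists_starLift (g := σ) (fun d => (hσ d).cont)
    fun d d' => by rw [(hσ d).zero, (hσ d').zero]
  have d₀ : Fin N := ⟨0, hN⟩
  -- This collapses the prongs of `V` without a germ over them to the center and retracts onto the
  -- others; composed with the projection to level `k`, it is the continuous inverse of `Φ`.
  obtain ⟨κ, hκ, hκ'⟩ := exists_starLift
    (g := fun (b : Fin m) t => if hb : ∃ d, ι d = b then starPath hb.choose t else starPath d₀ 0)
    (fun b => by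
      by_cases hb : ∃ d, ι d = b
      · simp only [dif_pos hb]
        exact continuousOn_starPath _
      · simp only [dif_neg hb]
        exact continuousOn_const)
    (fun b c => by
      have : ∀ b : Fin m, (if hb : ∃ d, ι d = b then starPath hb.choose 0 else starPath d₀ 0)
          = starPath d₀ 0 := fun b => by
        split_ifs with hb
        · exact starPath_zero _ _
        · rfl
      rw [this, this])
  have hκι : ∀ d, ∀ t ∈ Ico (0 : ℝ) 1, κ (starPath (ι d) t) = starPath d t := by
    intro d t ht
    have hb : ∃ d', ι d' = ι d := ⟨d, rfl⟩
    rw [hκ' _ t ht, dif_pos hb, hι hb.choose_spec]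
  have : Nonempty (Star N) := ⟨starPath d₀ 0⟩
  obtain ⟨r, hrc, hr⟩ := exists_starSet_extend h hκ
  have hmem : ∀ q, Φ q ∈ pathComponentIn (ζ.proj k ⁻¹' V) z := by
    intro q
    obtain ⟨d, t, ht, rfl⟩ := exists_starPath q
    rw [hΦ' d t ht]
    exact IsStandardChart.joined_prong (hσ d) ht
  have hleft : ∀ q, r ((Φ q).1 k) = q := by
    intro q
    obtain ⟨d, t, ht, rfl⟩ := exists_starPath q
    rw [hΦ' d t ht, (hσ d).proj t ht, hr, hκι d t ht]
  have hright : ∀ y ∈ pathComponentIn (ζ.proj k ⁻¹' V) z, ∃ q, Φ q = y := by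
    intro y hy
    rcases (H.mem_pathComponentIn_iff hz).1 hy with rfl | ⟨D, hD, t, ht, hy⟩
    · exact ⟨starPath d₀ 0, by rw [hΦ' d₀ 0 zero_mem_Ico, (hσ d₀).zero]⟩
    · refine ⟨starPath (e.symm ⟨D, hD⟩) t, ?_⟩
      rw [hΦ' _ t (Ioo_subset_Ico_self ht)]
      refine hy (ι (e.symm ⟨D, hD⟩)) (σ (e.symm ⟨D, hD⟩)) ?_
      have := hσ (e.symm ⟨D, hD⟩)
      rwa [e.apply_symm_apply] at this
  refine ⟨{ toFun := fun q => ⟨Φ q, hmem q⟩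
            invFun := fun y => r (y.1.1 k)
            left_inv := hleft
            right_inv := ?_
            continuous_toFun := hΦ.subtype_mk _
            continuous_invFun := ?_ }, ι, σ, hσ, fun d t ht => hΦ' d t ht⟩
  · rintro ⟨y, hy⟩
    obtain ⟨q, rfl⟩ := hright y hy
    exact Subtype.ext (by simp only [hleft])
  · refine hrc.comp_continuous ((continuous_coord k).comp continuous_subtype_val) fun y => ?_
    exact (pathComponentIn_subset y.2 : (y : ζ.Solenoid) ∈ ζ.proj k ⁻¹' V)

theorem eq_center_of_isNaturalVertex (H : ζ.IsStandardChart h p) {x : ζ.Solenoid} {j : ℕ}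
    (hj : j ≤ k) (hx : IsNaturalVertex (x.1 j)) (hxV : x.1 k ∈ V) : x.1 k = p := by
  by_contra hne
  refine H.not_special _ hxV hne (ζ.isSpecial_of_isNaturalVertex_map hj ?_)
  rwa [ζ.map_proj]

theorem isStarSetCenteredAt_plaque (hg : ζ.IsGood) (H : ζ.IsStandardChart h p) {z : ζ.Solenoid}
    (hz : z.1 k = p) (hcard : 2 < (Germ z).ncard) :
    IsStarSet (Germ z).ncard (pathComponentIn (ζ.proj k ⁻¹' V) z) ∧
      IsStarSetCenteredAt (pathComponentIn (ζ.proj k ⁻¹' V) z) z := by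
  have := (hg.finite_germ z).to_subtype
  obtain ⟨φ, ι, σ, hσ, hφ⟩ := exists_plaque_homeomorph hg H hz (by omega : 0 < (Germ z).ncard)
    (Finite.equivFinOfCardEq rfl).symm
  have h1 : 1 < (Germ z).ncard := by omega
  have d₀ : Fin (Germ z).ncard := ⟨0, one_pos.trans h1⟩
  refine ⟨⟨h1, ⟨φ⟩⟩, _, h1, φ, starPath d₀ 0, (mem_starCenter_iff d₀).2 rfl, ?_⟩
  rw [hφ d₀ 0 zero_mem_Ico, (hσ d₀).zero]

/-- All coordinates of `z` are natural vertices, hence special, so `z` lies over the center of every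
standard neighborhood that contains it. -/
theorem isSingularity_of_two_lt (hg : ζ.IsGood) {z : ζ.Solenoid} (hcard : 2 < (Germ z).ncard) :
    ζ.IsSingularity z := by
  rintro O ⟨k, V, hV, rfl⟩ hzO
  obtain ⟨m, h, p, H⟩ := exists_isStandardChart hV
  have hnat := hg.natural z (hg.isPreSingularity_of_two_lt hcard) k
  have hz := eq_center_of_isNaturalVertex H le_rfl hnat hzO
  exact ⟨_, hcard, (isStarSetCenteredAt_plaque hg H hz hcard).1⟩

end Plaque

end SplitSequence

/-! ### Two-sided paths through a turn -/

namespace SplitSeq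

/-- The path on `(-1,1)` that runs through `τ` backwards and then through `σ`. -/
noncomputable def turnPath {Y : Type u} (σ τ : ℝ → Y) (t : ℝ) : Y :=
  if 0 ≤ t then σ t else τ (-t)

theorem turnPath_of_nonneg {Y : Type u} (σ τ : ℝ → Y) {t : ℝ} (ht : 0 ≤ t) :
    turnPath σ τ t = σ t := if_pos ht

theorem turnPath_of_neg {Y : Type u} (σ τ : ℝ → Y) {t : ℝ} (ht : t < 0) :
    turnPath σ τ t = τ (-t) := if_neg ht.not_ge

theorem turnPath_neg {Y : Type u} {σ τ : ℝ → Y} (h0 : σ 0 = τ 0) {t : ℝ} (ht : 0 ≤ t) :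
    turnPath σ τ (-t) = τ t := by
  rcases ht.eq_or_lt with rfl | ht
  · rw [neg_zero, turnPath_of_nonneg _ _ le_rfl, h0]
  · rw [turnPath_of_neg _ _ (by linarith), neg_neg]

theorem continuousOn_turnPath {Y : Type u} [TopologicalSpace Y] {σ τ : ℝ → Y}
    (hσ : ContinuousOn σ (Ico 0 1)) (hτ : ContinuousOn τ (Ico 0 1)) (h0 : σ 0 = τ 0) :
    ContinuousOn (turnPath σ τ) (Ioo (-1) 1) := by
  rw [continuousOn_iff_continuous_domRestrict]
  have h : Continuous fun t : Ioo (-1 : ℝ) 1 =>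
      if (0 : ℝ) ≤ t then σ (max t 0) else τ (max (-t) 0) := by
    refine Continuous.if_le ?_ ?_ continuous_const continuous_subtype_val ?_
    · exact hσ.comp_continuous (by fun_prop) fun t => ⟨le_max_right _ _, max_lt t.2.2 one_pos⟩
    · exact hτ.comp_continuous (by fun_prop) fun t => ⟨le_max_right _ _,
        max_lt (by linarith [t.2.1]) one_pos⟩
    · intro t ht
      rw [← ht, neg_zero, max_self, h0]
  convert h using 1
  ext t
  change turnPath σ τ t = _
  split_ifs with ht
  · rw [turnPath_of_nonneg _ _ ht, max_eq_left ht]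
  · rw [turnPath_of_neg _ _ (not_le.1 ht), max_eq_left (by linarith)]

theorem image_turnPath {Y : Type u} {σ τ : ℝ → Y} (h0 : σ 0 = τ 0) :
    turnPath σ τ '' Ioo (-1) 1 = σ '' Ico 0 1 ∪ τ '' Ico 0 1 := by
  ext y
  constructor
  · rintro ⟨t, ht, rfl⟩
    rcases le_or_gt 0 t with h | h
    · exact Or.inl ⟨t, ⟨h, ht.2⟩, (turnPath_of_nonneg _ _ h).symm⟩
    · exact Or.inr ⟨-t, ⟨by linarith, by linarith [ht.1]⟩, (turnPath_of_neg _ _ h).symm⟩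
  · rintro (⟨t, ht, rfl⟩ | ⟨t, ht, rfl⟩)
    · exact ⟨t, ⟨by linarith [ht.1], ht.2⟩, turnPath_of_nonneg _ _ ht.1⟩
    · exact ⟨-t, ⟨by linarith [ht.2], by linarith [ht.1]⟩, turnPath_neg h0 ht.1⟩

/-- A continuous injective function on an open interval is an embedding. -/
theorem isEmbedding_of_injOn_Ioo {ψ : ℝ → ℝ} {a b : ℝ} (hc : ContinuousOn ψ (Ioo a b))
    (hi : InjOn ψ (Ioo a b)) : IsEmbedding fun t : Ioo a b => ψ t := by
  have hs : Continuous fun t : Ioo a b => ψ t := continuousOn_iff_continuous_domRestrict.1 hc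
  refine IsOpenEmbedding.isEmbedding <| .of_continuous_injective_isOpenMap hs
    (fun s t h => Subtype.ext (hi s.2 t.2 h)) ?_
  have hloc : IsOpenMap fun t : Ioo a b => ψ t := by
    rw [isOpenMap_iff_nhds_le]
    intro t S hS
    rw [mem_map] at hS
    obtain ⟨T, hT, hTS⟩ := mem_nhds_subtype (Ioo a b) t _ |>.1 hS
    obtain ⟨c, d, hcd, hsub⟩ : ∃ c d, (t : ℝ) ∈ Ioo c d ∧ Icc c d ⊆ T ∩ Ioo a b := by
      obtain ⟨ε, hε, hb⟩ := Metric.mem_nhds_iff.1 (inter_mem hT (Ioo_mem_nhds t.2.1 t.2.2))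
      refine ⟨t - ε / 2, t + ε / 2, ⟨by linarith, by linarith⟩, fun s hs => hb ?_⟩
      rw [Metric.mem_ball, Real.dist_eq, abs_lt]
      exact ⟨by linarith [hs.1], by linarith [hs.2]⟩
    have hcdI : Icc c d ⊆ Ioo a b := fun s hs => (hsub hs).2
    have himg : ψ '' Icc c d ⊆ S := by
      rintro _ ⟨s, hs, rfl⟩
      exact hTS (a := ⟨s, hcdI hs⟩) (hsub hs).1
    refine mem_of_superset ?_ himg
    have hle : c ≤ d := (hcd.1.trans hcd.2).le
    rcases (hc.mono hcdI).strictMonoOn_of_injOn_Icc' hle (hi.mono hcdI) with hm | hm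
    · refine mem_of_superset (Icc_mem_nhds
        (hm ⟨le_rfl, hle⟩ (Ioo_subset_Icc_self hcd) hcd.1)
        (hm (Ioo_subset_Icc_self hcd) ⟨hle, le_rfl⟩ hcd.2))
        (intermediate_value_Icc hle (hc.mono hcdI))
    · refine mem_of_superset (Icc_mem_nhds
        (hm (Ioo_subset_Icc_self hcd) ⟨hle, le_rfl⟩ hcd.2)
        (hm ⟨le_rfl, hle⟩ (Ioo_subset_Icc_self hcd) hcd.1))
        (intermediate_value_Icc' hle (hc.mono hcdI))
  exact hloc

end SplitSeq

/-! ### Stars over turns, and singular segments as pairs of germs -/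

namespace SplitSequence

open SplitSeq

variable {n : ℕ} {ζ : SplitSequence.{u} n}

/-- Being path connected, `U` lies in one plaque and projects injectively to the turn; the signed
coordinate of the turn then injects `U` into the line. -/
theorem not_isStarSet_three_over_turn (hg : ζ.IsGood) {k : ℕ} {I : Set (ζ.G k)}
    (hI : ζ.IsStandardTurn I) : ¬ ∃ U : Set ζ.Solenoid, IsStarSet 3 U ∧ ζ.proj k '' U = I := by
  rintro ⟨U, hU, hUI⟩
  obtain ⟨V, hV, N, -, h₁, i, j, hij, rfl⟩ := hI
  obtain ⟨m, h, p, H⟩ := exists_isStandardChart hV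
  have hI : ∀ x ∈ U, (∃ t ∈ Ico (0 : ℝ) 1, x.1 k = starArc h₁ i t) ∨
      ∃ t ∈ Ioo (0 : ℝ) 1, x.1 k = starArc h₁ j t := by
    intro x hx
    have hmem := mem_image_of_mem (ζ.proj k) hx
    rw [hUI] at hmem
    obtain ⟨q, (hq | hq) | hq, hqx⟩ := hmem
    · rw [starProng_eq] at hq
      obtain ⟨t, ht, rfl⟩ := hq
      exact Or.inl ⟨t, Ioo_subset_Ico_self ht, hqx.symm⟩
    · rw [mem_starCenter_iff i] at hq
      subst hq
      exact Or.inl ⟨0, zero_mem_Ico, hqx.symm⟩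
    · rw [starProng_eq] at hq
      obtain ⟨t, ht, rfl⟩ := hq
      exact Or.inr ⟨t, ht, hqx.symm⟩
  have hUV : U ⊆ ζ.proj k ⁻¹' V := by
    intro x hx
    have : x.1 k ∈ V := by
      rcases hI x hx with ⟨t, -, ht⟩ | ⟨t, -, ht⟩ <;> rw [ht] <;> exact starArc_mem _ _ _
    exact this
  have hpc : IsPathConnected U := isPathConnected_of_star hU.2.some 0
  obtain ⟨x₀, hx₀⟩ := hpc.nonempty
  have hsub : U ⊆ pathComponentIn (ζ.proj k ⁻¹' V) x₀ := hpc.subset_pathComponentIn hx₀ hUV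
  have hinj := (proj_injOn_plaque hg H (hUV hx₀)).mono hsub
  obtain ⟨g, hgc, hg₁, hg₂⟩ := exists_coordinate (ζ := ζ) h₁ i
  refine not_injOn_of_isStarSet (by norm_num) hU (hgc.mono hUV) fun x hx y hy hxy => ?_
  refine hinj hx hy ?_
  change x.1 k = y.1 k
  rcases hI x hx with ⟨t, ht, hxt⟩ | ⟨t, ht, hxt⟩ <;>
    rcases hI y hy with ⟨s, hs, hys⟩ | ⟨s, hs, hys⟩
  · rw [hg₁ x t ht hxt, hg₁ y s hs hys] at hxy
    rw [hxt, hys, hxy]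
  · rw [hg₁ x t ht hxt, hg₂ j hij.symm y s (Ioo_subset_Ico_self hs) hys] at hxy
    linarith [ht.1, hs.1]
  · rw [hg₂ j hij.symm x t (Ioo_subset_Ico_self ht) hxt, hg₁ y s hs hys] at hxy
    linarith [ht.1, hs.1]
  · rw [hg₂ j hij.symm x t (Ioo_subset_Ico_self ht) hxt,
      hg₂ j hij.symm y s (Ioo_subset_Ico_self hs) hys] at hxy
    rw [hxt, hys, neg_injective hxy]

/-- A singular segment consists of two prongs at a pre-singularity. -/
theorem exists_prongs_of_isSingularSegment (hg : ζ.IsGood) {L : Set ζ.Solenoid}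
    (hL : ζ.IsSingularSegment L) : ∃ (k : ℕ) (V : Set (ζ.G k)) (m : ℕ) (h : Star m ≃ₜ V)
      (p : ζ.G k) (z : ζ.Solenoid) (D E : ∀ j, Filter (ζ.G j)) (i i' : Fin m)
      (σ τ : ℝ → ζ.Solenoid), ζ.IsStandardNbhd (ζ.proj k ⁻¹' V) ∧ ζ.IsStandardChart h p ∧
      z.1 k = p ∧ ζ.IsPreSingularity z ∧ D ∈ Germ z ∧ E ∈ Germ z ∧ D ≠ E ∧ IsProng h z D i σ ∧
      IsProng h z E i' τ ∧ L = σ '' Ico 0 1 ∪ τ '' Ico 0 1 := by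
  obtain ⟨W, ⟨⟨O, ⟨k, V, hV, rfl⟩, x₀, hx₀, hW⟩, x, hx, hxW⟩, N, -, h₁, i, j, hij, rfl⟩ := hL
  obtain ⟨m, h, p, H⟩ := exists_isStandardChart hV
  obtain ⟨z, hz, heq⟩ := H.exists_plaque hx₀
  rw [heq] at hW
  subst hW
  -- The singularity `x` and the center `z` share the plaque, which is a star with more than two
  -- prongs because `x` is a singularity.
  have hcard : 2 < (Germ z).ncard := by
    obtain ⟨_, -, h₂, c, -, rfl⟩ := hxW
    have hxz : JoinedIn (ζ.proj k ⁻¹' V) z (h₂ c) := (h₂ c).2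
    obtain ⟨M, hM, hs⟩ := hx _ ⟨k, V, hV, rfl⟩ hxz.mem.2
    rw [pathComponentIn_congr hxz] at hs
    exact two_lt_ncard_germ hg H hz hM hs
  have := (hg.finite_germ z).to_subtype
  obtain ⟨φ, ι, σ, hσ, hφ⟩ := exists_plaque_homeomorph hg H hz (by omega : 0 < (Germ z).ncard)
    (Finite.equivFinOfCardEq rfl).symm
  set e := (Finite.equivFinOfCardEq (α := Germ z) (n := (Germ z).ncard) rfl).symm
  -- The turn is given in an arbitrary star parameterization; comparison with the one by germs
  -- preserves center and prongs because there are more than two.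
  obtain ⟨hcen, hpr⟩ := homeomorph_starPath hcard (h₁.trans φ.symm)
  obtain ⟨a, ha⟩ := hpr i
  obtain ⟨b, hb⟩ := hpr j
  have hab : a ≠ b := by
    rintro rfl
    have : (h₁.trans φ.symm) (starPath i (1 / 2)) ∈
        (h₁.trans φ.symm) '' (starPath j '' Ioo 0 1) := by
      rw [hb, ← ha]
      exact mem_image_of_mem _ (mem_image_of_mem _ (by norm_num))
    rw [(h₁.trans φ.symm).injective.mem_set_image] at this
    obtain ⟨t, ht, he⟩ := this
    have := (starPath_eq_iff (Ioo_subset_Ico_self ht) (by norm_num)).1 he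
    rcases this.2 with h | h
    · exact hij h.symm
    · exact ht.1.ne' h
  have himg : ∀ i a, (h₁.trans φ.symm) '' (starPath i '' Ioo 0 1) = starPath a '' Ioo 0 1 →
      (fun q => (h₁ q : ζ.Solenoid)) '' (starPath i '' Ioo 0 1) = σ a '' Ioo 0 1 := by
    intro i a hia
    have h₂ : (fun q => (h₁ q : ζ.Solenoid)) =
        (fun q => (φ q : ζ.Solenoid)) ∘ (h₁.trans φ.symm) := by
      funext q
      simp
    rw [h₂, image_comp, hia, image_image]
    exact image_congr fun t ht => hφ a t (Ioo_subset_Ico_self ht)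
  have hzero : ∀ c, σ c '' Ico 0 1 = insert z (σ c '' Ioo 0 1) := by
    intro c
    rw [← Ioo_insert_left (one_pos), image_insert_eq, (hσ c).zero]
  refine ⟨k, V, m, h, p, z, e a, e b, ι a, ι b, σ a, σ b, ⟨k, V, hV, rfl⟩, H, hz,
    hg.isPreSingularity_of_two_lt hcard, (e a).2, (e b).2, fun h => hab ?_, hσ a, hσ b, ?_⟩
  · exact e.injective (Subtype.ext h)
  · have hc : starCenter N = {starPath i 0} := by
      ext q
      exact mem_starCenter_iff i
    have hcz : (h₁ (starPath i 0) : ζ.Solenoid) = z := by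
      have := hcen i a
      rw [Homeomorph.trans_apply, Homeomorph.symm_apply_eq] at this
      rw [this, hφ a 0 zero_mem_Ico, (hσ a).zero]
    rw [image_union, image_union, starProng_eq, starProng_eq, himg i a ha, himg j b hb, hc,
      image_singleton, hcz, hzero a, hzero b]
    ext y
    simp only [mem_union, mem_insert_iff, mem_singleton_iff]
    tauto

end SplitSequence

/-! ### Transferring leaf segments from the top level to lower levels -/

namespace SplitSequence

open SplitSeq

variable {n : ℕ} {ζ : SplitSequence.{u} n}

/-- The path through a turn that is sustained by a leaf segment becomes an embedding under a
coordinate of that leaf segment. Moreover the leaf segment provides a point with at most two germs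
whose directions at the top level are those of the turn. -/
theorem exists_embedding_of_sustains (hg : ζ.IsGood) {k : ℕ} {V : Set (ζ.G k)} {m : ℕ}
    {h : Star m ≃ₜ V} {p : ζ.G k} (H : ζ.IsStandardChart h p) {z : ζ.Solenoid}
    (hpre : ζ.IsPreSingularity z) {D E : ∀ j, Filter (ζ.G j)}
    (hD : D ∈ Germ z) (hE : E ∈ Germ z) (hDE : D ≠ E) {i i' : Fin m} {σ τ : ℝ → ζ.Solenoid}
    (hσ : IsProng h z D i σ) (hτ : IsProng h z E i' τ)
    (htaken : ζ.IsTaken (ζ.proj 0 '' (σ '' Ico 0 1 ∪ τ '' Ico 0 1))) :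
    IsTakenGerm D E 0 ∧ ∃ u : ζ.G 0 → ℝ,
      ContinuousOn u (ζ.proj 0 '' (σ '' Ico 0 1 ∪ τ '' Ico 0 1)) ∧
      IsEmbedding fun t : Ioo (-1 : ℝ) 1 => u ((turnPath σ τ t).1 0) := by
  classical
  set T := σ '' Ico 0 1 ∪ τ '' Ico 0 1 with hT
  obtain ⟨L, ⟨⟨O, ⟨k', V', hV', rfl⟩, x₀, hx₀, hLeq⟩, hns⟩, l, hl⟩ := htaken
  obtain ⟨m', h', p', H'⟩ := exists_isStandardChart hV'
  have h0 : σ 0 = τ 0 := by rw [hσ.zero, hτ.zero]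
  -- the section over the turn
  obtain ⟨e, hec, heL, he⟩ : ∃ e : ζ.G 0 → ζ.Solenoid, ContinuousOn e (ζ.proj 0 '' T) ∧
      (∀ q ∈ ζ.proj 0 '' T, e q ∈ L) ∧ ∀ q ∈ ζ.proj 0 '' T, (e q).1 0 = q := by
    refine ⟨fun q => if hq : q ∈ ζ.proj 0 '' T then l ⟨q, hq⟩ else z, ?_, ?_, ?_⟩
    · rw [continuousOn_iff_continuous_domRestrict]
      convert continuous_subtype_val.comp l.continuous using 1
      ext1 q
      exact dif_pos q.2
    · intro q hq
      simp only [dif_pos hq]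
      exact (l _).2
    · intro q hq
      simp only [dif_pos hq]
      exact hl ⟨q, hq⟩
  have hmem : ∀ t ∈ Ioo (-1 : ℝ) 1, (turnPath σ τ t).1 0 ∈ ζ.proj 0 '' T := fun t ht =>
    mem_image_of_mem (ζ.proj 0) (hT.symm ▸ image_turnPath h0 ▸ mem_image_of_mem (turnPath σ τ) ht)
  have hσT : ∀ t ∈ Ico (0 : ℝ) 1, (σ t).1 0 ∈ ζ.proj 0 '' T := fun t ht =>
    mem_image_of_mem (ζ.proj 0) (Or.inl (mem_image_of_mem _ ht))
  have hτT : ∀ t ∈ Ico (0 : ℝ) 1, (τ t).1 0 ∈ ζ.proj 0 '' T := fun t ht =>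
    mem_image_of_mem (ζ.proj 0) (Or.inr (mem_image_of_mem _ ht))
  have hzT : z.1 0 ∈ ζ.proj 0 '' T := by
    rw [← hσ.zero]
    exact hσT 0 zero_mem_Ico
  -- the center of the leaf segment
  set y := e (z.1 0) with hy
  have hLsub : L ⊆ ζ.proj k' ⁻¹' V' := hLeq ▸ pathComponentIn_subset
  have hy0 : y.1 0 = z.1 0 := he _ hzT
  have hyL : y ∈ L := heL _ hzT
  -- By goodness `z` projects to a natural vertex of the top level, and so does `y`; hence `y` is
  -- the center of the leaf segment, whatever level `k'` it comes from.
  have hyp : y.1 k' = p' := eq_center_of_isNaturalVertex H' (Nat.zero_le k')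
    (by rw [hy0]; exact hg.natural z hpre 0) (hLsub hyL)
  have hLy : L = pathComponentIn (ζ.proj k' ⁻¹' V') y := by
    rw [hLeq] at hyL ⊢
    exact (pathComponentIn_congr hyL).symm
  have hcard : ¬ 2 < (Germ y).ncard := fun hlt => hns ⟨⟨_, ⟨k', V', hV', rfl⟩, x₀, hx₀, hLeq⟩, y,
    isSingularity_of_two_lt hg hlt, hLy ▸ (isStarSetCenteredAt_plaque hg H' hyp hlt).2⟩
  -- the two germs at the center
  have hgerm : ∀ (F : ∀ j, Filter (ζ.G j)) (b : Fin m) (υ : ℝ → ζ.Solenoid), F ∈ Germ z →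
      IsProng h z F b υ → (∀ t ∈ Ico (0 : ℝ) 1, (υ t).1 0 ∈ ζ.proj 0 '' T) →
      ∃ A ∈ Germ y, A 0 = F 0 ∧
        ∀ j, A j = Filter.map (fun t => (e ((υ t).1 0)).1 j) (𝓝[>] 0) := by
    intro F b υ hF hυ hυT
    have hc : ContinuousOn (fun t => e ((υ t).1 0)) (Ico 0 1) :=
      hec.comp ((continuous_coord 0).comp_continuousOn hυ.cont) hυT
    have htend : Tendsto (fun t => e ((υ t).1 0)) (𝓝[>] 0) (𝓝 y) := by
      have := hc 0 zero_mem_Ico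
      unfold ContinuousWithinAt at this
      beta_reduce at this
      rw [hυ.zero] at this
      rw [← nhdsWithin_Ioo_eq_nhdsGT one_pos]
      exact this.mono_left (nhdsWithin_mono _ Ioo_subset_Ico_self)
    have h01 : ∀ᶠ t in 𝓝[>] (0 : ℝ), t ∈ Ioo (0 : ℝ) 1 := Ioo_mem_nhdsGT one_pos
    refine ⟨_, germ_of_path (k := 0) one_pos (hc.mono Ioo_subset_Ico_self) htend ?_, ?_,
      fun j => rfl⟩
    · have h₁ : F 0 ≤ 𝓝[≠] (z.1 0) := Dir.le (hF.1 0)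
      rw [← hυ.germ 0] at h₁
      have h₂ : ∀ᶠ t in 𝓝[>] (0 : ℝ), (υ t).1 0 ≠ z.1 0 := h₁ self_mem_nhdsWithin
      filter_upwards [h01, h₂] with t ht hne
      rw [he _ (hυT t (Ioo_subset_Ico_self ht)), hy0]
      exact hne
    · rw [← hυ.germ 0]
      refine map_congr ?_
      filter_upwards [h01] with t ht using he _ (hυT t (Ioo_subset_Ico_self ht))
  obtain ⟨A, hA, hA0, hA'⟩ := hgerm D i σ hD hσ hσT
  obtain ⟨B, hB, hB0, hB'⟩ := hgerm E i' τ hE hτ hτT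
  have hAB : A ≠ B := by
    rintro rfl
    exact hDE (hg.germ_inj hD hE (hA0.symm.trans hB0))
  refine ⟨⟨y, A, hA, B, hB, ?_, hA0, hB0⟩, ?_⟩
  · intro F hF
    by_contra hne
    simp only [mem_insert_iff, mem_singleton_iff, not_or] at hne
    exact hcard ((Set.two_lt_ncard_iff (hg.finite_germ y)).2
      ⟨A, B, F, hA, hB, hF, hAB, Ne.symm hne.1, Ne.symm hne.2⟩)
  -- the coordinate
  obtain ⟨a, α, hα⟩ := H'.exists_prong hyp hA
  obtain ⟨b, β, hβ⟩ := H'.exists_prong hyp hB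
  have hba : b ≠ a := by
    rintro rfl
    exact hAB (prong_index_inj hg hα hβ hA hB)
  obtain ⟨g, hgc, hg₁, hg₂⟩ := exists_coordinate (ζ := ζ) h' a
  have hginj := injOn_coordinate hg H' hyp hcard hA hα hg₁ hg₂
  rw [← hLy] at hginj
  have huc : ContinuousOn (g ∘ e) (ζ.proj 0 '' T) :=
    (hgc.mono hLsub).comp hec fun q hq => heL q hq
  have huinj : InjOn (g ∘ e) (ζ.proj 0 '' T) := fun q hq q' hq' hqq => by
    have := hginj (heL q hq) (heL q' hq') hqq
    rw [← he q hq, ← he q' hq', this]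
  refine ⟨g ∘ e, huc, ?_⟩
  set ψ : ℝ → ℝ := fun t => (g ∘ e) ((turnPath σ τ t).1 0) with hψ
  have hψc : ContinuousOn ψ (Ioo (-1) 1) :=
    huc.comp ((continuous_coord 0).comp_continuousOn
      (continuousOn_turnPath hσ.cont hτ.cont h0)) hmem
  -- injectivity of each half
  have hprong : ∀ (F : ∀ j, Filter (ζ.G j)) (b : Fin m) (υ : ℝ → ζ.Solenoid), F ∈ Germ z →
      IsProng h z F b υ → (∀ t ∈ Ico (0 : ℝ) 1, (υ t).1 0 ∈ ζ.proj 0 '' T) →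
      InjOn (fun t => (g ∘ e) ((υ t).1 0)) (Ioo 0 1) := by
    intro F b υ hF hυ hυT
    refine injOn_Ioo_of_locally_injOn (huc.comp ((continuous_coord 0).comp_continuousOn
      (hυ.cont.mono Ioo_subset_Ico_self)) fun t ht => hυT t (Ioo_subset_Ico_self ht)) ?_
    intro t ht
    have hnat : ¬ IsNaturalVertex (starArc h b t) := fun hnat => H.not_special_arc b ht <| by
      have := ζ.isSpecial_of_isNaturalVertex le_rfl hnat
      rwa [map_self] at this
    -- Open prongs avoid natural vertices, so projection to the top level is locally injective along
    -- them; on an interval this improves to injectivity after composing with the coordinate.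
    obtain ⟨U, hU, hinj⟩ := ζ.exists_injOn_map (Nat.zero_le k) hnat
    have hcont := (continuousOn_starArc h b).continuousAt (Ico_mem_nhds ht.1 ht.2)
    refine ⟨starArc h b ⁻¹' U ∩ Ioo 0 1,
      inter_mem (hcont.preimage_mem_nhds hU) (Ioo_mem_nhds ht.1 ht.2), ?_⟩
    intro s hs s' hs' hss
    have h₁ := huinj (hυT s (Ioo_subset_Ico_self hs.2)) (hυT s' (Ioo_subset_Ico_self hs'.2)) hss
    rw [← ζ.map_proj (Nat.zero_le k) (υ s), ← ζ.map_proj (Nat.zero_le k) (υ s'),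
      hυ.proj s (Ioo_subset_Ico_self hs.2), hυ.proj s' (Ioo_subset_Ico_self hs'.2)] at h₁
    exact starArc_injOn h b hs.2 hs'.2 (hinj hs.1 hs'.1 h₁)
  have hσinj := hprong D i σ hD hσ hσT
  have hτinj := hprong E i' τ hE hτ hτT
  -- signs near the center
  have hsign : ∀ (F : ∀ j, Filter (ζ.G j)) (c : Fin m') (υ γ : ℝ → ζ.Solenoid),
      F k' = Filter.map (fun t => (e ((υ t).1 0)).1 k') (𝓝[>] 0) → IsProng h' y F c γ →
      ∀ᶠ t in 𝓝[>] (0 : ℝ), ∃ s ∈ Ioo (0 : ℝ) 1, (e ((υ t).1 0)).1 k' = starArc h' c s := by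
    intro F c υ γ hF hγ
    have h₁ : starArc h' c '' Ioo 0 1 ∈ F k' := by
      rw [← hγ.germ k']
      refine mem_map.2 ?_
      filter_upwards [Ioo_mem_nhdsGT one_pos] with t ht
      exact ⟨t, ht, (hγ.proj t (Ioo_subset_Ico_self ht)).symm⟩
    rw [hF] at h₁
    have h₂ : ∀ᶠ t in 𝓝[>] (0 : ℝ), (e ((υ t).1 0)).1 k' ∈ starArc h' c '' Ioo 0 1 := h₁
    filter_upwards [h₂] with t ⟨s, hs, ht⟩ using ⟨s, hs, ht.symm⟩
  have hpos : ∀ᶠ t in 𝓝[>] (0 : ℝ), 0 < (g ∘ e) ((σ t).1 0) := by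
    filter_upwards [hsign A a σ α (hA' k') hα] with t ⟨s, hs, ht⟩
    rw [Function.comp_apply, hg₁ _ s (Ioo_subset_Ico_self hs) ht]
    exact hs.1
  have hneg : ∀ᶠ t in 𝓝[>] (0 : ℝ), (g ∘ e) ((τ t).1 0) < 0 := by
    filter_upwards [hsign B b τ β (hB' k') hβ] with t ⟨s, hs, ht⟩
    rw [Function.comp_apply, hg₂ b hba _ s (Ioo_subset_Ico_self hs) ht]
    linarith [hs.1]
  have hzero : ψ 0 = 0 := by
    simp only [hψ, Function.comp_apply]
    rw [turnPath_of_nonneg _ _ le_rfl, hσ.zero]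
    exact hg₁ _ 0 zero_mem_Ico (by rw [← hy, hyp, H'.center])
  obtain ⟨ε, hε, hεp⟩ := mem_nhdsGT_iff_exists_Ioo_subset.1 (hpos.and hneg)
  have hψσ : ∀ t, 0 ≤ t → ψ t = (g ∘ e) ((σ t).1 0) := fun t ht => by
    simp only [hψ]; rw [turnPath_of_nonneg _ _ ht]
  have hψτ : ∀ t, t < 0 → ψ t = (g ∘ e) ((τ (-t)).1 0) := fun t ht => by
    simp only [hψ]; rw [turnPath_of_neg _ _ ht]
  have hψp : ∀ s ∈ Ioo (0 : ℝ) 1, ∀ t ∈ Ioo (0 : ℝ) 1, ψ s = ψ t → s = t := by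
    intro s hs t ht hst
    rw [hψσ s hs.1.le, hψσ t ht.1.le] at hst
    exact hσinj hs ht hst
  have hψn : ∀ s ∈ Ioo (-1 : ℝ) 0, ∀ t ∈ Ioo (-1 : ℝ) 0, ψ s = ψ t → s = t := by
    intro s hs t ht hst
    rw [hψτ s hs.2, hψτ t ht.2] at hst
    exact neg_injective (hτinj ⟨by linarith [hs.2], by linarith [hs.1]⟩
      ⟨by linarith [ht.2], by linarith [ht.1]⟩ hst)
  -- Each half is injective, and near `0` the two halves have opposite signs, as `A` and `B` lie
  -- over different prongs. So `ψ` is locally injective on the whole interval.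
  refine isEmbedding_of_injOn_Ioo hψc (injOn_Ioo_of_locally_injOn hψc fun t ht => ?_)
  have hε : 0 < ε := hε
  rcases lt_trichotomy t 0 with h | rfl | h
  · exact ⟨Ioo (-1) 0, Ioo_mem_nhds ht.1 h, fun s hs s' hs' hss => hψn s hs s' hs' hss⟩
  · have hsgn : ∀ s ∈ Ioo (-ε) ε, (0 < s → 0 < ψ s) ∧ (s < 0 → ψ s < 0) := by
      intro s hs
      refine ⟨fun h => ?_, fun h => ?_⟩
      · rw [hψσ s h.le]
        exact (hεp (show s ∈ Ioo 0 ε from ⟨h, hs.2⟩)).1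
      · rw [hψτ s h]
        exact (hεp (show -s ∈ Ioo 0 ε from ⟨by linarith, by linarith [hs.1]⟩)).2
    refine ⟨Ioo (-ε) ε ∩ Ioo (-1) 1, inter_mem (Ioo_mem_nhds (by linarith) hε)
      (Ioo_mem_nhds ht.1 ht.2), fun s hs s' hs' hss => ?_⟩
    have h₁ := hsgn s hs.1
    have h₂ := hsgn s' hs'.1
    rcases lt_trichotomy s 0 with h | rfl | h <;> rcases lt_trichotomy s' 0 with h' | rfl | h'
    · exact hψn s ⟨hs.2.1, h⟩ s' ⟨hs'.2.1, h'⟩ hss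
    · linarith [h₁.2 h]
    · linarith [h₁.2 h, h₂.1 h']
    · linarith [h₂.2 h']
    · rfl
    · linarith [h₂.1 h']
    · linarith [h₁.1 h, h₂.2 h']
    · linarith [h₁.1 h]
    · exact hψp s ⟨h, hs.2.2⟩ s' ⟨h', hs'.2.2⟩ hss
  · exact ⟨Ioo 0 1, Ioo_mem_nhds h ht.2, fun s hs s' hs' hss => hψp s hs s' hs' hss⟩

/-- The homeomorphism of two images of an interval that lie over a common embedding. -/
theorem exists_homeomorph_of_common {α X Y Z : Type*} [TopologicalSpace α] [TopologicalSpace X]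
    [TopologicalSpace Y] [TopologicalSpace Z] {c : α → X} {d : α → Y} {u : X → Z} {v : Y → Z}
    (hc : Continuous c) (hd : Continuous d) (hcs : Function.Surjective c)
    (hds : Function.Surjective d) (hu : Continuous u) (hv : Continuous v)
    (huc : IsEmbedding (u ∘ c)) (hvd : IsEmbedding (v ∘ d)) :
    ∃ l : X ≃ₜ Y, ∀ a, l (c a) = d a := by
  have hc' : IsEmbedding c := .of_comp hc hu huc
  have hd' : IsEmbedding d := .of_comp hd hv hvd
  refine ⟨(hc'.toHomeomorphOfSurjective hcs).symm.trans (hd'.toHomeomorphOfSurjective hds),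
    fun a => ?_⟩
  rw [Homeomorph.trans_apply]
  have : (hc'.toHomeomorphOfSurjective hcs).symm (c a) = a := by
    rw [Homeomorph.symm_apply_eq]; rfl
  rw [this]
  rfl

/-- The leaf segment at the top matches the germs of `L` at level zero, and goodness yields a point
`w`, with no other germs, matching them at a deeper level. The plaque of `w` in the standard
neighborhood of `L` is a leaf segment whose prongs project like those of `L` down to that level. The
coordinate from the top level makes the resulting section a homeomorphism. -/
theorem isTaken_of_isTaken_zero (hg : ζ.IsGood) {L : Set ζ.Solenoid}
    (hL : ζ.IsSingularSegment L) (h0 : ζ.IsTaken (ζ.proj 0 '' L)) (j : ℕ) :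
    ζ.IsTaken (ζ.proj j '' L) := by
  obtain ⟨k, V, m, h, p, z, D, E, i, i', σ, τ, hnb, H, hz, hpre, hD, hE, hDE, hσ, hτ, rfl⟩ :=
    exists_prongs_of_isSingularSegment hg hL
  obtain ⟨htk, u, huc, hemb⟩ := exists_embedding_of_sustains hg H hpre hD hE hDE hσ hτ h0
  -- Matching at level `k` places `w` over the center of the chart; matching at level `j` is needed
  -- to take the image of `L` there.
  obtain ⟨w, A, hA, B, hB, hAB, hAD, hBE⟩ := hg.taken z hpre D hD E hE htk (max k j)
  have hkM : k ≤ max k j := le_max_left _ _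
  have hwk : w.1 k = p := by
    have h₁ : D k ∈ Dir (w.1 k) := by
      rw [← Germ.eq_of_le hA hD hkM hAD]
      exact hA.1 k
    rw [← Dir.eq_of_mem (hD.1 k) h₁, hz]
  obtain ⟨a, α, hα⟩ := H.exists_prong hwk hA
  obtain ⟨b, β, hβ⟩ := H.exists_prong hwk hB
  have hασ := H.prong_coord_eq hα hσ hA hD hkM hAD
  have hβτ := H.prong_coord_eq hβ hτ hB hE hkM hBE
  have hστ0 : σ 0 = τ 0 := by rw [hσ.zero, hτ.zero]
  have hαβ0 : α 0 = β 0 := by rw [hα.zero, hβ.zero]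
  have hcoord : ∀ l ≤ max k j, ∀ t ∈ Ioo (-1 : ℝ) 1,
      (turnPath α β t).1 l = (turnPath σ τ t).1 l := by
    intro l hl t ht
    rcases le_or_gt 0 t with h | h
    · rw [turnPath_of_nonneg _ _ h, turnPath_of_nonneg _ _ h]
      exact hασ l hl t ⟨h, ht.2⟩
    · rw [turnPath_of_neg _ _ h, turnPath_of_neg _ _ h]
      exact hβτ l hl (-t) ⟨by linarith, by linarith [ht.1]⟩
  have hplaque : pathComponentIn (ζ.proj k ⁻¹' V) w = α '' Ico 0 1 ∪ β '' Ico 0 1 := by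
    ext y
    constructor
    · intro hy
      rcases (H.mem_pathComponentIn_iff hwk).1 hy with rfl | ⟨F, hF, t, ht, hy⟩
      · exact Or.inl ⟨0, zero_mem_Ico, hα.zero⟩
      · rcases hAB hF with rfl | rfl
        · exact Or.inl ⟨t, Ioo_subset_Ico_self ht, hy a α hα⟩
        · exact Or.inr ⟨t, Ioo_subset_Ico_self ht, hy b β hβ⟩
    · rintro (⟨t, ht, rfl⟩ | ⟨t, ht, rfl⟩)
      · exact IsStandardChart.joined_prong hα ht
      · exact IsStandardChart.joined_prong hβ ht
  have hwV : w ∈ ζ.proj k ⁻¹' V := by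
    have : w.1 k ∈ V := hwk ▸ H.center_mem
    exact this
  refine ⟨pathComponentIn (ζ.proj k ⁻¹' V) w, ⟨⟨_, hnb, w, hwV, rfl⟩, ?_⟩, ?_⟩
  · rintro ⟨-, x, hx, _, -, h₂, c, -, rfl⟩
    have hxz : JoinedIn (ζ.proj k ⁻¹' V) w (h₂ c) := (h₂ c).2
    obtain ⟨M, hM, hs⟩ := hx _ hnb hxz.mem.2
    rw [pathComponentIn_congr hxz] at hs
    have h₃ := two_lt_ncard_germ hg H hwk hM hs
    have h₄ : (Germ w).ncard ≤ ({A, B} : Set _).ncard := ncard_le_ncard hAB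
    have h₅ : ({A, B} : Set (∀ j, Filter (ζ.G j))).ncard ≤ 2 :=
      (ncard_insert_le A {B}).trans (by rw [ncard_singleton])
    omega
  · rw [hplaque]
    have hT₁ := image_turnPath hστ0
    have hT₂ := image_turnPath hαβ0
    have hc₁ := continuousOn_turnPath hσ.cont hτ.cont hστ0
    have hc₂ := continuousOn_turnPath hα.cont hβ.cont hαβ0
    set T := σ '' Ico 0 1 ∪ τ '' Ico 0 1
    set S := α '' Ico 0 1 ∪ β '' Ico 0 1
    have hm₁ : ∀ t : Ioo (-1 : ℝ) 1, turnPath σ τ t ∈ T := fun t => hT₁ ▸ mem_image_of_mem _ t.2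
    have hm₂ : ∀ t : Ioo (-1 : ℝ) 1, turnPath α β t ∈ S := fun t => hT₂ ▸ mem_image_of_mem _ t.2
    have hS0 : ∀ y ∈ S, y.1 0 ∈ ζ.proj 0 '' T := by
      rw [← hT₂, ← hT₁]
      rintro _ ⟨t, ht, rfl⟩
      rw [hcoord 0 (Nat.zero_le _) t ht]
      exact mem_image_of_mem (ζ.proj 0) (mem_image_of_mem _ ht)
    have hT0 : ∀ q ∈ ζ.proj j '' T, ζ.map (Nat.zero_le j) q ∈ ζ.proj 0 '' T := by
      rintro _ ⟨y, hy, rfl⟩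
      exact ⟨y, hy, (ζ.map_proj (Nat.zero_le j) y).symm⟩
    -- Both the turn of `L` seen at level `j` and the plaque of `w` become the embedding `hemb`
    -- after projection to level zero and `u`.
    obtain ⟨l, hl⟩ := exists_homeomorph_of_common (α := Ioo (-1 : ℝ) 1)
      (c := fun t => (⟨(turnPath σ τ t).1 j, mem_image_of_mem (ζ.proj j) (hm₁ t)⟩ :
        ζ.proj j '' T))
      (d := fun t => (⟨turnPath α β t, hm₂ t⟩ : S))
      (u := fun q => u (ζ.map (Nat.zero_le j) q)) (v := fun y => u (y.1.1 0))
      (((continuous_coord j).comp (continuousOn_iff_continuous_domRestrict.1 hc₁)).subtype_mk _)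
      ((continuousOn_iff_continuous_domRestrict.1 hc₂).subtype_mk _)
      (by
        rintro ⟨_, y, hy, rfl⟩
        rw [← hT₁] at hy
        obtain ⟨t, ht, rfl⟩ := hy
        exact ⟨⟨t, ht⟩, rfl⟩)
      (by
        rintro ⟨y, hy⟩
        obtain ⟨t, ht, rfl⟩ := hT₂ ▸ hy
        exact ⟨⟨t, ht⟩, rfl⟩)
      (huc.comp_continuous ((ζ.continuous_map _).comp continuous_subtype_val)
        fun q => hT0 q q.2)
      (huc.comp_continuous ((continuous_coord 0).comp continuous_subtype_val)
        fun y => hS0 y y.2)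
      (by
        convert hemb using 1
        funext t
        exact congrArg u (ζ.map_proj (Nat.zero_le j) _))
      (by
        convert hemb using 1
        funext t
        exact congrArg u (hcoord 0 (Nat.zero_le _) t t.2))
    refine ⟨l, ?_⟩
    rintro ⟨_, y, hy, rfl⟩
    rw [← hT₁] at hy
    obtain ⟨t, ht, rfl⟩ := hy
    have := hl ⟨t, ht⟩
    change ζ.proj j (l ⟨(turnPath σ τ t).1 j, _⟩ : ζ.Solenoid) = (turnPath σ τ t).1 j
    rw [this]
    exact hcoord j (le_max_right _ _) t ht

theorem IsGood.turnStabilized (hg : ζ.IsGood) : ζ.TurnStabilized := by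
  refine fun k I hI => ⟨not_isStarSet_three_over_turn hg hI, fun L hL _ => ?_⟩
  by_cases h0 : ζ.IsTaken (ζ.proj 0 '' L)
  · exact Or.inl ⟨isTaken_of_isTaken_zero hg hL h0, not_not.2 h0⟩
  · exact Or.inr ⟨h0, fun h => h0 (h 0)⟩

end SplitSequence

namespace SplitSequence

open SplitSeq

variable {n : ℕ} {ζ : SplitSequence.{u} n}

/-! ## Finiteness -/

variable (ζ) in
theorem exists_dirBound : ∃ C, ∀ k, DirBound (ζ.G k) C := by
  obtain ⟨C, hC⟩ := (ζ.graph 0).exists_dirBound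
  refine ⟨C, fun k => ?_⟩
  induction k with
  | zero => exact hC
  | succ k ih => exact (ζ.fold k).dirBound (ζ.core (k + 1)) (ζ.graph k) ih

theorem eventually_coord_ne {x y : ζ.Solenoid} (h : x ≠ y) : ∀ᶠ j in atTop, x.1 j ≠ y.1 j := by
  obtain ⟨k, hk⟩ : ∃ k, x.1 k ≠ y.1 k := by
    by_contra! hcon
    exact h (solenoid_ext (k := 0) fun j _ => hcon j)
  filter_upwards [eventually_ge_atTop k] with j hj he
  exact hk (by rw [← ζ.map_proj hj x, ← ζ.map_proj hj y, he])

theorem eventually_germ_ne {x : ζ.Solenoid} {D E : ∀ j, Filter (ζ.G j)} (hD : D ∈ Germ x)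
    (hE : E ∈ Germ x) (h : D ≠ E) : ∀ᶠ j in atTop, D j ≠ E j := by
  obtain ⟨k, hk⟩ := Function.ne_iff.1 h
  filter_upwards [eventually_ge_atTop k] with j hj he
  exact hk (Germ.eq_of_le hD hE hj he)

variable (ζ) in
-- If there were `C + 1` of them, at a deep level they would be distinct natural vertices, and `3 *
-- (C + 1) ≤ 2 * (C + 1) + C` fails.
theorem finite_preSingularities : {x | ζ.IsPreSingularity x}.Finite := by
  classical
  obtain ⟨C, hC⟩ := ζ.exists_dirBound
  by_contra hinf
  obtain ⟨S, hS, hcard⟩ := (show Set.Infinite _ from hinf).exists_subset_card_eq (C + 1)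
  have h₁ : ∀ᶠ j in atTop, ∀ x ∈ S, IsNaturalVertex (x.1 j) := by
    refine (eventually_all_finset S).2 fun x hx => ?_
    obtain ⟨k, hk⟩ := hS hx
    filter_upwards [eventually_ge_atTop k] with j hj using hk j hj
  have h₂ : ∀ᶠ j in atTop, ∀ x ∈ S, ∀ y ∈ S, x ≠ y → x.1 j ≠ y.1 j := by
    refine (eventually_all_finset S).2 fun x _ => (eventually_all_finset S).2 fun y _ => ?_
    by_cases h : x = y
    · exact Eventually.of_forall fun j hne => absurd h hne
    · exact (eventually_coord_ne h).mono fun j hj _ => hj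
  obtain ⟨j, hn, hne⟩ := (h₁.and h₂).exists
  have hinj : InjOn (fun x : ζ.Solenoid => x.1 j) S := fun x hx y hy he => by
    by_contra h
    exact hne x hx y hy h he
  have hbound := hC j (S.image fun x => x.1 j)
  rw [Finset.card_image_of_injOn hinj, hcard] at hbound
  have hlow : (S.image fun x => x.1 j).card • 3 ≤
      ∑ p ∈ S.image fun x => x.1 j, (Dir p).ncard := by
    refine Finset.card_nsmul_le_sum _ _ _ fun p hp => ?_
    obtain ⟨x, hx, rfl⟩ := Finset.mem_image.1 hp
    exact (ζ.graph j).isNaturalVertex_iff.1 (hn x hx)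
  rw [Finset.card_image_of_injOn hinj, hcard, smul_eq_mul] at hlow
  omega

/-- Among `C + 3` germs all would be different directions at one deep coordinate, where the valence
is at most `C + 2`. -/
theorem finite_germ (x : ζ.Solenoid) : (Germ x).Finite := by
  classical
  obtain ⟨C, hC⟩ := ζ.exists_dirBound
  by_contra hinf
  obtain ⟨S, hS, hcard⟩ := (show Set.Infinite _ from hinf).exists_subset_card_eq (C + 3)
  have h₂ : ∀ᶠ j in atTop, ∀ D ∈ S, ∀ E ∈ S, D ≠ E → D j ≠ E j := by
    refine (eventually_all_finset S).2 fun D hD => (eventually_all_finset S).2 fun E hE => ?_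
    by_cases h : D = E
    · exact Eventually.of_forall fun j hne => absurd h hne
    · exact (eventually_germ_ne (hS hD) (hS hE) h).mono fun j hj _ => hj
  obtain ⟨j, hne⟩ := h₂.exists
  have hle : (S : Set (∀ j, Filter (ζ.G j))).ncard ≤ (Dir (x.1 j)).ncard :=
    Set.ncard_le_ncard_of_injOn (fun D => D j) (fun D hD => (hS hD).1 j)
      (fun D hD E hE he => by
        by_contra h
        exact hne D hD E hE h he) ((ζ.graph j).finite_dir _)
  rw [Set.ncard_coe_finset, hcard] at hle
  have hbound := hC j {x.1 j}
  rw [Finset.sum_singleton, Finset.card_singleton] at hbound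
  omega

/-- Agreement of directions passes to smaller indices. Hence failure at one level persists at all
deeper ones, which is the monotonicity behind stabilization. -/
theorem IsTakenGerm.of_le {x : ζ.Solenoid} {D E : ∀ j, Filter (ζ.G j)} (hD : D ∈ Germ x)
    (hE : E ∈ Germ x) {j k : ℕ} (h : j ≤ k) (ht : IsTakenGerm D E k) : IsTakenGerm D E j := by
  obtain ⟨y, A, hA, B, hB, hAB, h₁, h₂⟩ := ht
  exact ⟨y, A, hA, B, hB, hAB, Germ.eq_of_le hA hD h h₁, Germ.eq_of_le hB hE h h₂⟩

/-! ## Tails -/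

variable (ζ) in
theorem f_map_add (K j : ℕ) (w : ζ.G (K + (j + 1))) :
    ζ.f j (ζ.map (Nat.le_add_left (j + 1) K) w) =
      ζ.map (Nat.le_add_left j K) (ζ.f (K + j) w) := by
  rw [← ζ.map_one, ζ.map_map]
  exact ζ.map_succ (Nat.le_add_left j K) w

variable (ζ) in
theorem tail_map (K : ℕ) {j k : ℕ} (h : j ≤ k) (x : ζ.G (K + k)) :
    (ζ.tail K).map h x = ζ.map (Nat.add_le_add_left h K) x := by
  induction k, h using Nat.le_induction with
  | base => exact ((ζ.tail K).map_self j x).trans (ζ.map_self (K + j) x).symm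
  | succ k h ih =>
    exact ((ζ.tail K).map_succ h x).trans ((ih (ζ.f (K + k) x)).trans
      (ζ.map_succ (Nat.add_le_add_left h K) x).symm)

variable (ζ) in
/-- The canonical homeomorphism between the solenoids of a split sequence and of its tail. -/
def tailHomeomorph (K : ℕ) : ζ.Solenoid ≃ₜ (ζ.tail K).Solenoid where
  toFun := ζ.toTail K
  invFun x := ⟨fun j => ζ.map (Nat.le_add_left j K) (x.1 j), fun j =>
    (ζ.f_map_add K j (x.1 (j + 1))).trans (congrArg (ζ.map (Nat.le_add_left j K)) (x.2 j))⟩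
  left_inv x := Subtype.ext (funext fun j => ζ.map_proj (Nat.le_add_left j K) x)
  right_inv x := Subtype.ext <| funext fun j =>
    (ζ.tail_map K (Nat.le_add_left j K) (x.1 (K + j))).symm.trans
      ((ζ.tail K).map_proj (Nat.le_add_left j K) x)
  continuous_toFun := (continuous_pi fun k => continuous_coord (K + k)).subtype_mk _
  continuous_invFun := (continuous_pi fun j =>
    (ζ.continuous_map _).comp (continuous_coord (ζ := ζ.tail K) j)).subtype_mk _

theorem exists_toTail_eq (K : ℕ) (y : (ζ.tail K).Solenoid) : ∃ x, ζ.toTail K x = y :=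
  (ζ.tailHomeomorph K).surjective y

theorem isPreSingularity_toTail {K : ℕ} {x : ζ.Solenoid}
    (h : (ζ.tail K).IsPreSingularity (ζ.toTail K x)) : ζ.IsPreSingularity x := by
  obtain ⟨k, hk⟩ := h
  refine ⟨K + k, fun j hj => ?_⟩
  obtain ⟨i, rfl⟩ := Nat.exists_eq_add_of_le hj
  rw [add_assoc]
  exact hk (k + i) (Nat.le_add_right k i)

theorem germ_toTail {K : ℕ} {x : ζ.Solenoid} {D : ∀ j, Filter (ζ.G j)} (hD : D ∈ Germ x) :
    (fun j => D (K + j)) ∈ Germ (ζ := ζ.tail K) (ζ.toTail K x) :=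
  ⟨fun j => hD.1 (K + j), fun j => hD.2 (K + j)⟩

theorem exists_germ_of_toTail {K : ℕ} {x : ζ.Solenoid} {F : ∀ j, Filter ((ζ.tail K).G j)}
    (hF : F ∈ Germ (ζ := ζ.tail K) (ζ.toTail K x)) :
    ∃ D ∈ Germ x, F = fun j => D (K + j) := by
  refine ⟨fun j => Filter.map (ζ.map (Nat.le_add_left j K)) (F j), ⟨fun j => ?_, fun j => ?_⟩, ?_⟩
  · rw [← ζ.map_proj (Nat.le_add_left j K) x]
    exact ζ.dir_map _ (hF.1 j)
  · have h₁ : ∀ M : Filter (ζ.G (K + (j + 1))),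
        Filter.map (ζ.f j) (Filter.map (ζ.map (Nat.le_add_left (j + 1) K)) M) =
          Filter.map (ζ.map (Nat.le_add_left j K)) (Filter.map (ζ.f (K + j)) M) := fun M => by
      rw [Filter.map_map, Filter.map_map]
      congr 1
      funext w
      exact ζ.f_map_add K j w
    exact (h₁ (F (j + 1))).trans
      (congrArg (Filter.map (ζ.map (Nat.le_add_left j K))) (hF.2 j))
  · funext j
    have h₁ := Germ.map hF (Nat.le_add_left j K)
    have h₂ : (ζ.tail K).map (Nat.le_add_left j K) =
        ζ.map (Nat.add_le_add_left (Nat.le_add_left j K) K) := funext fun w => ζ.tail_map K _ w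
    rw [h₂] at h₁
    exact h₁.symm

theorem Germ.ext_tail {K : ℕ} {x y : ζ.Solenoid} {D E : ∀ j, Filter (ζ.G j)} (hD : D ∈ Germ x)
    (hE : E ∈ Germ y) (h : (fun j => D (K + j)) = fun j => E (K + j)) : D = E := by
  refine Germ.ext hD hE (k := K) fun j hj => ?_
  obtain ⟨i, rfl⟩ := Nat.exists_eq_add_of_le hj
  exact congrFun h i

theorem isTakenGerm_tail_iff {K : ℕ} {D E : ∀ j, Filter (ζ.G j)} {j : ℕ} :
    IsTakenGerm (ζ := ζ.tail K) (fun j => D (K + j)) (fun j => E (K + j)) j ↔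
      IsTakenGerm D E (K + j) := by
  constructor
  · rintro ⟨y, A, hA, B, hB, hAB, h₁, h₂⟩
    obtain ⟨y, rfl⟩ := exists_toTail_eq K y
    obtain ⟨A, hA', rfl⟩ := exists_germ_of_toTail hA
    obtain ⟨B, hB', rfl⟩ := exists_germ_of_toTail hB
    refine ⟨y, A, hA', B, hB', fun F hF => ?_, h₁, h₂⟩
    rcases hAB (germ_toTail hF) with h | h
    · exact Or.inl (Germ.ext_tail hF hA' h)
    · exact Or.inr (Germ.ext_tail hF hB' h)
  · rintro ⟨y, A, hA, B, hB, hAB, h₁, h₂⟩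
    refine ⟨ζ.toTail K y, _, germ_toTail hA, _, germ_toTail hB, fun F hF => ?_, h₁, h₂⟩
    obtain ⟨F, hF', rfl⟩ := exists_germ_of_toTail hF
    rcases hAB hF' with rfl | rfl
    · exact Or.inl rfl
    · exact Or.inr rfl

/-- The relevant points of level `K` map into the finite set for `ζ`, and the map from level `K` to
the top has finite fibers. -/
theorem isProper_tail (h : ζ.IsProper) (K : ℕ) : (ζ.tail K).IsProper := by
  refine (Set.Finite.preimage' h fun b _ => ζ.finite_fiber (Nat.zero_le K) b).subset ?_
  rintro p ⟨j, hj, v, hv, rfl⟩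
  refine ⟨K + j, by omega, v, hv, ?_⟩
  exact (ζ.map_map (Nat.zero_le K) (Nat.add_le_add_left (Nat.zero_le j) K) v).symm.trans
    (congrArg (ζ.map (Nat.zero_le K)) (ζ.tail_map K (Nat.zero_le j) v).symm)

variable (ζ) in
-- Each clause of goodness concerns finitely many points and germs, and for each of them it holds
-- eventually; so all clauses hold for a common `K`.
theorem exists_isGood_tail : ∃ K, (ζ.tail K).IsGood := by
  have hfin := ζ.finite_preSingularities
  have h₁ : ∀ᶠ K in atTop, ∀ x ∈ {x | ζ.IsPreSingularity x},
      ∀ j, K ≤ j → IsNaturalVertex (x.1 j) := by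
    refine (eventually_all_finite hfin).2 fun x hx => ?_
    obtain ⟨k, hk⟩ := hx
    filter_upwards [eventually_ge_atTop k] with K hK j hj using hk j (hK.trans hj)
  have h₂ : ∀ᶠ K in atTop, ∀ x ∈ {x | ζ.IsPreSingularity x}, ∀ y ∈ {x | ζ.IsPreSingularity x},
      x.1 K = y.1 K → x = y := by
    refine (eventually_all_finite hfin).2 fun x _ => (eventually_all_finite hfin).2 fun y _ => ?_
    by_cases h : x = y
    · exact Eventually.of_forall fun _ _ => h
    · exact (eventually_coord_ne h).mono fun j hj he => absurd he hj
  have h₃ : ∀ᶠ K in atTop, ∀ x ∈ {x | ζ.IsPreSingularity x}, ∀ D ∈ Germ x, ∀ E ∈ Germ x,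
      D K = E K → D = E := by
    refine (eventually_all_finite hfin).2 fun x _ => (eventually_all_finite (finite_germ x)).2
      fun D hD => (eventually_all_finite (finite_germ x)).2 fun E hE => ?_
    by_cases h : D = E
    · exact Eventually.of_forall fun _ _ => h
    · exact (eventually_germ_ne hD hE h).mono fun j hj he => absurd he hj
  have h₄ : ∀ᶠ K in atTop, ∀ x ∈ {x | ζ.IsPreSingularity x}, ∀ D ∈ Germ x, ∀ E ∈ Germ x,
      IsTakenGerm D E K → ∀ j, IsTakenGerm D E j := by
    refine (eventually_all_finite hfin).2 fun x _ => (eventually_all_finite (finite_germ x)).2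
      fun D hD => (eventually_all_finite (finite_germ x)).2 fun E hE => ?_
    -- Either the pair is taken at all levels, and the implication is trivial, or it fails at some
    -- `k` and then its premise fails for all `K ≥ k`.
    by_cases h : ∀ j, IsTakenGerm D E j
    · exact Eventually.of_forall fun _ _ => h
    · push Not at h
      obtain ⟨k, hk⟩ := h
      filter_upwards [eventually_ge_atTop k] with K hK ht
      exact absurd (ht.of_le hD hE hK) hk
  obtain ⟨K, hK₁, hK₂, hK₃, hK₄⟩ := (h₁.and (h₂.and (h₃.and h₄))).exists
  refine ⟨K, ⟨?_, ?_, ?_, ?_⟩⟩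
  · intro x hx j
    obtain ⟨x, rfl⟩ := exists_toTail_eq K x
    exact hK₁ x (isPreSingularity_toTail hx) (K + j) (Nat.le_add_right K j)
  · intro x y hx hy hxy
    obtain ⟨x, rfl⟩ := exists_toTail_eq K x
    obtain ⟨y, rfl⟩ := exists_toTail_eq K y
    rw [hK₂ x (isPreSingularity_toTail hx) y (isPreSingularity_toTail hy) hxy]
  · intro x hx D hD E hE hDE
    obtain ⟨x, rfl⟩ := exists_toTail_eq K x
    obtain ⟨D, hD', rfl⟩ := exists_germ_of_toTail hD
    obtain ⟨E, hE', rfl⟩ := exists_germ_of_toTail hE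
    rw [hK₃ x (isPreSingularity_toTail hx) D hD' E hE' hDE]
  · intro x hx D hD E hE ht j
    obtain ⟨x, rfl⟩ := exists_toTail_eq K x
    obtain ⟨D, hD', rfl⟩ := exists_germ_of_toTail hD
    obtain ⟨E, hE', rfl⟩ := exists_germ_of_toTail hE
    exact isTakenGerm_tail_iff.2 (hK₄ x (isPreSingularity_toTail hx) D hD' E hE'
      (isTakenGerm_tail_iff.1 ht) (K + j))

end SplitSequence

theorem mainTheorem10 (n : ℕ) :
    (∀ ζ : SplitSequence.{u} n, ζ.IsProper →
      ∃ K : ℕ, (ζ.tail K).IsStabilizedProper ∧ IsHomeomorph (ζ.toTail K)) ∧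
    (∀ (X : Type v) [TopologicalSpace X], IsProperSolenoid.{u} n X →
      ∃ ζ : SplitSequence.{u} n, ζ.IsStabilizedProper ∧ Nonempty (X ≃ₜ ζ.Solenoid)) := by
  have main : ∀ ζ : SplitSequence.{u} n, ζ.IsProper → ∃ K : ℕ, (ζ.tail K).IsStabilizedProper := by
    intro ζ hζ
    obtain ⟨K, hK⟩ := ζ.exists_isGood_tail
    exact ⟨K, SplitSequence.isProper_tail hζ K, hK.vertexStabilized, hK.turnStabilized⟩
  refine ⟨fun ζ hζ => ?_, ?_⟩
  · obtain ⟨K, hK⟩ := main ζ hζ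
    exact ⟨K, hK, (ζ.tailHomeomorph K).isHomeomorph⟩
  · rintro X _ ⟨ζ, hζ, ⟨φ⟩⟩
    obtain ⟨K, hK⟩ := main ζ hζ
    exact ⟨ζ.tail K, hK, ⟨φ.trans (ζ.tailHomeomorph K)⟩⟩
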